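/- A string C-group of rank $n$ is a group $W$ generated by distinct involutions $s_0,\dots,s_{n-1}$ with $(s_is_j)^2=1$ for $|i-j|>1$ and $\langle s_i\mid i\in I\rangle\cap\langle s_j\mid j\in J\rangle=\langle s_k\mid k\in I\cap J\rangle$ for all $I,J\subseteq\{0,\dots,n-1\}$. Put $H_i=\langle s_j\mid j\ne i\rangle$ for $-1\le i\le n$. Then $\mathcal P(W)$ denotes the poset whose faces of rank $i$ are the cosets $uH_i$, with $uH_i\le vH_j$ if and only if $i\le j$ and $uH_i\cap vH_j\neq\emptyset$; $W$ acts on it by left multiplication. For $N\le W$, $\mathcal P(W)/N$ is the set of $N$-orbits of faces, where two orbits are incident if they have incident representatives. Two flags of an abstract polytope $\mathcal Q$ are $i$-adjacent if they are distinct and differ only in their face of rank $i$. A flag action on $\mathcal Q$ of a group $G$ with distinguished generators $s_i$ is a right action $(\Phi,u)\mapsto\Phi^u$ of $G$ on the flags of $\mathcal Q$ such that $\Phi^{s_i}$ is the flag $i$-adjacent to $\Phi$. For a regular polytope $\mathcal R$ with a base flag $\Psi$, the distinguished generators of $\mathrm{Aut}(\mathcal R)$ are the automorphisms $\rho_i$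 that map $\Psi$ to its $i$-adjacent flag. A covering of polytopes is an order-preserving surjection that preserves ranks and maps $i$-adjacent flags to $i$-adjacent flags. $\mathrm{Core}(G,N)$ is the largest normal subgroup of $G$ contained in $N$. **Theorem.** Let $\mathcal Q$ be one of the 14 sporadic Archimedean polyhedra (the 13 uniform ones other than prisms and antiprisms, obtained combinatorially from the Platonic solids by truncation, full truncation, rhombification and snubbing, together with the pseudorhombicuboctahedron), regarded as an abstract polytope of rank 3 through its face lattice. The faces around each vertex of $\mathcal Q$ have, in cyclic order, the numbers of sides given by the vertex symbol in the table below. There is a finite string C-group $W$ of rank 3 with a flag action on $\mathcal Q$ such that the following hold. 1. $\mathcal P(W)$ is a finite regular polytope of rank 3 and the natural map $W\to\mathrm{Aut}(\mathcal P(W))$ is an isomorphism. 2. $\mathcal P(W)$ has the Schläfli type $\{p,q\}$ in the table, that is, $s_0s_1$ has order $p$ and $s_1s_2$ has order $q$; and $|W|$ is as in the table. 3. For every flag $\Phi$ of $\mathcal Q$, with stabilizer $N=\{w\in W\mid\Phi^w=\Phi\}$, the order $|N|$ is as in the table, $\mathrm{Core}(W,N)=1$, and $\mathcal Q\cong\mathcal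 P(W)/N$. 4. (Minimality) Let $\mathcal R$ be any regular polytope of rank 3 whose automorphism group $U=\mathrm{Aut}(\mathcal R)$, with the distinguished generators $\rho_0,\rho_1,\rho_2$ belonging to some base flag, has a flag action on $\mathcal Q$. Then there is a surjective homomorphism $U\to W$ with $\rho_i\mapsto s_i$ whose kernel is $\mathrm{Core}(U,N_U)$, where $N_U$ is the stabilizer in $U$ of any flag of $\mathcal Q$ (so that $W\cong U/\mathrm{Core}(U,N_U)$), and there is a covering $\mathcal R\to\mathcal P(W)$. | Polyhedron $\mathcal Q$ | Vertex symbol | Type | $\lvert W\rvert$ | $\lvert N\rvert$ | |---|---|---|---|---| | Truncated tetrahedron | $3.6.6$ | $\{6,3\}$ | $144$ | $2$ | | Truncated octahedron | $4.6.6$ | $\{12,3\}$ | $6912$ | $48$ | | Cuboctahedron | $3.4.3.4$ | $\{12,4\}$ | $2304$ | $24$ | | Truncated cube | $3.8.8$ | $\{24,3\}$ | $82944$ | $576$ | | Icosidodecahedron | $3.5.3.5$ | $\{15,4\}$ | $14400$ | $60$ | | Truncated icosahedron | $5.6.6$ | $\{30,3\}$ | $2592000$ | $7200$ | | Small rhombicuboctahedron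 | $3.4.4.4$ | $\{12,4\}$ | $1327104$ | $6912$ | | Pseudorhombicuboctahedron | $3.4.4.4$ | $\{12,4\}$ | $2^{35}3^{5}5^{2}\cdot7\cdot11$ | $2^{29}3^{4}5^{2}\cdot7\cdot11$ | | Snub cube | $3.3.3.3.4$ | $\{12,5\}$ | $2^{32}3^{11}5$ | $2^{28}3^{10}$ | | Small rhombicosidodecahedron | $3.4.5.4$ | $\{60,4\}$ | $207360000$ | $432000$ | | Great rhombicosidodecahedron | $4.6.10$ | $\{60,3\}$ | $559872000000$ | $777600000$ | | Snub dodecahedron | $3.3.3.3.5$ | $\{15,5\}$ | $2^{23}3^{11}5^{11}$ | $2^{20}3^{10}5^{9}$ | | Truncated dodecahedron | $3.10.10$ | $\{30,3\}$ | $2592000$ | $7200$ | | Great rhombicuboctahedron | $4.6.8$ | $\{24,3\}$ | $5308416$ | $18432$ | -/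

import Mathlib

namespace ArchPoly

section Polytopes

variable {P : Type*} [PartialOrder P]

/-- `x` is a face of rank `i`, for `i ≥ 0`. The least face has rank `-1` and height `0`, so a face
of rank `i` has height `i + 1`. -/
def HasRank (i : ℕ) (x : P) : Prop := Order.height x = (i : ℕ∞) + 1

/-- `P` is an abstract polytope of rank `d`. The four fields are the usual axioms: least and greatest
face; every flag has `d + 2` elements; every section of rank at least `2` is connected; the
diamond condition. -/
structure IsPolytope (d : ℕ) (P : Type*) [PartialOrder P] : Prop where
  bounded : (∃ x : P, IsBot x) ∧ ∃ x : P, IsTop x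
  flag_card : ∀ Φ : Flag P, (Φ : Set P).ncard = d + 2
  strongly_connected : ∀ H K : P, H < K → Order.height H + 3 ≤ Order.height K →
    ∀ F ∈ Set.Ioo H K, ∀ G ∈ Set.Ioo H K,
      Relation.ReflTransGen (fun x y => y ∈ Set.Ioo H K ∧ (x < y ∨ y < x)) F G
  diamond : ∀ F G : P, F < G → Order.height G = Order.height F + 2 → (Set.Ioo F G).ncard = 2

/-- A regular polytope: the automorphism group acts transitively on the flags. -/
def IsRegularPolytope (d : ℕ) (P : Type*) [PartialOrder P] : Prop :=
  IsPolytope d P ∧ ∀ Φ Ψ : Flag P, ∃ g : P ≃o P, Flag.map g Φ = Ψ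

/-- `Φ` and `Ψ` are distinct flags that differ only in their face of rank `i`. -/
def Adjacent (i : ℕ) (Φ Ψ : Flag P) : Prop :=
  Φ ≠ Ψ ∧ ∀ x : P, ¬ HasRank i x → (x ∈ Φ ↔ x ∈ Ψ)

/-- The map `act` is the flag action on the flags of `Q` of the group `G` with distinguished
generators `s i`: a right action in which `s i` sends each flag to its `i`-adjacent flag. -/
structure IsFlagAction {G : Type*} [Group G] {n : ℕ} (s : Fin n → G) {Q : Type*} [PartialOrder Q]
    (act : Flag Q → G → Flag Q) : Prop where
  act_one : ∀ Φ, act Φ 1 = Φ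
  act_mul : ∀ Φ u v, act Φ (u * v) = act (act Φ u) v
  act_gen : ∀ Φ (i : Fin n), Adjacent i Φ (act Φ (s i))

/-- The stabilizer of the flag `Φ` under a flag action. -/
def IsFlagAction.stabilizer {G : Type*} [Group G] {n : ℕ} {s : Fin n → G} {Q : Type*}
    [PartialOrder Q] {act : Flag Q → G → Flag Q} (h : IsFlagAction s act) (Φ : Flag Q) :
    Subgroup G where
  carrier := {w | act Φ w = Φ}
  one_mem' := h.act_one Φ
  mul_mem' {u v} hu hv := by
    simp only [Set.mem_ofPred_eq] at hu hv ⊢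
    rw [h.act_mul, hu, hv]
  inv_mem' {u} hu := by
    simp only [Set.mem_ofPred_eq] at hu ⊢
    conv_lhs => rw [← hu]
    rw [← h.act_mul, mul_inv_cancel, h.act_one]

/-- A covering of polytopes: an order-preserving surjection that preserves ranks and maps
`i`-adjacent flags onto `i`-adjacent flags. -/
structure IsCovering {R : Type*} [PartialOrder R] (γ : R → P) : Prop where
  surjective : Function.Surjective γ
  monotone : Monotone γ
  height_eq : ∀ x, Order.height (γ x) = Order.height x
  adjacent : ∀ (i : ℕ) (Φ Ψ : Flag R), Adjacent i Φ Ψ →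
    ∃ Φ' Ψ' : Flag P, (Φ' : Set P) = γ '' Φ ∧ (Ψ' : Set P) = γ '' Ψ ∧ Adjacent i Φ' Ψ'

/-- Every vertex `v` of the 3-polytope `Q` has the symbol `p₁.p₂.….pₖ` (the list `l`): the 2-faces
that contain `v` are `F 0, …, F (k - 1)`, cyclically consecutive ones share an edge at `v`, and the
number of vertices of `F i` is the entry of `l` in position `i`. -/
def HasVertexSymbol (Q : Type*) [PartialOrder Q] (l : List ℕ) : Prop :=
  ∀ v : Q, HasRank 0 v → ∃ F : Fin l.length → Q, Function.Injective F ∧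
    (∀ G : Q, (HasRank 2 G ∧ v < G) ↔ ∃ i, F i = G) ∧
    (∀ i, ∃ e : Q, HasRank 1 e ∧ v < e ∧ e < F i ∧ e < F (finRotate _ i)) ∧
    ∀ i, {u : Q | HasRank 0 u ∧ u < F i}.ncard = l.get i

end Polytopes

/-- A string C-group: a group `W` generated by distinct involutions `gen 0, …, gen (n - 1)` with the
intersection property, in which generators with non-consecutive indices commute. -/
structure StringCGroup (W : Type*) [Group W] (n : ℕ) where
  gen : Fin n → W
  gen_injective : Function.Injective gen
  orderOf_gen : ∀ i, orderOf (gen i) = 2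
  closure_gen : Subgroup.closure (Set.range gen) = ⊤
  inter : ∀ I J : Set (Fin n),
    Subgroup.closure (gen '' I) ⊓ Subgroup.closure (gen '' J) = Subgroup.closure (gen '' (I ∩ J))
  string : ∀ i j : Fin n, (i : ℕ) + 1 < j → (gen i * gen j) ^ 2 = 1

namespace StringCGroup

variable {W : Type*} [Group W] {n : ℕ} (S : StringCGroup W n)

/-- The subgroup generated by all `gen j` except the one with `j + 1 = k`; it is the stabilizer of the
base face of rank `k - 1`. For `k = 0` and `k = n + 1` it is the whole group. -/
def faceStab (k : Fin (n + 2)) : Subgroup W :=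
  Subgroup.closure (S.gen '' {j | (j : ℕ) + 1 ≠ k})

/-- The faces of the regular polytope `P(W)`: a face of rank `level - 1` is a left coset of
`faceStab level`. -/
@[ext]
structure Face where
  level : Fin (n + 2)
  coset : W ⧸ S.faceStab level

variable {S}

/-- Faces are incident when their cosets meet. -/
instance : LE S.Face :=
  ⟨fun F G => F.level ≤ G.level ∧ ∃ w : W, F.coset = (w : W ⧸ S.faceStab F.level) ∧
    G.coset = (w : W ⧸ S.faceStab G.level)⟩

theorem le_def (F G : S.Face) : F ≤ G ↔ F.level ≤ G.level ∧
    ∃ w : W, F.coset = (w : W ⧸ S.faceStab F.level) ∧ G.coset = (w : W ⧸ S.faceStab G.level) :=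
  Iff.rfl

theorem gen_mul_self (i : Fin n) : S.gen i * S.gen i = 1 := by
  have h := pow_orderOf_eq_one (S.gen i)
  rwa [S.orderOf_gen, pow_two] at h

theorem gen_comm {i j : Fin n} (h : (i : ℕ) + 1 < j) : S.gen i * S.gen j = S.gen j * S.gen i := by
  have hs := S.string i j h
  have hi : (S.gen i)⁻¹ = S.gen i := inv_eq_of_mul_eq_one_left (gen_mul_self i)
  have hj : (S.gen j)⁻¹ = S.gen j := inv_eq_of_mul_eq_one_left (gen_mul_self j)
  rw [pow_two] at hs
  have h2 := eq_inv_of_mul_eq_one_left hs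
  rwa [mul_inv_rev, hi, hj] at h2

theorem comm_of_mem {k : ℕ} {u v : W}
    (hu : u ∈ Subgroup.closure (S.gen '' {j | k < (j : ℕ) + 1}))
    (hv : v ∈ Subgroup.closure (S.gen '' {j | (j : ℕ) + 1 < k})) : u * v = v * u := by
  have h1 : Subgroup.closure (S.gen '' {j | (j : ℕ) + 1 < k}) ≤
      Subgroup.centralizer (S.gen '' {j | k < (j : ℕ) + 1}) := by
    rw [Subgroup.closure_le]
    rintro _ ⟨i, hi, rfl⟩
    rw [SetLike.mem_coe, Subgroup.mem_centralizer_iff]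
    rintro _ ⟨j, hj, rfl⟩
    simp only [Set.mem_ofPred_eq] at hi hj
    exact (gen_comm (by omega)).symm
  have h2 : Subgroup.closure (S.gen '' {j | k < (j : ℕ) + 1}) ≤ Subgroup.centralizer {v} := by
    rw [Subgroup.closure_le]
    intro x hx
    rw [SetLike.mem_coe, Subgroup.mem_centralizer_iff]
    rintro _ rfl
    exact (Subgroup.mem_centralizer_iff.1 (h1 hv) x hx).symm
  exact (Subgroup.mem_centralizer_iff.1 (h2 hu) v rfl).symm

theorem exists_factor {k : Fin (n + 2)} {x : W} (hx : x ∈ S.faceStab k) :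
    ∃ u ∈ Subgroup.closure (S.gen '' {j | (k : ℕ) < (j : ℕ) + 1}),
    ∃ v ∈ Subgroup.closure (S.gen '' {j | (j : ℕ) + 1 < (k : ℕ)}), x = u * v := by
  induction hx using Subgroup.closure_induction with
  | mem x hx =>
    obtain ⟨j, hj, rfl⟩ := hx
    simp only [Set.mem_ofPred_eq] at hj
    rcases lt_or_gt_of_ne hj with h | h
    · exact ⟨1, one_mem _, _, Subgroup.subset_closure ⟨j, h, rfl⟩, (one_mul _).symm⟩
    · exact ⟨_, Subgroup.subset_closure ⟨j, h, rfl⟩, 1, one_mem _, (mul_one _).symm⟩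
  | one => exact ⟨1, one_mem _, 1, one_mem _, (one_mul _).symm⟩
  | mul x y _ _ hx hy =>
    obtain ⟨u, hu, v, hv, rfl⟩ := hx
    obtain ⟨u', hu', v', hv', rfl⟩ := hy
    refine ⟨u * u', mul_mem hu hu', v * v', mul_mem hv hv', ?_⟩
    have := comm_of_mem hu' hv
    simp only [mul_assoc]
    rw [← mul_assoc v, ← this, mul_assoc]
  | inv x _ hx =>
    obtain ⟨u, hu, v, hv, rfl⟩ := hx
    refine ⟨u⁻¹, inv_mem hu, v⁻¹, inv_mem hv, ?_⟩
    rw [mul_inv_rev, comm_of_mem (inv_mem hu) (inv_mem hv)]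

instance : PartialOrder S.Face where
  le_refl F := by
    obtain ⟨w, hw⟩ := QuotientGroup.mk_surjective F.coset
    exact ⟨le_rfl, w, hw.symm, hw.symm⟩
  le_trans := by
    rintro ⟨i, a⟩ ⟨j, b⟩ ⟨k, c⟩ ⟨hij, x, hax, hbx⟩ ⟨hjk, y, hby, hcy⟩
    simp only at hij hjk hax hbx hby hcy
    subst hax hbx hcy
    have hxy := QuotientGroup.eq.1 hby
    obtain ⟨u, hu, v, hv, huv⟩ := exists_factor hxy
    have hu' : u ∈ S.faceStab i := by
      refine Subgroup.closure_mono (Set.image_mono ?_) hu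
      intro l hl
      simp only [Set.mem_ofPred_eq] at hl ⊢
      have : (i : ℕ) ≤ j := hij
      omega
    have hv' : v ∈ S.faceStab k := by
      refine Subgroup.closure_mono (Set.image_mono ?_) hv
      intro l hl
      simp only [Set.mem_ofPred_eq] at hl ⊢
      have : (j : ℕ) ≤ k := hjk
      omega
    refine ⟨hij.trans hjk, x * u, ?_, ?_⟩
    · refine QuotientGroup.eq.2 ?_
      simpa using hu'
    · refine QuotientGroup.eq.2 ?_
      have hy : y = x * u * v := by
        rw [mul_assoc, ← huv]; group
      rw [hy]
      simpa [mul_assoc] using inv_mem hv'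
  le_antisymm := by
    rintro ⟨i, a⟩ ⟨j, b⟩ ⟨hij, x, hax, hbx⟩ ⟨hji, -⟩
    obtain rfl : i = j := le_antisymm hij hji
    simp only at hax hbx
    rw [hax, hbx]

/-- The natural action of `W` on `P(W)`. -/
instance : MulAction W S.Face where
  smul w F := ⟨F.level, w • F.coset⟩
  one_smul F := Face.ext rfl (heq_of_eq (one_smul W F.coset))
  mul_smul u v F := Face.ext rfl (heq_of_eq (mul_smul u v F.coset))

theorem smul_le_smul (w : W) {F G : S.Face} (h : F ≤ G) : w • F ≤ w • G := by
  obtain ⟨hl, x, hF, hG⟩ := h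
  refine ⟨hl, w * x, ?_, ?_⟩
  · change w • F.coset = _
    rw [hF]; rfl
  · change w • G.coset = _
    rw [hG]; rfl

variable (S)

/-- The homomorphism from `W` to the automorphism group of `P(W)` given by the natural action. -/
def toAut : W →* (S.Face ≃o S.Face) where
  toFun w :=
    { MulAction.toPerm w with
      map_rel_iff' := by
        intro F G
        refine ⟨fun h => ?_, fun h => smul_le_smul w h⟩
        have := smul_le_smul w⁻¹ h
        simpa using this }
  map_one' := RelIso.ext fun F => one_smul W F
  map_mul' u v := RelIso.ext fun F => mul_smul u v F

/-- The quotient `P(W)/N`: its faces are the orbits of `N` on the faces of `P(W)`. -/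
def QuotientFace (N : Subgroup W) : Type _ := MulAction.orbitRel.Quotient N S.Face

/-- Two orbits are incident when they have incident representatives. -/
instance (N : Subgroup W) : LE (S.QuotientFace N) :=
  ⟨fun x y => ∃ F G : S.Face, F ≤ G ∧ (Quotient.mk'' F : MulAction.orbitRel.Quotient N S.Face) = x ∧
    (Quotient.mk'' G : MulAction.orbitRel.Quotient N S.Face) = y⟩

end StringCGroup

/-! ### Polyhedra given by their boundary cycles

A spherical polyhedron with vertices labelled by natural numbers is given by the list of its faces;
each face is the list of its vertices, in counterclockwise order as seen from outside. -/

/-- The directed edges of a face. -/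
def darts (f : List ℕ) : List (ℕ × ℕ) := f.zip (f.rotate 1)

/-- The corners `(u, v, w)`: `u`, `v`, `w` are consecutive on some face. -/
def corners (L : List (List ℕ)) : List (ℕ × ℕ × ℕ) :=
  L.flatMap fun f => f.zip ((f.rotate 1).zip (f.rotate 2))

/-- The vertices. -/
def vertices (L : List (List ℕ)) : List ℕ := L.flatten.dedup

/-- The neighbour of `v` that follows the neighbour `w` counterclockwise around `v`. -/
def nextNeighbour (L : List (List ℕ)) (v w : ℕ) : ℕ :=
  (((corners L).find? fun t => t.2 = (v, w)).map fun t => t.1).getD w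

/-- The neighbours of `v` in counterclockwise order. -/
def neighbourCycle (L : List (List ℕ)) (v : ℕ) : List ℕ :=
  match (corners L).filter fun t => t.2.1 = v with
  | [] => []
  | t :: ts => List.iterate (nextNeighbour L v) t.2.2 (ts.length + 1)

/-- A label for the directed edge from `u` to `v`. -/
def dartLabel (u v : ℕ) : ℕ := Nat.pair u v

/-- A label for the undirected edge between `u` and `v`. -/
def edgeLabel (u v : ℕ) : ℕ := Nat.pair (min u v) (max u v)

/-- Truncation: the new vertex `dartLabel u v` lies near `u` on the edge `uv`. Each face with `k`
sides becomes a face with `2 k` sides, and each vertex is replaced by a face. -/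
def truncate (L : List (List ℕ)) : List (List ℕ) :=
  (L.map fun f => (darts f).flatMap fun d => [dartLabel d.1 d.2, dartLabel d.2 d.1]) ++
  (vertices L).map fun v => (neighbourCycle L v).map (dartLabel v)

/-- Full truncation: the new vertices are the edges, the new faces are the old faces and the old
vertices. -/
def fullTruncate (L : List (List ℕ)) : List (List ℕ) :=
  (L.map fun f => (darts f).map fun d => edgeLabel d.1 d.2) ++
  (vertices L).map fun v => (neighbourCycle L v).map (edgeLabel v)

/-- Rhombification is full truncation applied twice. -/
def rhombify (L : List (List ℕ)) : List (List ℕ) := fullTruncate (fullTruncate L)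

/-- Snubbing. The vertices of the rhombification correspond to the corners of the polyhedron; the
corner `(u, v, w)` is labelled here by `dartLabel v w`. The rhombification has a face for each
face of the polyhedron, a face for each vertex, and a quadrilateral for each edge; every
quadrilateral is cut into two triangles by a diagonal, all in the same rotational sense. -/
def snub (L : List (List ℕ)) : List (List ℕ) :=
  (L.map fun f => (darts f).map fun d => dartLabel d.1 d.2) ++
  ((vertices L).map fun v => (neighbourCycle L v).map (dartLabel v)) ++
  (corners L).map fun t =>
    [dartLabel t.2.1 t.2.2, dartLabel t.1 t.2.1, dartLabel t.2.1 t.1]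

/-- The vertex sets of all faces: the least face `∅`, the vertices, the edges, the 2-faces and the
greatest face. -/
def faceSets (L : List (List ℕ)) : Finset (Finset ℕ) :=
  {∅} ∪ (vertices L).toFinset.image (fun v => {v}) ∪
    (L.flatMap darts).toFinset.image (fun d => {d.1, d.2}) ∪
    L.toFinset.image List.toFinset ∪ {(vertices L).toFinset}

/-- The face lattice: the vertex sets of the faces, ordered by inclusion. -/
abbrev FaceLattice (L : List (List ℕ)) : Type := {s : Finset ℕ // s ∈ faceSets L}

/-- The Platonic solids. -/
def tetrahedron : List (List ℕ) := [[0, 1, 2], [0, 2, 3], [0, 3, 1], [1, 3, 2]]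

def cube : List (List ℕ) :=
  [[0, 1, 2, 3], [7, 6, 5, 4], [0, 4, 5, 1], [1, 5, 6, 2], [2, 6, 7, 3], [3, 7, 4, 0]]

def octahedron : List (List ℕ) :=
  [[0, 1, 2], [0, 2, 3], [0, 3, 4], [0, 4, 1], [5, 2, 1], [5, 3, 2], [5, 4, 3], [5, 1, 4]]

def icosahedron : List (List ℕ) :=
  [[0, 1, 2], [0, 2, 3], [0, 3, 4], [0, 4, 5], [0, 5, 1],
   [2, 1, 6], [3, 2, 7], [4, 3, 8], [5, 4, 9], [1, 5, 10],
   [6, 7, 2], [7, 8, 3], [8, 9, 4], [9, 10, 5], [10, 6, 1],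
   [11, 7, 6], [11, 8, 7], [11, 9, 8], [11, 10, 9], [11, 6, 10]]

def dodecahedron : List (List ℕ) :=
  [[0, 1, 2, 3, 4], [0, 4, 9, 14, 5], [0, 5, 10, 6, 1], [1, 6, 11, 7, 2],
   [2, 7, 12, 8, 3], [3, 8, 13, 9, 4], [5, 14, 19, 15, 10], [6, 10, 15, 16, 11],
   [7, 11, 16, 17, 12], [8, 12, 17, 18, 13], [9, 13, 18, 19, 14], [15, 19, 18, 17, 16]]

/-- The pseudorhombicuboctahedron (elongated square gyrobicupola). Its vertices lie in four layers:
a top square `0, …, 3`, two octagons `4, …, 11` and `12, …, 19`, and a bottom square `20, …, 23`.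
A belt of eight squares joins the octagons; the top cupola has its squares on the belt edges
`4 5`, `6 7`, `8 9`, `10 11`, the bottom one on `13 14`, `15 16`, `17 18`, `19 12`. -/
def pseudorhombicuboctahedron : List (List ℕ) :=
  [[0, 1, 2, 3], [4, 5, 1, 0], [6, 7, 2, 1], [8, 9, 3, 2],
   [10, 11, 0, 3], [11, 4, 0], [5, 6, 1], [7, 8, 2],
   [9, 10, 3], [12, 13, 5, 4], [13, 14, 6, 5], [14, 15, 7, 6],
   [15, 16, 8, 7], [16, 17, 9, 8], [17, 18, 10, 9], [18, 19, 11, 10],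
   [19, 12, 4, 11], [14, 13, 20, 21], [16, 15, 21, 22], [18, 17, 22, 23],
   [12, 19, 23, 20], [13, 12, 20], [15, 14, 21], [17, 16, 22],
   [19, 18, 23], [23, 22, 21, 20]]

/-- The fourteen sporadic Archimedean polyhedra. -/
inductive Sporadic
  | truncatedTetrahedron
  | truncatedOctahedron
  | cuboctahedron
  | truncatedCube
  | icosidodecahedron
  | truncatedIcosahedron
  | smallRhombicuboctahedron
  | pseudorhombicuboctahedron
  | snubCube
  | smallRhombicosidodecahedron
  | greatRhombicosidodecahedron
  | snubDodecahedron
  | truncatedDodecahedron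
  | greatRhombicuboctahedron

namespace Sporadic

/-- The boundary cycles. -/
def faces : Sporadic → List (List ℕ)
  | truncatedTetrahedron => truncate tetrahedron
  | truncatedOctahedron => truncate octahedron
  | cuboctahedron => fullTruncate cube
  | truncatedCube => truncate cube
  | icosidodecahedron => fullTruncate dodecahedron
  | truncatedIcosahedron => truncate icosahedron
  | smallRhombicuboctahedron => rhombify cube
  | pseudorhombicuboctahedron => ArchPoly.pseudorhombicuboctahedron
  | snubCube => snub cube
  | smallRhombicosidodecahedron => rhombify dodecahedron
  | greatRhombicosidodecahedron => truncate (fullTruncate dodecahedron)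
  | snubDodecahedron => snub dodecahedron
  | truncatedDodecahedron => truncate dodecahedron
  | greatRhombicuboctahedron => truncate (fullTruncate cube)

/-- The polyhedron as an abstract polytope. -/
abbrev Poly (X : Sporadic) : Type := FaceLattice X.faces

/-- The vertex symbol. -/
def symbol : Sporadic → List ℕ
  | truncatedTetrahedron => [3, 6, 6]
  | truncatedOctahedron => [4, 6, 6]
  | cuboctahedron => [3, 4, 3, 4]
  | truncatedCube => [3, 8, 8]
  | icosidodecahedron => [3, 5, 3, 5]
  | truncatedIcosahedron => [5, 6, 6]
  | smallRhombicuboctahedron => [3, 4, 4, 4]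
  | pseudorhombicuboctahedron => [3, 4, 4, 4]
  | snubCube => [3, 3, 3, 3, 4]
  | smallRhombicosidodecahedron => [3, 4, 5, 4]
  | greatRhombicosidodecahedron => [4, 6, 10]
  | snubDodecahedron => [3, 3, 3, 3, 5]
  | truncatedDodecahedron => [3, 10, 10]
  | greatRhombicuboctahedron => [4, 6, 8]

/-- The Schläfli type of the minimal regular cover. -/
def schlafli : Sporadic → ℕ × ℕ
  | truncatedTetrahedron => (6, 3)
  | truncatedOctahedron => (12, 3)
  | cuboctahedron => (12, 4)
  | truncatedCube => (24, 3)
  | icosidodecahedron => (15, 4)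
  | truncatedIcosahedron => (30, 3)
  | smallRhombicuboctahedron => (12, 4)
  | pseudorhombicuboctahedron => (12, 4)
  | snubCube => (12, 5)
  | smallRhombicosidodecahedron => (60, 4)
  | greatRhombicosidodecahedron => (60, 3)
  | snubDodecahedron => (15, 5)
  | truncatedDodecahedron => (30, 3)
  | greatRhombicuboctahedron => (24, 3)

/-- The order of the group of the minimal regular cover. -/
def groupOrder : Sporadic → ℕ
  | truncatedTetrahedron => 144
  | truncatedOctahedron => 6912
  | cuboctahedron => 2304
  | truncatedCube => 82944
  | icosidodecahedron => 14400
  | truncatedIcosahedron => 2592000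
  | smallRhombicuboctahedron => 1327104
  | pseudorhombicuboctahedron => 2 ^ 35 * 3 ^ 5 * 5 ^ 2 * 7 * 11
  | snubCube => 2 ^ 32 * 3 ^ 11 * 5
  | smallRhombicosidodecahedron => 207360000
  | greatRhombicosidodecahedron => 559872000000
  | snubDodecahedron => 2 ^ 23 * 3 ^ 11 * 5 ^ 11
  | truncatedDodecahedron => 2592000
  | greatRhombicuboctahedron => 5308416

/-- The order of the stabilizer of a flag in the group of the minimal regular cover. -/
def stabilizerOrder : Sporadic → ℕ
  | truncatedTetrahedron => 2
  | truncatedOctahedron => 48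
  | cuboctahedron => 24
  | truncatedCube => 576
  | icosidodecahedron => 60
  | truncatedIcosahedron => 7200
  | smallRhombicuboctahedron => 6912
  | pseudorhombicuboctahedron => 2 ^ 29 * 3 ^ 4 * 5 ^ 2 * 7 * 11
  | snubCube => 2 ^ 28 * 3 ^ 10
  | smallRhombicosidodecahedron => 432000
  | greatRhombicosidodecahedron => 777600000
  | snubDodecahedron => 2 ^ 20 * 3 ^ 10 * 5 ^ 9
  | truncatedDodecahedron => 7200
  | greatRhombicuboctahedron => 18432

end Sporadic

end ArchPoly

open ArchPoly

universe u

/-! The group `W` is the monodromy group of the polyhedron (`IsPolytope.monodromy`): it is generated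
by the three permutations of the flags that pass to the `i`-adjacent flag. Adjacent flags are
unique, so a flag action of a group generated by its distinguished generators is a homomorphism onto
the monodromy group, followed by the natural action. The kernel consists of the elements that fix
all flags. Since the flags form one orbit, it is the core of the stabilizer of any flag. This gives
minimality (`exists_hom_monodromy`), a covering (`exists_isCovering`), and the trivial core for `W`
itself.

That `W` is a string C-group (`stringCGroup`) needs an argument only for the intersection property.
An element of both subgroups preserves, in every flag, each face whose rank is not in `I ∩ J`. If
neither set contains the other, `I ∩ J` has at most one element `m`, so every flag is fixed or sent
to its `m`-adjacent flag. The polyhedron is orientable, hence the same alternative holds for all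
flags, and the element is `1` or the generator with index `m`.

For any string C-group of rank 3 the coset poset is a regular polytope with group `W`. The coset `w
H_i` is sent to the face of rank `i` of `Φ^w`; this identifies the polyhedron with `P(W)/N`, because
flags with a common face of rank `i` are joined by adjacency steps of the other ranks
(`linked_of_face_eq`).

The numerical claims are computed. Flags correspond to darts with a chosen end
(`position_bijective`), which gives their number and the orientation. Each flag is labelled
equivariantly by a tuple of points of a small permutation representation. If the labels single out
one flag and all points occur, the group generated by the pairs of corresponding generators projects
injectively to both factors, so orders can be read off in small degree (`card_monodromy`,
`orderOf_monodromyGen_mul`). A Schreier–Sims computation gives the group order; its correctness is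
`card_codeGroup`. The orbit-stabilizer theorem then gives the order of `N`. The polytope axioms and
the vertex symbol follow from finitely many conditions on the boundary cycles (`IsPolyhedralMap`).
-/

namespace ArchPoly

/-! ### Graded posets, flags, adjacency and flag-connectedness -/

/-- The rank function of a bounded poset in which all flags have `d + 2` elements, with values
`0, …, d + 1`. -/
structure IsGraded {P : Type*} [PartialOrder P] (d : ℕ) (r : P → ℕ) : Prop where
  strictMono : StrictMono r
  bot : ∃ x, IsBot x ∧ r x = 0
  top : ∃ x, IsTop x ∧ r x = d + 1
  between : ∀ x y, x < y → r x + 2 ≤ r y → ∃ z, x < z ∧ z < y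

namespace IsGraded

variable {P : Type*} [PartialOrder P] {d : ℕ} {r : P → ℕ}

theorem rank_le (h : IsGraded d r) (x : P) : r x ≤ d + 1 := by
  obtain ⟨t, ht, hr⟩ := h.top
  exact hr ▸ h.strictMono.monotone (ht x)

theorem exists_rank_add_one (h : IsGraded d r) {x y : P} (hxy : x < y) :
    ∃ z, x ≤ z ∧ z < y ∧ r z + 1 = r y := by
  induction hn : r y - r x using Nat.strong_induction_on generalizing x with
  | _ n ih =>
    have h1 := h.strictMono hxy
    rcases Nat.lt_or_ge (r x + 1) (r y) with h2 | h2
    · obtain ⟨z, hxz, hzy⟩ := h.between x y hxy h2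
      have h3 := h.strictMono hxz
      have h4 := h.strictMono hzy
      obtain ⟨w, hw1, hw2, hw3⟩ := ih (r y - r z) (by omega) hzy rfl
      exact ⟨w, hxz.le.trans hw1, hw2, hw3⟩
    · exact ⟨x, le_rfl, hxy, by omega⟩

/-- Below every element other than the least one there is an element of rank exactly one less, so
`r` makes no jumps; both inequalities follow by strong induction on the rank. -/
theorem height_eq (h : IsGraded d r) (x : P) : Order.height x = r x := by
  apply le_antisymm
  · induction hn : r x using Nat.strong_induction_on generalizing x with
    | _ n ih =>
      rw [Order.height_le_coe_iff]
      intro y hy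
      have h1 := h.strictMono hy
      exact (ih (r y) (hn ▸ h1) y rfl).trans_lt (by exact_mod_cast hn ▸ h1)
  · induction hn : r x using Nat.strong_induction_on generalizing x with
    | _ n ih =>
      obtain ⟨b, hb, hb0⟩ := h.bot
      rcases (hb x).eq_or_lt with rfl | hlt
      · simp [← hn, hb0]
      · obtain ⟨z, -, hz, hz1⟩ := h.exists_rank_add_one hlt
        have h1 := ih (r z) (by omega) z rfl
        calc (n : ℕ∞) = (r z : ℕ∞) + 1 := by rw [← hn, ← hz1]; push_cast; rfl
          _ ≤ Order.height z + 1 := by gcongr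
          _ ≤ Order.height x := Order.height_add_one_le hz

theorem lt_of_mem (h : IsGraded d r) {Φ : Flag P} {x y : P} (hx : x ∈ Φ) (hy : y ∈ Φ)
    (hr : r x < r y) : x < y := by
  rcases Φ.le_or_le hx hy with h1 | h1
  · exact lt_of_le_of_ne h1 fun h2 => by simp [h2] at hr
  · exact absurd (h.strictMono.monotone h1) (by omega)

theorem eq_of_mem (h : IsGraded d r) {Φ : Flag P} {x y : P} (hx : x ∈ Φ) (hy : y ∈ Φ)
    (hr : r x = r y) : x = y := by
  rcases Φ.le_or_le hx hy with h1 | h1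
  · exact h1.eq_or_lt.resolve_right fun h2 => by have := h.strictMono h2; omega
  · exact (h1.eq_or_lt.resolve_right fun h2 => by have := h.strictMono h2; omega).symm

/-- A flag without an element of rank `i` has a gap between its highest member below that rank and
its lowest member above it. An element inside the gap is comparable with the whole flag, hence
belongs to it by maximality, against the choice of the two ends. -/
theorem exists_mem_flag (h : IsGraded d r) (Φ : Flag P) {i : ℕ} (hi : i ≤ d + 1) :
    ∃ x ∈ Φ, r x = i := by
  obtain ⟨b, hb, hb0⟩ := h.bot
  obtain ⟨t, ht, ht0⟩ := h.top
  have hbΦ : b ∈ Φ := Flag.mem_iff_forall_le_or_ge.2 fun y _ => Or.inl (hb y)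
  have htΦ : t ∈ Φ := Flag.mem_iff_forall_le_or_ge.2 fun y _ => Or.inr (ht y)
  by_contra! hne
  have hup : ∃ n, ∃ y ∈ Φ, r y = n ∧ i ≤ n := ⟨d + 1, t, htΦ, ht0, hi⟩
  classical
  obtain ⟨y, hyΦ, hyn, hiy⟩ := Nat.find_spec hup
  -- `Nat.find` minimizes, so the highest rank below `i` is encoded by its distance `n` from `i`.
  have hdown : ∃ n, ∃ x ∈ Φ, r x = i - n ∧ n ≤ i := ⟨i, b, hbΦ, by omega, le_rfl⟩
  obtain ⟨x, hxΦ, hxn, hix⟩ := Nat.find_spec hdown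
  have h1 := hne x hxΦ
  have h2 := hne y hyΦ
  obtain ⟨z, hxz, hzy⟩ := h.between x y (h.lt_of_mem hxΦ hyΦ (by omega)) (by omega)
  have h3 := h.strictMono hxz
  have h4 := h.strictMono hzy
  have hlow : ∀ w ∈ Φ, r w < i → w ≤ x := by
    intro w hw hwi
    have := Nat.find_min' hdown ⟨w, hw, (by omega : r w = i - (i - r w)), by omega⟩
    rcases (show r w ≤ r x by omega).eq_or_lt with h5 | h5
    · exact (h.eq_of_mem hw hxΦ h5).le
    · exact (h.lt_of_mem hw hxΦ h5).le
  have hhigh : ∀ w ∈ Φ, i < r w → y ≤ w := by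
    intro w hw hwi
    have := Nat.find_min' hup ⟨w, hw, rfl, by omega⟩
    rcases (show r y ≤ r w by omega).eq_or_lt with h5 | h5
    · exact (h.eq_of_mem hyΦ hw h5).le
    · exact (h.lt_of_mem hyΦ hw h5).le
  have hzΦ : z ∈ Φ := by
    refine Flag.mem_iff_forall_le_or_ge.2 fun w hw => ?_
    rcases Nat.lt_trichotomy (r w) i with h5 | h5 | h5
    · exact Or.inr ((hlow w hw h5).trans hxz.le)
    · exact absurd h5 (hne w hw)
    · exact Or.inl (hzy.le.trans (hhigh w hw h5))
  rcases Nat.lt_trichotomy (r z) i with h5 | h5 | h5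
  · exact absurd (hlow z hzΦ h5) hxz.not_ge
  · exact hne z hzΦ h5
  · exact absurd (hhigh z hzΦ h5) hzy.not_ge

theorem ncard_flag (h : IsGraded d r) (Φ : Flag P) : (Φ : Set P).ncard = d + 2 := by
  have hinj : Set.InjOn r (Φ : Set P) := fun x hx y hy hxy => h.eq_of_mem hx hy hxy
  have himg : r '' (Φ : Set P) = (Finset.range (d + 2) : Set ℕ) := by
    ext i
    simp only [Set.mem_image, Finset.coe_range, Set.mem_Iio]
    constructor
    · rintro ⟨x, -, rfl⟩
      have := h.rank_le x
      omega
    · intro hi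
      exact h.exists_mem_flag Φ (by omega)
  rw [← hinj.ncard_image, himg, Set.ncard_coe_finset, Finset.card_range]

end IsGraded

/-- The height as a natural number. -/
noncomputable def natHeight {P : Type*} [PartialOrder P] (x : P) : ℕ := (Order.height x).toNat

namespace IsPolytope

variable {P : Type*} [PartialOrder P] {d : ℕ}

/-- An element of greater height would be the top of a chain of `d + 3` elements, too many for a
flag. -/
theorem height_le (h : IsPolytope d P) (x : P) : Order.height x ≤ (d + 1 : ℕ) := by
  by_contra! hx
  obtain ⟨p, -, hp⟩ := Order.exists_series_of_le_height x (n := d + 2)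
    (by exact_mod_cast Order.add_one_le_of_lt hx)
  have hc : IsChain (· ≤ ·) (Set.range p) := p.strictMono.monotone.isChain_range
  obtain ⟨Φ, hΦ⟩ := hc.exists_subset_flag
  have h1 := h.flag_card Φ
  -- `ncard` is zero on infinite sets, so a flag with `ncard` equal to `d + 2` is finite.
  have h2 := Set.ncard_le_ncard hΦ (Set.finite_of_ncard_ne_zero (by omega))
  rw [← Set.image_univ, Set.ncard_image_of_injective _ p.strictMono.injective, Set.ncard_univ,
    Nat.card_eq_fintype_card, Fintype.card_fin] at h2
  omega

theorem height_eq (h : IsPolytope d P) (x : P) : Order.height x = natHeight x :=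
  (ENat.natCast_toNat (ne_top_of_le_ne_top (ENat.natCast_ne_top _) (h.height_le x))).symm

theorem natHeight_strictMono (h : IsPolytope d P) : StrictMono (natHeight : P → ℕ) := by
  intro x y hxy
  have := Order.height_strictMono hxy (by rw [h.height_eq]; exact ENat.natCast_lt_top _)
  rw [h.height_eq, h.height_eq] at this
  exact_mod_cast this

theorem natHeight_le (h : IsPolytope d P) (x : P) : natHeight x ≤ d + 1 := by
  have := h.height_le x
  rw [h.height_eq] at this
  exact_mod_cast this

/-- On a flag the height is injective with values in `0, …, d + 1`, and the flag has `d + 2`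
elements, so every height occurs. A flag through `x` and `y` then supplies the element between them.
-/
theorem isGraded (h : IsPolytope d P) : IsGraded d (natHeight : P → ℕ) := by
  have key : ∀ Φ : Flag P, ∀ i ≤ d + 1, ∃ x ∈ Φ, natHeight x = i := by
    intro Φ i hi
    have hinj : Set.InjOn natHeight (Φ : Set P) := by
      intro x hx y hy hxy
      by_contra hne
      rcases Φ.chain_lt hx hy hne with h1 | h1 <;> have := h.natHeight_strictMono h1 <;> omega
    have hsub : natHeight '' (Φ : Set P) ⊆ (Finset.range (d + 2) : Set ℕ) := by
      rintro _ ⟨x, -, rfl⟩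
      have := h.natHeight_le x
      simp only [Finset.coe_range, Set.mem_Iio]
      omega
    have heq := Set.eq_of_subset_of_ncard_le hsub
      (by rw [hinj.ncard_image, h.flag_card, Set.ncard_coe_finset, Finset.card_range])
    have : i ∈ natHeight '' (Φ : Set P) := by
      rw [heq]; simp only [Finset.coe_range, Set.mem_Iio]; omega
    exact this
  obtain ⟨⟨b, hb⟩, t, ht⟩ := h.bounded
  refine ⟨h.natHeight_strictMono, ⟨b, hb, ?_⟩, ⟨t, ht, ?_⟩, ?_⟩
  · have : Order.height b = 0 := Order.height_eq_zero.2 hb.isMin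
    simp [natHeight, this]
  · obtain ⟨Φ, -⟩ := (IsChain.empty (r := (· ≤ · : P → P → Prop))).exists_subset_flag
    obtain ⟨x, -, hx⟩ := key Φ (d + 1) le_rfl
    exact le_antisymm (h.natHeight_le t) (hx ▸ h.natHeight_strictMono.monotone (ht x))
  · intro x y hxy hr
    obtain ⟨Φ, hΦ⟩ := (IsChain.pair (r := (· ≤ ·)) hxy.le).exists_subset_flag
    obtain ⟨z, hz, hzr⟩ := key Φ (natHeight x + 1) (by have := h.natHeight_le y; omega)
    have hx : x ∈ Φ := hΦ (by simp)
    have hy : y ∈ Φ := hΦ (by simp)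
    refine ⟨z, ?_, ?_⟩
    · rcases Φ.le_or_le hx hz with h1 | h1
      · exact lt_of_le_of_ne h1 fun h2 => by subst h2; omega
      · have := h.natHeight_strictMono.monotone h1; omega
    · rcases Φ.le_or_le hz hy with h1 | h1
      · exact lt_of_le_of_ne h1 fun h2 => by subst h2; omega
      · have := h.natHeight_strictMono.monotone h1; omega

theorem hasRank_iff (h : IsPolytope d P) {i : ℕ} {x : P} : HasRank i x ↔ natHeight x = i + 1 := by
  rw [HasRank, h.height_eq]
  exact_mod_cast Iff.rfl

/-- The element of height `i` of the flag `Φ`. -/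
noncomputable def face (h : IsPolytope d P) (Φ : Flag P) (i : Fin (d + 2)) : P :=
  (h.isGraded.exists_mem_flag Φ (Nat.le_of_lt_succ i.2)).choose

theorem face_mem (h : IsPolytope d P) (Φ : Flag P) (i : Fin (d + 2)) : h.face Φ i ∈ Φ :=
  (h.isGraded.exists_mem_flag Φ (Nat.le_of_lt_succ i.2)).choose_spec.1

@[simp] theorem natHeight_face (h : IsPolytope d P) (Φ : Flag P) (i : Fin (d + 2)) :
    natHeight (h.face Φ i) = i :=
  (h.isGraded.exists_mem_flag Φ (Nat.le_of_lt_succ i.2)).choose_spec.2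

theorem eq_face (h : IsPolytope d P) {Φ : Flag P} {x : P} (hx : x ∈ Φ) {i : Fin (d + 2)}
    (hi : natHeight x = i) : x = h.face Φ i :=
  h.isGraded.eq_of_mem hx (h.face_mem Φ i) (by rw [hi, natHeight_face])

theorem mem_iff_face (h : IsPolytope d P) {Φ : Flag P} {x : P} : x ∈ Φ ↔ ∃ i, h.face Φ i = x := by
  constructor
  · intro hx
    exact ⟨⟨natHeight x, Nat.lt_succ_of_le (h.natHeight_le x)⟩, (h.eq_face hx rfl).symm⟩
  · rintro ⟨i, rfl⟩
    exact h.face_mem Φ i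

theorem flag_ext (h : IsPolytope d P) {Φ Ψ : Flag P} (hΦ : ∀ i, h.face Φ i = h.face Ψ i) :
    Φ = Ψ :=
  SetLike.ext fun x => by simp only [h.mem_iff_face, hΦ]

theorem face_lt_face (h : IsPolytope d P) (Φ : Flag P) {i j : Fin (d + 2)} (hij : i < j) :
    h.face Φ i < h.face Φ j :=
  h.isGraded.lt_of_mem (h.face_mem Φ i) (h.face_mem Φ j) (by simpa using hij)

theorem face_le_face (h : IsPolytope d P) (Φ : Flag P) {i j : Fin (d + 2)} (hij : i ≤ j) :
    h.face Φ i ≤ h.face Φ j := by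
  rcases hij.eq_or_lt with rfl | hij
  · exact le_rfl
  · exact (h.face_lt_face Φ hij).le

theorem isBot_of_natHeight (h : IsPolytope d P) {x : P} (hx : natHeight x = 0) : IsBot x := by
  obtain ⟨b, hb, hb0⟩ := h.isGraded.bot
  rcases (hb x).eq_or_lt with rfl | hlt
  · exact hb
  · have := h.natHeight_strictMono hlt; omega

theorem isTop_of_natHeight (h : IsPolytope d P) {x : P} (hx : natHeight x = d + 1) : IsTop x := by
  obtain ⟨t, ht, ht0⟩ := h.isGraded.top
  rcases (ht x).eq_or_lt with rfl | hlt
  · exact ht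
  · have := h.natHeight_strictMono hlt; omega

theorem face_zero_eq (h : IsPolytope d P) (Φ Ψ : Flag P) : h.face Φ 0 = h.face Ψ 0 :=
  (h.isBot_of_natHeight (by simp) _).antisymm (h.isBot_of_natHeight (by simp) _)

theorem face_last_eq (h : IsPolytope d P) (Φ Ψ : Flag P) :
    h.face Φ (Fin.last _) = h.face Ψ (Fin.last _) :=
  (h.isTop_of_natHeight (by simp) _).antisymm (h.isTop_of_natHeight (by simp) _)

theorem exists_flag_of_le (_ : IsPolytope d P) {x y : P} (hxy : x ≤ y) :
    ∃ Φ : Flag P, x ∈ Φ ∧ y ∈ Φ := by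
  obtain ⟨Φ, hΦ⟩ := (IsChain.pair (r := (· ≤ ·)) hxy).exists_subset_flag
  exact ⟨Φ, hΦ (by simp), hΦ (by simp)⟩

theorem adjacent_iff (h : IsPolytope d P) {i : ℕ} {Φ Ψ : Flag P} : Adjacent i Φ Ψ ↔
    Φ ≠ Ψ ∧ ∀ j : Fin (d + 2), (j : ℕ) ≠ i + 1 → h.face Φ j = h.face Ψ j := by
  refine and_congr_right fun _ => ⟨fun H j hj => ?_, fun H x hx => ?_⟩
  · refine h.eq_face ((H _ ?_).1 (h.face_mem Φ j)) (by simp)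
    rw [h.hasRank_iff, natHeight_face]
    exact hj
  · rw [h.hasRank_iff] at hx
    rw [h.mem_iff_face, h.mem_iff_face]
    refine exists_congr fun j => ?_
    by_cases hj : (j : ℕ) = i + 1
    · constructor <;> rintro rfl <;> simp [hj] at hx
    · rw [H j hj]

/-- For `i ≥ d` the flags could differ at most in the greatest face, which all flags share. -/
theorem lt_of_adjacent (h : IsPolytope d P) {i : ℕ} {Φ Ψ : Flag P} (ha : Adjacent i Φ Ψ) :
    i < d := by
  by_contra! hi
  rw [h.adjacent_iff] at ha
  refine ha.1 (h.flag_ext fun j => ?_)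
  by_cases hj : (j : ℕ) = i + 1
  · obtain rfl : j = Fin.last _ := Fin.ext (by simp; omega)
    exact h.face_last_eq _ _
  · exact ha.2 j hj

/-- The diamond condition offers a second face between the neighbours of the face of rank `i`. With
the remaining faces of `Φ` it forms a chain, and any flag that contains this chain is adjacent to
`Φ`. -/
theorem exists_adjacent (h : IsPolytope d P) (i : Fin d) (Φ : Flag P) :
    ∃ Ψ, Adjacent i Φ Ψ := by
  set a : Fin (d + 2) := ⟨i, by omega⟩
  set b : Fin (d + 2) := ⟨i + 1, by omega⟩
  set c : Fin (d + 2) := ⟨i + 2, by omega⟩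
  have hab : a < b := by simp [a, b, Fin.lt_def]
  have hbc : b < c := by simp [b, c, Fin.lt_def]
  have hd := h.diamond (h.face Φ a) (h.face Φ c) (h.face_lt_face Φ (hab.trans hbc))
    (by rw [h.height_eq, h.height_eq, natHeight_face, natHeight_face]; simp [a, c])
  obtain ⟨y, hy, hyb⟩ := Set.exists_ne_of_one_lt_ncard (by rw [hd]; norm_num) (h.face Φ b)
  have hsplit : ∀ j : Fin (d + 2), j ≠ b → j ≤ a ∨ c ≤ j := by
    intro j hj
    have : (j : ℕ) ≠ i + 1 := fun h1 => hj (Fin.ext h1)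
    simp only [Fin.le_def, a, c]
    omega
  have hchain : IsChain (· ≤ ·) (insert y (h.face Φ '' {j | j ≠ b})) := by
    refine IsChain.insert ?_ ?_
    · rintro _ ⟨j, -, rfl⟩ _ ⟨k, -, rfl⟩ -
      exact Φ.le_or_le (h.face_mem Φ j) (h.face_mem Φ k)
    · rintro _ ⟨j, hj, rfl⟩ -
      rcases hsplit j hj with h1 | h1
      · exact Or.inr ((h.face_le_face Φ h1).trans hy.1.le)
      · exact Or.inl (hy.2.le.trans (h.face_le_face Φ h1))
  obtain ⟨Ψ, hΨ⟩ := hchain.exists_subset_flag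
  have hyr : natHeight y = b := by
    have h1 := h.natHeight_strictMono hy.1
    have h2 := h.natHeight_strictMono hy.2
    simp only [natHeight_face, a, b, c] at h1 h2 ⊢
    omega
  refine ⟨Ψ, h.adjacent_iff.2 ⟨?_, ?_⟩⟩
  · rintro rfl
    exact hyb (h.eq_face (hΨ (by simp)) hyr)
  · intro j hj
    exact h.eq_face (hΨ (Set.mem_insert_of_mem _ ⟨j, fun h1 => hj (by simp [h1, b]), rfl⟩))
      (by simp)

/-- The diamond has two elements; one is the face of `Φ`, so `Ψ` and `Ψ'` both use the other. -/
theorem adjacent_unique (h : IsPolytope d P) {i : ℕ} {Φ Ψ Ψ' : Flag P}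
    (h1 : Adjacent i Φ Ψ) (h2 : Adjacent i Φ Ψ') : Ψ = Ψ' := by
  have hi := h.lt_of_adjacent h1
  rw [h.adjacent_iff] at h1 h2
  set a : Fin (d + 2) := ⟨i, by omega⟩
  set b : Fin (d + 2) := ⟨i + 1, by omega⟩
  set c : Fin (d + 2) := ⟨i + 2, by omega⟩
  have hab : a < b := by simp [a, b, Fin.lt_def]
  have hbc : b < c := by simp [b, c, Fin.lt_def]
  have hd := h.diamond (h.face Φ a) (h.face Φ c) (h.face_lt_face Φ (hab.trans hbc))
    (by rw [h.height_eq, h.height_eq, natHeight_face, natHeight_face]; simp [a, c])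
  have hmem : ∀ X : Flag P, (∀ j : Fin (d + 2), (j : ℕ) ≠ i + 1 → h.face Φ j = h.face X j) →
      h.face X b ∈ Set.Ioo (h.face Φ a) (h.face Φ c) := by
    intro X hX
    rw [hX a (by simp [a]), hX c (by simp [c])]
    exact ⟨h.face_lt_face X hab, h.face_lt_face X hbc⟩
  have hne : ∀ X : Flag P, Φ ≠ X → (∀ j : Fin (d + 2), (j : ℕ) ≠ i + 1 → h.face Φ j = h.face X j) →
      h.face X b ≠ h.face Φ b := by
    intro X hΦ hX hb
    refine hΦ (h.flag_ext fun j => ?_)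
    by_cases hj : j = b
    · rw [hj, hb]
    · exact hX j fun h1 => hj (Fin.ext h1)
  have hb : h.face Ψ b = h.face Ψ' b := by
    by_contra hbb
    obtain ⟨x, y, hxy, hS⟩ := Set.ncard_eq_two.1 hd
    have m0 := hmem Φ fun _ _ => rfl
    have m1 := hmem Ψ h1.2
    have m2 := hmem Ψ' h2.2
    have n1 := hne Ψ h1.1 h1.2
    have n2 := hne Ψ' h2.1 h2.2
    rw [hS] at m0 m1 m2
    simp only [Set.mem_insert_iff, Set.mem_singleton_iff] at m0 m1 m2
    rcases m0 with m0 | m0 <;> rcases m1 with m1 | m1 <;> rcases m2 with m2 | m2 <;>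
      simp_all
  refine h.flag_ext fun j => ?_
  by_cases hj : j = b
  · rw [hj, hb]
  · rw [← h1.2 j fun h1 => hj (Fin.ext h1), ← h2.2 j fun h1 => hj (Fin.ext h1)]

/-- The `i`-adjacent flag. -/
noncomputable def adj (h : IsPolytope d P) (i : Fin d) (Φ : Flag P) : Flag P :=
  (h.exists_adjacent i Φ).choose

theorem adjacent_adj (h : IsPolytope d P) (i : Fin d) (Φ : Flag P) : Adjacent i Φ (h.adj i Φ) :=
  (h.exists_adjacent i Φ).choose_spec

theorem eq_adj (h : IsPolytope d P) {i : Fin d} {Φ Ψ : Flag P} (ha : Adjacent i Φ Ψ) :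
    Ψ = h.adj i Φ :=
  h.adjacent_unique ha (h.adjacent_adj i Φ)

theorem adj_ne (h : IsPolytope d P) (i : Fin d) (Φ : Flag P) : h.adj i Φ ≠ Φ :=
  (h.adjacent_adj i Φ).1.symm

theorem face_adj (h : IsPolytope d P) (i : Fin d) (Φ : Flag P) {j : Fin (d + 2)}
    (hj : (j : ℕ) ≠ i + 1) : h.face (h.adj i Φ) j = h.face Φ j :=
  ((h.adjacent_iff.1 (h.adjacent_adj i Φ)).2 j hj).symm

theorem eq_or_eq_adj (h : IsPolytope d P) (i : Fin d) {Φ Ψ : Flag P}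
    (hj : ∀ j : Fin (d + 2), (j : ℕ) ≠ i + 1 → h.face Φ j = h.face Ψ j) :
    Ψ = Φ ∨ Ψ = h.adj i Φ := by
  by_cases he : Φ = Ψ
  · exact Or.inl he.symm
  · exact Or.inr (h.eq_adj (h.adjacent_iff.2 ⟨he, hj⟩))

theorem adj_adj (h : IsPolytope d P) (i : Fin d) (Φ : Flag P) : h.adj i (h.adj i Φ) = Φ := by
  rcases h.eq_or_eq_adj i (Φ := h.adj i Φ) (Ψ := Φ) (fun j hj => h.face_adj i Φ hj) with h1 | h1
  · exact absurd h1.symm (h.adj_ne i Φ)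
  · exact h1.symm

theorem face_adj_ne (h : IsPolytope d P) (i : Fin d) (Φ : Flag P) {j : Fin (d + 2)}
    (hj : (j : ℕ) = i + 1) : h.face (h.adj i Φ) j ≠ h.face Φ j := by
  intro hf
  refine h.adj_ne i Φ (h.flag_ext fun k => ?_)
  by_cases hk : (k : ℕ) = i + 1
  · rwa [show k = j from Fin.ext (hk.trans hj.symm)]
  · exact h.face_adj i Φ hk

/-- The neighbours of rank `i` are not touched by `adj j`, so the face of rank `i` of `adj i Φ` also
fits into `adj j Φ`. The flag obtained in this way is the value of both sides. -/
theorem adj_comm (h : IsPolytope d P) {i j : Fin d} (hij : (i : ℕ) + 1 < j) (Φ : Flag P) :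
    h.adj i (h.adj j Φ) = h.adj j (h.adj i Φ) := by
  set a : Fin (d + 2) := ⟨i, by omega⟩
  set b : Fin (d + 2) := ⟨i + 1, by omega⟩
  set c : Fin (d + 2) := ⟨i + 2, by omega⟩
  have hab : a < b := by simp [a, b, Fin.lt_def]
  have hbc : b < c := by simp [b, c, Fin.lt_def]
  -- the flag obtained from `adj i Φ` by replacing the face of rank `j`
  have hchain : IsChain (· ≤ ·) (insert (h.face (h.adj i Φ) b)
      (h.face (h.adj j Φ) '' {k | k ≠ b})) := by
    refine IsChain.insert ?_ ?_
    · rintro _ ⟨k, -, rfl⟩ _ ⟨l, -, rfl⟩ -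
      exact (h.adj j Φ).le_or_le (h.face_mem _ k) (h.face_mem _ l)
    · rintro _ ⟨k, hk, rfl⟩ -
      have hk' : (k : ℕ) ≠ i + 1 := fun h1 => hk (Fin.ext h1)
      rcases Nat.lt_or_gt_of_ne hk' with h1 | h1
      · refine Or.inr ?_
        rw [h.face_adj j Φ (by omega), ← h.face_adj i Φ hk']
        exact (h.face_lt_face _ (by simpa [b, Fin.lt_def] using h1)).le
      · refine Or.inl (le_trans ?_ (h.face_le_face (h.adj j Φ) (i := c) ?_))
        · rw [h.face_adj j Φ (j := c) (by simp [c]; omega),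
            ← h.face_adj i Φ (j := c) (by simp [c])]
          exact (h.face_lt_face _ hbc).le
        · simp only [Fin.le_def, c]; omega
  obtain ⟨Ψ, hΨ⟩ := hchain.exists_subset_flag
  have hΨb : h.face Ψ b = h.face (h.adj i Φ) b :=
    (h.eq_face (hΨ (by simp)) (by simp)).symm
  have hΨk : ∀ k : Fin (d + 2), (k : ℕ) ≠ i + 1 → h.face Ψ k = h.face (h.adj j Φ) k := fun k hk =>
    (h.eq_face (hΨ (Set.mem_insert_of_mem _ ⟨k, fun h1 => hk (by simp [h1, b]), rfl⟩))
      (by simp)).symm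
  have h1 : Ψ = h.adj i (h.adj j Φ) := by
    refine (h.eq_or_eq_adj i fun k hk => (hΨk k hk).symm).resolve_left fun h1 => ?_
    rw [h1, h.face_adj j Φ (by simp [b]; omega)] at hΨb
    exact h.face_adj_ne i Φ (j := b) rfl hΨb.symm
  have h2 : Ψ = h.adj j (h.adj i Φ) := by
    refine (h.eq_or_eq_adj j fun k hk => ?_).resolve_left fun h2 => ?_
    · by_cases hk' : (k : ℕ) = i + 1
      · rw [show k = b from Fin.ext hk', hΨb]
      · rw [hΨk k hk', h.face_adj j Φ hk, h.face_adj i Φ hk']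
    · have := hΨk ⟨j + 1, by omega⟩ (by simp; omega)
      rw [h2, h.face_adj i Φ (by simp; omega)] at this
      exact h.face_adj_ne j Φ (j := ⟨j + 1, by omega⟩) rfl this.symm
  rw [← h1, h2]

/-- `Ψ` can be reached from `Φ` by passing to `j`-adjacent flags with `j ∈ J`. -/
def Linked (h : IsPolytope d P) (J : Set (Fin d)) : Flag P → Flag P → Prop :=
  Relation.ReflTransGen fun Φ Ψ => ∃ j ∈ J, Ψ = h.adj j Φ

theorem Linked.mono {h : IsPolytope d P} {J K : Set (Fin d)} (hJK : J ⊆ K) {Φ Ψ : Flag P}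
    (hL : h.Linked J Φ Ψ) : h.Linked K Φ Ψ :=
  Relation.ReflTransGen.mono (fun _ _ ⟨j, hj, e⟩ => ⟨j, hJK hj, e⟩) _ _ hL

/-- Passage from connected sections to linked flags. Consecutive faces on a path in the section are
incident, so some flag through both ends of the section contains both of them; `step` links any two
flags through the ends that share a face of the path. -/
theorem linked_of_section (h : IsPolytope d P) {J : Set (Fin d)} {a b : Fin (d + 2)}
    (hab : (a : ℕ) + 3 ≤ b)
    (step : ∀ c, a < c → c < b → ∀ Φ Ψ : Flag P, h.face Φ a = h.face Ψ a →
      h.face Φ b = h.face Ψ b → h.face Φ c = h.face Ψ c → h.Linked J Φ Ψ)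
    {Φ Ψ : Flag P} (ha : h.face Φ a = h.face Ψ a) (hb : h.face Φ b = h.face Ψ b) :
    h.Linked J Φ Ψ := by
  set c : Fin (d + 2) := ⟨a + 1, by omega⟩
  have hac : a < c := by simp [c, Fin.lt_def]
  have hcb : c < b := by simp only [c, Fin.lt_def]; omega
  have hr := h.strongly_connected (h.face Φ a) (h.face Φ b) (h.face_lt_face Φ (hac.trans hcb))
    (by rw [h.height_eq, h.height_eq, natHeight_face, natHeight_face]; exact_mod_cast hab)
    (h.face Φ c) ⟨h.face_lt_face Φ hac, h.face_lt_face Φ hcb⟩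
    (h.face Ψ c) ⟨ha ▸ h.face_lt_face Ψ hac, hb ▸ h.face_lt_face Ψ hcb⟩
  suffices H : ∀ y, Relation.ReflTransGen (fun x y => y ∈ Set.Ioo (h.face Φ a) (h.face Φ b) ∧
      (x < y ∨ y < x)) (h.face Φ c) y → y ∈ Set.Ioo (h.face Φ a) (h.face Φ b) ∧
      ∀ X : Flag P, h.face X a = h.face Φ a → h.face X b = h.face Φ b → y ∈ X →
        h.Linked J Φ X from
    (H _ hr).2 Ψ ha.symm hb.symm (h.face_mem Ψ c)
  intro y hy
  induction hy with
  | refl =>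
    refine ⟨⟨h.face_lt_face Φ hac, h.face_lt_face Φ hcb⟩, fun X hXa hXb hX => ?_⟩
    exact step c hac hcb Φ X hXa.symm hXb.symm (h.eq_face hX (by simp))
  | @tail y z _ hyz ih =>
    obtain ⟨hy, ih⟩ := ih
    obtain ⟨hz, hcmp⟩ := hyz
    refine ⟨hz, fun X hXa hXb hX => ?_⟩
    obtain ⟨Y, hY⟩ : ∃ Y : Flag P, ({h.face Φ a, h.face Φ b, y, z} : Set P) ⊆ Y := by
      refine IsChain.exists_subset_flag ?_
      have h0 := (h.face_lt_face Φ (hac.trans hcb)).le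
      have h1 := hy.1.le
      have h2 := hy.2.le
      have h3 := hz.1.le
      have h4 := hz.2.le
      have h5 : y ≤ z ∨ z ≤ y := hcmp.imp le_of_lt le_of_lt
      rintro u hu v hv -
      simp only [Set.mem_insert_iff, Set.mem_singleton_iff] at hu hv
      rcases hu with rfl | rfl | rfl | rfl <;> rcases hv with rfl | rfl | rfl | rfl <;>
        first
          | exact Or.inl le_rfl
          | exact Or.inl (by assumption)
          | exact Or.inr (by assumption)
          | assumption
          | exact Or.symm (by assumption)
    have hYa : h.face Φ a = h.face Y a := h.eq_face (hY (by simp)) (by simp)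
    have hYb : h.face Φ b = h.face Y b := h.eq_face (hY (by simp)) (by simp)
    have hzr1 := h.natHeight_strictMono hz.1
    have hzr2 := h.natHeight_strictMono hz.2
    rw [natHeight_face] at hzr1 hzr2
    refine (ih Y hYa.symm hYb.symm (hY (by simp))).trans ?_
    set e : Fin (d + 2) := ⟨natHeight z, by omega⟩
    refine step e hzr1 hzr2 Y X (hYa.symm.trans hXa.symm) (hYb.symm.trans hXb.symm) ?_
    rw [← h.eq_face (i := e) (hY (by simp) : z ∈ Y) rfl, ← h.eq_face (i := e) hX rfl]

end IsPolytope

namespace IsPolytope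

variable {P : Type*} [PartialOrder P]

theorem linked_of_two_faces (h : IsPolytope 3 P) {Φ Ψ : Flag P} {k l : Fin 5} {J : Set (Fin 3)}
    (j : Fin 3) (hj : j ∈ J) (hkl : ∀ i : Fin 5, i = 0 ∨ i = 4 ∨ i = k ∨ i = l ∨ (i : ℕ) = j + 1)
    (hk : h.face Φ k = h.face Ψ k) (hl : h.face Φ l = h.face Ψ l) : h.Linked J Φ Ψ := by
  have H : ∀ i : Fin 5, (i : ℕ) ≠ j + 1 → h.face Φ i = h.face Ψ i := by
    intro i hi
    rcases hkl i with rfl | rfl | rfl | rfl | h1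
    · exact h.face_zero_eq _ _
    · exact h.face_last_eq _ _
    · exact hk
    · exact hl
    · exact absurd h1 hi
  rcases h.eq_or_eq_adj j H with rfl | rfl
  · exact Relation.ReflTransGen.refl
  · exact Relation.ReflTransGen.single ⟨j, hj, rfl⟩

/-- Strong flag-connectedness in rank 3, the form in which connectedness is used from here on. A
vertex or a 2-face bounds a section to which `linked_of_section` applies. The sections on both sides
of an edge are too short for that, but the choices of the vertex and of the 2-face at an edge are
independent. -/
theorem linked_of_face_eq (h : IsPolytope 3 P) {Φ Ψ : Flag P} {k : Fin 5}
    (hk : h.face Φ k = h.face Ψ k) : h.Linked {j | (j : ℕ) + 1 ≠ k} Φ Ψ := by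
  have h1 : ∀ Φ Ψ : Flag P, h.face Φ 1 = h.face Ψ 1 →
      h.Linked {j | (j : ℕ) + 1 ≠ (1 : Fin 5)} Φ Ψ := by
    intro Φ Ψ h1
    refine h.linked_of_section (a := 1) (b := 4) (by decide) ?_ h1 (h.face_last_eq _ _)
    intro c hc1 hc2 Φ Ψ hΦ1 _ hc
    obtain rfl | rfl : c = 2 ∨ c = 3 := by clear hc; revert c; decide
    · exact h.linked_of_two_faces 2 (by simp) (by decide) hΦ1 hc
    · exact h.linked_of_two_faces 1 (by simp) (by decide) hΦ1 hc
  have h3 : ∀ Φ Ψ : Flag P, h.face Φ 3 = h.face Ψ 3 →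
      h.Linked {j | (j : ℕ) + 1 ≠ (3 : Fin 5)} Φ Ψ := by
    intro Φ Ψ h1
    refine h.linked_of_section (a := 0) (b := 3) (by decide) ?_ (h.face_zero_eq _ _) h1
    intro c hc1 hc2 Φ Ψ _ hΦ1 hc
    obtain rfl | rfl : c = 1 ∨ c = 2 := by clear hc; revert c; decide
    · exact h.linked_of_two_faces 1 (by simp) (by decide) hΦ1 hc
    · exact h.linked_of_two_faces 0 (by simp) (by decide) hΦ1 hc
  have h2 : ∀ Φ Ψ : Flag P, h.face Φ 2 = h.face Ψ 2 →
      h.Linked {j | (j : ℕ) + 1 ≠ (2 : Fin 5)} Φ Ψ := by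
    intro Φ Ψ he
    -- pass through a flag with the vertex of `Φ` and the face of `Ψ`
    obtain ⟨X, hX⟩ : ∃ X : Flag P, ({h.face Φ 1, h.face Φ 2, h.face Ψ 3} : Set P) ⊆ X := by
      refine IsChain.exists_subset_flag ?_
      have h12 : h.face Φ 1 ≤ h.face Φ 2 := h.face_le_face Φ (by decide)
      have h23 : h.face Φ 2 ≤ h.face Ψ 3 := he ▸ h.face_le_face Ψ (by decide)
      have h13 := h12.trans h23
      rintro u hu v hv -
      simp only [Set.mem_insert_iff, Set.mem_singleton_iff] at hu hv
      rcases hu with rfl | rfl | rfl <;> rcases hv with rfl | rfl | rfl <;>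
        first
          | exact Or.inl le_rfl
          | exact Or.inl (by assumption)
          | exact Or.inr (by assumption)
    have e1 : h.face Φ 1 = h.face X 1 := h.eq_face (hX (by simp)) (by simp)
    have e2 : h.face Φ 2 = h.face X 2 := h.eq_face (hX (by simp)) (by simp)
    have e3 : h.face Ψ 3 = h.face X 3 := h.eq_face (hX (by simp)) (by simp)
    exact (h.linked_of_two_faces 2 (by simp) (by decide) e1 e2).trans
      (h.linked_of_two_faces 0 (by simp) (by decide) (e2.symm.trans he) e3.symm)
  have h0 : ∀ Φ Ψ : Flag P, h.Linked Set.univ Φ Ψ := by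
    intro Φ Ψ
    refine h.linked_of_section (a := 0) (b := 4) (by decide) ?_ (h.face_zero_eq _ _)
      (h.face_last_eq _ _)
    intro c hc1 hc2 Φ Ψ _ _ hc
    obtain rfl | rfl | rfl : c = 1 ∨ c = 2 ∨ c = 3 := by
      clear hc; revert c; decide
    · exact (h1 _ _ hc).mono (Set.subset_univ _)
    · exact (h2 _ _ hc).mono (Set.subset_univ _)
    · exact (h3 _ _ hc).mono (Set.subset_univ _)
  obtain rfl | rfl | rfl | rfl | rfl : k = 0 ∨ k = 1 ∨ k = 2 ∨ k = 3 ∨ k = 4 := by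
    clear hk; revert k; decide
  · exact (h0 Φ Ψ).mono fun j _ => by simp
  · exact h1 _ _ hk
  · exact h2 _ _ hk
  · exact h3 _ _ hk
  · exact (h0 Φ Ψ).mono fun j _ => by simp only [Set.mem_ofPred_eq]; have := j.2; omega

theorem linked_univ (h : IsPolytope 3 P) (Φ Ψ : Flag P) : h.Linked Set.univ Φ Ψ :=
  (h.linked_of_face_eq (h.face_zero_eq Φ Ψ)).mono (Set.subset_univ _)

theorem natHeight_orderIso (g : P ≃o P) (x : P) : natHeight (g x) = natHeight x := by
  rw [natHeight, natHeight, Order.height_orderIso]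

theorem face_map (h : IsPolytope 3 P) (g : P ≃o P) (Φ : Flag P) (i : Fin 5) :
    h.face (Flag.map g Φ) i = g (h.face Φ i) :=
  (h.eq_face (show g (h.face Φ i) ∈ ((Flag.map g Φ : Flag P) : Set P) from
    ⟨_, h.face_mem Φ i, rfl⟩) (by rw [natHeight_orderIso, natHeight_face])).symm

theorem adj_map (h : IsPolytope 3 P) (g : P ≃o P) (i : Fin 3) (Φ : Flag P) :
    h.adj i (Flag.map g Φ) = Flag.map g (h.adj i Φ) := by
  refine (h.eq_adj (h.adjacent_iff.2 ⟨?_, fun j hj => ?_⟩)).symm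
  · intro h1
    exact h.adj_ne i Φ ((Flag.map g).injective h1).symm
  · rw [h.face_map, h.face_map, h.face_adj i Φ hj]

/-- An automorphism that fixes a flag is trivial. -/
theorem eq_one_of_map_flag (h : IsPolytope 3 P) {g : P ≃o P} {Φ : Flag P}
    (hg : Flag.map g Φ = Φ) : g = 1 := by
  have key : ∀ Ψ, Flag.map g Ψ = Ψ := by
    intro Ψ
    have := h.linked_univ Φ Ψ
    induction this with
    | refl => exact hg
    | tail _ hs ih =>
      obtain ⟨j, -, rfl⟩ := hs
      rw [← h.adj_map, ih]
  refine RelIso.ext fun x => ?_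
  obtain ⟨Ψ, hx, -⟩ := h.exists_flag_of_le (le_refl x)
  obtain ⟨i, rfl⟩ := h.mem_iff_face.1 hx
  rw [← h.face_map, key]
  rfl

end IsPolytope

end ArchPoly

/-! ### The coset poset of a string C-group is a regular polytope -/

namespace ArchPoly

namespace StringCGroup

variable {W : Type*} [Group W] {n : ℕ} {S : StringCGroup W n}

/-- The face of rank `k - 1` that contains `w`. -/
def mkFace (S : StringCGroup W n) (k : Fin (n + 2)) (w : W) : S.Face := ⟨k, w⟩

theorem exists_mkFace (F : S.Face) : ∃ w, S.mkFace F.level w = F := by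
  obtain ⟨w, hw⟩ := QuotientGroup.mk_surjective F.coset
  exact ⟨w, Face.ext rfl (heq_of_eq hw)⟩

theorem mkFace_eq_iff {k : Fin (n + 2)} {u v : W} :
    S.mkFace k u = S.mkFace k v ↔ u⁻¹ * v ∈ S.faceStab k := by
  rw [← QuotientGroup.eq]
  constructor
  · intro h
    exact eq_of_heq (Face.mk.inj h).2
  · intro h
    exact Face.ext rfl (heq_of_eq h)

theorem mkFace_mul {k : Fin (n + 2)} (u : W) {v : W} (hv : v ∈ S.faceStab k) :
    S.mkFace k (u * v) = S.mkFace k u := by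
  rw [mkFace_eq_iff]
  simpa [mul_assoc] using inv_mem hv

theorem mkFace_le_mkFace {i j : Fin (n + 2)} (hij : i ≤ j) (w : W) :
    S.mkFace i w ≤ S.mkFace j w := ⟨hij, w, rfl, rfl⟩

theorem exists_of_le {F G : S.Face} (h : F ≤ G) :
    ∃ w, F = S.mkFace F.level w ∧ G = S.mkFace G.level w := by
  obtain ⟨-, w, h1, h2⟩ := h
  exact ⟨w, Face.ext rfl (heq_of_eq h1), Face.ext rfl (heq_of_eq h2)⟩

theorem eq_of_le_of_level_eq {F G : S.Face} (h : F ≤ G) (hl : F.level = G.level) : F = G := by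
  obtain ⟨w, h1, h2⟩ := exists_of_le h
  rw [h1, h2, hl]

theorem lt_iff {F G : S.Face} : F < G ↔ F ≤ G ∧ F.level < G.level := by
  constructor
  · intro h
    exact ⟨h.le, lt_of_le_of_ne h.le.1 fun hl => h.ne (eq_of_le_of_level_eq h.le hl)⟩
  · rintro ⟨h, hl⟩
    exact lt_of_le_of_ne h fun e => by simp [e] at hl

theorem mkFace_lt_mkFace {i j : Fin (n + 2)} (hij : i < j) (w : W) :
    S.mkFace i w < S.mkFace j w := lt_iff.2 ⟨mkFace_le_mkFace hij.le w, hij⟩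

theorem gen_mem_faceStab {k : Fin (n + 2)} {j : Fin n} (h : (j : ℕ) + 1 ≠ k) :
    S.gen j ∈ S.faceStab k :=
  Subgroup.subset_closure ⟨j, h, rfl⟩

/-- Two representatives of the middle coset differ by `u * v`, with `u` a word in the generators
above the middle level and `v` a word in those below. Then `u` stabilizes the faces up to the middle
one and `v` those from the middle one upwards, so `x * u` represents all three cosets. -/
theorem exists_of_le_of_le {F G K : S.Face} (hFG : F ≤ G) (hGK : G ≤ K) :
    ∃ w, F = S.mkFace F.level w ∧ G = S.mkFace G.level w ∧ K = S.mkFace K.level w := by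
  obtain ⟨x, hF, hG⟩ := exists_of_le hFG
  obtain ⟨y, hG', hK⟩ := exists_of_le hGK
  obtain ⟨u, hu, v, hv, huv⟩ := exists_factor (mkFace_eq_iff.1 (hG.symm.trans hG'))
  have hy : y = x * u * v := by rw [mul_assoc, ← huv]; group
  have hu' : ∀ k ≤ G.level, u ∈ S.faceStab k := fun k hk =>
    Subgroup.closure_mono (Set.image_mono fun l hl => by
      simp only [Set.mem_ofPred_eq, Fin.le_def] at hl hk ⊢; omega) hu
  have hv' : ∀ k, G.level ≤ k → v ∈ S.faceStab k := fun k hk =>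
    Subgroup.closure_mono (Set.image_mono fun l hl => by
      simp only [Set.mem_ofPred_eq, Fin.le_def] at hl hk ⊢; omega) hv
  refine ⟨x * u, ?_, ?_, ?_⟩
  · rw [mkFace_mul _ (hu' _ hFG.1)]; exact hF
  · rw [mkFace_mul _ (hu' _ le_rfl)]; exact hG
  · rw [← mkFace_mul (x * u) (hv' _ hGK.1), ← hy]; exact hK

theorem faceStab_zero : S.faceStab 0 = ⊤ := by
  rw [faceStab, show {j : Fin n | (j : ℕ) + 1 ≠ (0 : Fin (n + 2))} = Set.univ from by ext; simp,
    Set.image_univ, S.closure_gen]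

theorem faceStab_last : S.faceStab (Fin.last _) = ⊤ := by
  rw [faceStab, show {j : Fin n | (j : ℕ) + 1 ≠ (Fin.last (n + 1))} = Set.univ from by
    ext j; simp; omega, Set.image_univ, S.closure_gen]

theorem isGraded_level : IsGraded n (fun F : S.Face => (F.level : ℕ)) where
  strictMono := fun _ _ h => (lt_iff.1 h).2
  bot := by
    refine ⟨S.mkFace 0 1, fun F => ?_, rfl⟩
    obtain ⟨w, hw⟩ := exists_mkFace F
    refine le_trans (le_of_eq ?_) ((mkFace_le_mkFace (Fin.zero_le _) w).trans_eq hw)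
    rw [mkFace_eq_iff, faceStab_zero]; trivial
  top := by
    refine ⟨S.mkFace (Fin.last _) 1, fun F => ?_, rfl⟩
    obtain ⟨w, hw⟩ := exists_mkFace F
    refine le_trans (hw.ge.trans (mkFace_le_mkFace (Fin.le_last _) w)) (le_of_eq ?_)
    rw [mkFace_eq_iff, faceStab_last]; trivial
  between := by
    intro F G hFG hr
    obtain ⟨w, hF, hG⟩ := exists_of_le hFG.le
    have hlt := G.level.2
    refine ⟨S.mkFace ⟨F.level + 1, by omega⟩ w, ?_, ?_⟩
    · exact hF.trans_lt (mkFace_lt_mkFace (by simp [Fin.lt_def]) w)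
    · exact (mkFace_lt_mkFace (by simp only [Fin.lt_def]; omega) w).trans_eq hG.symm

/-- By the intersection property with `{i}`, the involution would lie in the trivial subgroup. -/
theorem gen_notMem {I : Set (Fin n)} {i : Fin n} (hi : i ∉ I) :
    S.gen i ∉ Subgroup.closure (S.gen '' I) := by
  intro h
  have h1 : S.gen i ∈ Subgroup.closure (S.gen '' {i}) := Subgroup.subset_closure ⟨i, rfl, rfl⟩
  have h2 : S.gen i ∈ Subgroup.closure (S.gen '' (I ∩ {i})) := S.inter I {i} ▸ ⟨h, h1⟩
  rw [show I ∩ {i} = ∅ from by ext j; simp; rintro hj rfl; exact hi hj, Set.image_empty,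
    Subgroup.closure_empty, Subgroup.mem_bot] at h2
  have := S.orderOf_gen i
  rw [h2, orderOf_one] at this
  norm_num at this

theorem faceStab_inf_faceStab (i k : Fin (n + 2)) : S.faceStab i ⊓ S.faceStab k =
    Subgroup.closure (S.gen '' {j | (j : ℕ) + 1 ≠ i ∧ (j : ℕ) + 1 ≠ k}) :=
  S.inter _ _

/-- A common representative of the three faces differs from `w` by an element that stabilizes both
ends; the intersection property makes this element a word in the generators that do. -/
theorem exists_of_mem_Icc {w : W} {i k : Fin (n + 2)} {F : S.Face}
    (h1 : S.mkFace i w ≤ F) (h2 : F ≤ S.mkFace k w) :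
    ∃ x ∈ Subgroup.closure (S.gen '' {j | (j : ℕ) + 1 ≠ i ∧ (j : ℕ) + 1 ≠ k}),
      F = S.mkFace F.level (w * x) := by
  obtain ⟨y, hy1, hy2, hy3⟩ := exists_of_le_of_le h1 h2
  refine ⟨w⁻¹ * y, ?_, by simpa using hy2⟩
  rw [← faceStab_inf_faceStab]
  exact ⟨mkFace_eq_iff.1 hy1, mkFace_eq_iff.1 hy3⟩

/-- The faces in the middle are the cosets of `w * x`, with `x` a word in the generators that fix
both ends. Except for `S.gen a`, these generators also fix the middle face, and they commute with
`S.gen a`. Hence only the parity of `S.gen a` in `x` matters, and the two faces are the cosets of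
`w` and `w * S.gen a`. -/
theorem diamond {F G : S.Face} (hFG : F < G) (hl : (G.level : ℕ) = F.level + 2) :
    (Set.Ioo F G).ncard = 2 := by
  obtain ⟨w, hF, hG⟩ := exists_of_le hFG.le
  have hlt := G.level.2
  set k : Fin (n + 2) := ⟨F.level + 1, by omega⟩ with hk
  set a : Fin n := ⟨F.level, by omega⟩ with ha
  have hFk : F.level < k := by simp [hk, Fin.lt_def]
  have hkG : k < G.level := by simp only [hk, Fin.lt_def]; omega
  have haF : S.gen a ∈ S.faceStab F.level := gen_mem_faceStab (by simp [ha])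
  have haG : S.gen a ∈ S.faceStab G.level := gen_mem_faceStab (by simp [ha]; omega)
  have hak : S.gen a ∉ S.faceStab k := gen_notMem (by simp [ha, hk])
  rw [Set.ncard_eq_two]
  refine ⟨S.mkFace k w, S.mkFace k (w * S.gen a), ?_, ?_⟩
  · rw [Ne, mkFace_eq_iff]
    simpa using hak
  ext z
  simp only [Set.mem_Ioo, Set.mem_insert_iff, Set.mem_singleton_iff]
  constructor
  · rintro ⟨h1, h2⟩
    have hz : z.level = k := by
      have e1 := (lt_iff.1 h1).2
      have e2 := (lt_iff.1 h2).2
      simp only [Fin.lt_def, Fin.ext_iff, hk] at e1 e2 ⊢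
      omega
    rw [hF] at h1
    rw [hG] at h2
    obtain ⟨x, hx, hzx⟩ := exists_of_mem_Icc h1.le h2.le
    rw [hz] at hzx
    suffices H : x ∈ S.faceStab k ∨ S.gen a * x ∈ S.faceStab k by
      rw [hzx]
      rcases H with H | H
      · exact Or.inl (mkFace_mul _ H)
      · right
        rw [← mkFace_mul (w * S.gen a) H]
        congr 1
        rw [mul_assoc, ← mul_assoc (S.gen a), gen_mul_self, one_mul]
    have hgen : ∀ j : Fin n, (j : ℕ) + 1 ≠ F.level ∧ (j : ℕ) + 1 ≠ G.level → ∀ y,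
        y ∈ S.faceStab k ∨ S.gen a * y ∈ S.faceStab k →
        S.gen j * y ∈ S.faceStab k ∨ S.gen a * (S.gen j * y) ∈ S.faceStab k := by
      intro j hj y hy
      by_cases hja : j = a
      · subst hja
        rw [← mul_assoc, gen_mul_self, one_mul]
        exact hy.symm
      have hja' : (j : ℕ) ≠ F.level := fun h => hja (Fin.ext h)
      have hjk : S.gen j ∈ S.faceStab k := gen_mem_faceStab (by simpa [hk] using hja')
      have hcomm : S.gen a * S.gen j = S.gen j * S.gen a := by
        rcases Nat.lt_or_ge (j : ℕ) F.level with h | h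
        · exact (gen_comm (by simp only [ha]; omega)).symm
        · exact gen_comm (by simp only [ha]; omega)
      refine hy.imp (mul_mem hjk) fun h => ?_
      rw [← mul_assoc, hcomm, mul_assoc]
      exact mul_mem hjk h
    clear hzx
    induction hx using Subgroup.closure_induction_left with
    | one => exact Or.inl (one_mem _)
    | mul_left x hx y _ ih =>
      obtain ⟨j, hj, rfl⟩ := hx
      exact hgen j hj y ih
    | inv_mul_cancel x hx y _ ih =>
      obtain ⟨j, hj, rfl⟩ := hx
      rw [inv_eq_of_mul_eq_one_left (gen_mul_self j)]
      exact hgen j hj y ih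
  · rintro (rfl | rfl)
    · rw [hF, hG]
      exact ⟨mkFace_lt_mkFace hFk w, mkFace_lt_mkFace hkG w⟩
    · rw [hF, hG, ← mkFace_mul w haF, ← mkFace_mul w haG]
      exact ⟨mkFace_lt_mkFace hFk _, mkFace_lt_mkFace hkG _⟩

/-- A word in the generators that fix both ends describes a path: appending one letter keeps some
intermediate face, and intermediate faces with a common representative are incident. -/
theorem strongly_connected {H K : S.Face} (hl : (H.level : ℕ) + 3 ≤ K.level)
    {F G : S.Face} (hF : F ∈ Set.Ioo H K) (hG : G ∈ Set.Ioo H K) :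
    Relation.ReflTransGen (fun x y => y ∈ Set.Ioo H K ∧ (x < y ∨ y < x)) F G := by
  obtain ⟨w, hwH, hwF, hwK⟩ := exists_of_le_of_le hF.1.le hF.2.le
  set M := Subgroup.closure (S.gen '' {j | (j : ℕ) + 1 ≠ H.level ∧ (j : ℕ) + 1 ≠ K.level}) with hM
  have hMHK : M = S.faceStab H.level ⊓ S.faceStab K.level := (faceStab_inf_faceStab _ _).symm
  have hmem : ∀ x ∈ M, ∀ j, H.level < j → j < K.level →
      S.mkFace j (w * x) ∈ Set.Ioo H K := by
    intro x hx j h1 h2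
    rw [hMHK] at hx
    rw [hwH, hwK, ← mkFace_mul w hx.1, ← mkFace_mul w hx.2]
    exact ⟨mkFace_lt_mkFace h1 _, mkFace_lt_mkFace h2 _⟩
  have hturn : ∀ x ∈ M, ∀ i j, H.level < i → i < K.level → H.level < j → j < K.level →
      Relation.ReflTransGen (fun x y => y ∈ Set.Ioo H K ∧ (x < y ∨ y < x))
        (S.mkFace i (w * x)) (S.mkFace j (w * x)) := by
    intro x hx i j _ _ h3 h4
    rcases lt_trichotomy i j with h | rfl | h
    · exact Relation.ReflTransGen.single ⟨hmem x hx j h3 h4, Or.inl (mkFace_lt_mkFace h _)⟩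
    · exact Relation.ReflTransGen.refl
    · exact Relation.ReflTransGen.single ⟨hmem x hx j h3 h4, Or.inr (mkFace_lt_mkFace h _)⟩
  have hF1 := (lt_iff.1 hF.1).2
  have hF2 := (lt_iff.1 hF.2).2
  have hlt := K.level.2
  have main : ∀ x ∈ M, ∀ j, H.level < j → j < K.level →
      Relation.ReflTransGen (fun x y => y ∈ Set.Ioo H K ∧ (x < y ∨ y < x))
        F (S.mkFace j (w * x)) := by
    intro x hx
    have hgen : ∀ x ∈ M, ∀ l : Fin n, (l : ℕ) + 1 ≠ H.level ∧ (l : ℕ) + 1 ≠ K.level →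
        (∀ j, H.level < j → j < K.level → Relation.ReflTransGen
          (fun x y => y ∈ Set.Ioo H K ∧ (x < y ∨ y < x)) F (S.mkFace j (w * x))) →
        ∀ j, H.level < j → j < K.level → Relation.ReflTransGen
          (fun x y => y ∈ Set.Ioo H K ∧ (x < y ∨ y < x)) F (S.mkFace j (w * (x * S.gen l))) := by
      intro x hx l hl' ih j h1 h2
      -- At least two levels lie strictly between the ends, and the generator `l` moves faces of
      -- level `l + 1` only.
      obtain ⟨i, hi1, hi2, hil⟩ : ∃ i : Fin (n + 2), H.level < i ∧ i < K.level ∧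
          (l : ℕ) + 1 ≠ i := by
        by_cases h : (l : ℕ) + 1 = H.level + 1
        · exact ⟨⟨H.level + 2, by omega⟩, by simp [Fin.lt_def],
            by simp only [Fin.lt_def]; omega, by simp; omega⟩
        · exact ⟨⟨H.level + 1, by omega⟩, by simp [Fin.lt_def],
            by simp only [Fin.lt_def]; omega, by simpa using h⟩
      have hxl : x * S.gen l ∈ M := mul_mem hx (Subgroup.subset_closure ⟨l, hl', rfl⟩)
      refine Relation.ReflTransGen.trans ?_ (hturn _ hxl i j hi1 hi2 h1 h2)
      rw [← mul_assoc, mkFace_mul _ (gen_mem_faceStab hil)]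
      exact ih i hi1 hi2
    induction hx using Subgroup.closure_induction_right with
    | one =>
      intro j h1 h2
      have := hturn 1 (one_mem _) F.level j hF1 hF2 h1 h2
      rw [mul_one] at this ⊢
      convert this using 1
    | mul_right x hx y hy ih =>
      obtain ⟨l, hl', rfl⟩ := hy
      exact hgen x hx l hl' ih
    | mul_inv_cancel x hx y hy ih =>
      obtain ⟨l, hl', rfl⟩ := hy
      rw [inv_eq_of_mul_eq_one_left (gen_mul_self l)]
      exact hgen x hx l hl' ih
  obtain ⟨x, hx, hGx⟩ := exists_of_mem_Icc (S := S) (w := w) (i := H.level) (k := K.level)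
    (hwH ▸ hG.1.le) (hwK ▸ hG.2.le)
  rw [hGx]
  exact main x hx _ (lt_iff.1 hG.1).2 (lt_iff.1 hG.2).2

variable (S) in
/-- The poset `P(W)` of a string C-group is an abstract polytope. -/
theorem isPolytope : IsPolytope n S.Face where
  bounded := by
    obtain ⟨b, hb, -⟩ := (isGraded_level (S := S)).bot
    obtain ⟨t, ht, -⟩ := (isGraded_level (S := S)).top
    exact ⟨⟨b, hb⟩, t, ht⟩
  flag_card := isGraded_level.ncard_flag
  strongly_connected := by
    intro H K _ hl F hF G hG
    rw [isGraded_level.height_eq, isGraded_level.height_eq] at hl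
    exact strongly_connected (by exact_mod_cast hl) hF hG
  diamond := by
    intro F G hFG hl
    rw [isGraded_level.height_eq, isGraded_level.height_eq] at hl
    exact diamond hFG (by exact_mod_cast hl)

theorem natHeight_eq (F : S.Face) : natHeight F = F.level := by
  rw [natHeight, isGraded_level.height_eq]
  rfl

theorem exists_mkFace_flag (w : W) :
    ∃ Φ : Flag S.Face, ∀ i, S.isPolytope.face Φ i = S.mkFace i w := by
  have hc : IsChain (· ≤ ·) (Set.range fun i => S.mkFace i w) :=
    Monotone.isChain_range fun i j hij => mkFace_le_mkFace hij w
  obtain ⟨Φ, hΦ⟩ := hc.exists_subset_flag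
  exact ⟨Φ, fun i => (S.isPolytope.eq_face (hΦ ⟨i, rfl⟩) (natHeight_eq _)).symm⟩

variable (S) in
/-- The flag that consists of the cosets of `w`. -/
noncomputable def flag (w : W) : Flag S.Face := (exists_mkFace_flag (S := S) w).choose

@[simp] theorem face_flag (w : W) (i : Fin (n + 2)) :
    S.isPolytope.face (S.flag w) i = S.mkFace i w :=
  (exists_mkFace_flag (S := S) w).choose_spec i

theorem coe_flag (w : W) : (S.flag w : Set S.Face) = Set.range fun i => S.mkFace i w := by
  ext x
  rw [SetLike.mem_coe, S.isPolytope.mem_iff_face]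
  simp

theorem adjacent_flag (w : W) (i : Fin n) :
    Adjacent i (S.flag w) (S.flag (w * S.gen i)) := by
  rw [S.isPolytope.adjacent_iff]
  refine ⟨fun h => ?_, fun j hj => ?_⟩
  · have := congrArg (fun Φ => S.isPolytope.face Φ ⟨i + 1, by omega⟩) h
    simp only [face_flag] at this
    rw [mkFace_eq_iff, inv_mul_cancel_left] at this
    exact gen_notMem (I := {j | (j : ℕ) + 1 ≠ (i : ℕ) + 1}) (by simp) this
  · rw [face_flag, face_flag, mkFace_mul _ (gen_mem_faceStab (Ne.symm hj))]

end StringCGroup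

namespace StringCGroup

variable {W : Type*} [Group W] {S : StringCGroup W 3}

/-- Passing to the `j`-adjacent flag multiplies the representative by `S.gen j` on the right, and
all flags are reached in this way. -/
theorem exists_eq_flag (Φ : Flag S.Face) : ∃ w, Φ = S.flag w := by
  have h := S.isPolytope.linked_univ (S.flag 1) Φ
  induction h with
  | refl => exact ⟨1, rfl⟩
  | tail _ h ih =>
    obtain ⟨w, rfl⟩ := ih
    obtain ⟨j, -, rfl⟩ := h
    exact ⟨w * S.gen j, (S.isPolytope.eq_adj (adjacent_flag w j)).symm⟩

theorem map_toAut_flag (u v : W) : Flag.map (S.toAut u) (S.flag v) = S.flag (u * v) :=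
  S.isPolytope.flag_ext fun i => by
    rw [S.isPolytope.face_map, face_flag, face_flag]
    rfl

variable (S) in
theorem isRegularPolytope : IsRegularPolytope 3 S.Face := by
  refine ⟨S.isPolytope, fun Φ Ψ => ?_⟩
  obtain ⟨u, rfl⟩ := exists_eq_flag Φ
  obtain ⟨v, rfl⟩ := exists_eq_flag Ψ
  exact ⟨S.toAut (v * u⁻¹), by rw [map_toAut_flag, inv_mul_cancel_right]⟩

/-- The stabilizers of the vertex, the edge and the 2-face of the base flag have no generator in
common, so two applications of the intersection property show that they meet trivially. -/
theorem eq_one_of_flag_eq {w : W} (h : S.flag w = S.flag 1) : w = 1 := by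
  have h1 : ∀ i, w⁻¹ ∈ S.faceStab i := by
    intro i
    have := congrArg (fun Φ => S.isPolytope.face Φ i) h
    simp only [face_flag] at this
    simpa using mkFace_eq_iff.1 this
  have h2 : w⁻¹ ∈ Subgroup.closure (S.gen '' (({j | (j : ℕ) + 1 ≠ (1 : Fin 5)} ∩
      {j | (j : ℕ) + 1 ≠ (2 : Fin 5)}) ∩ {j | (j : ℕ) + 1 ≠ (3 : Fin 5)})) := by
    rw [← S.inter, ← S.inter]
    exact ⟨⟨h1 1, h1 2⟩, h1 3⟩
  have h3 : (({j : Fin 3 | (j : ℕ) + 1 ≠ (1 : Fin 5)} ∩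
      {j | (j : ℕ) + 1 ≠ (2 : Fin 5)}) ∩ {j | (j : ℕ) + 1 ≠ (3 : Fin 5)}) = ∅ := by
    ext j
    fin_cases j <;> simp
  rw [h3, Set.image_empty, Subgroup.closure_empty, Subgroup.mem_bot] at h2
  exact inv_eq_one.1 h2

-- `W` is simply transitive on the flags, and an automorphism is determined by the image of one
-- flag.
variable (S) in
theorem bijective_toAut : Function.Bijective S.toAut := by
  constructor
  · rw [injective_iff_map_eq_one]
    intro w hw
    refine eq_one_of_flag_eq (S := S) ?_
    have := map_toAut_flag (S := S) w 1
    rw [hw, mul_one] at this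
    rw [← this]
    refine S.isPolytope.flag_ext fun i => ?_
    rw [S.isPolytope.face_map]
    rfl
  · intro g
    obtain ⟨w, hw⟩ := exists_eq_flag (Flag.map g (S.flag 1))
    refine ⟨w, ?_⟩
    have h1 : Flag.map (g⁻¹ * S.toAut w) (S.flag 1) = S.flag 1 := by
      refine S.isPolytope.flag_ext fun i => ?_
      rw [S.isPolytope.face_map, RelIso.mul_apply, ← S.isPolytope.face_map (S.toAut w),
        map_toAut_flag, mul_one, ← hw, S.isPolytope.face_map]
      exact RelIso.inv_apply_self _ _
    exact (inv_mul_eq_one.1 (S.isPolytope.eq_one_of_map_flag h1)).symm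

theorem finite_face [Finite W] {n : ℕ} (S : StringCGroup W n) : Finite S.Face := by
  have : Function.Surjective fun p : Fin (n + 2) × W => S.mkFace p.1 p.2 := by
    intro F
    obtain ⟨w, hw⟩ := exists_mkFace F
    exact ⟨(F.level, w), hw⟩
  exact Finite.of_surjective _ this

end StringCGroup

end ArchPoly

/-! ### Flag actions, monodromy groups, quotients and coverings -/

namespace ArchPoly

namespace IsFlagAction

variable {P : Type*} [PartialOrder P] {G : Type*} [Group G] {s : Fin 3 → G}
  {act : Flag P → G → Flag P}

theorem act_gen_eq_adj (ha : IsFlagAction s act) (h : IsPolytope 3 P) (Φ : Flag P) (i : Fin 3) :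
    act Φ (s i) = h.adj i Φ :=
  h.eq_adj (ha.act_gen Φ i)

theorem act_act_inv (ha : IsFlagAction s act) (Φ : Flag P) (u : G) : act (act Φ u) u⁻¹ = Φ := by
  rw [← ha.act_mul, mul_inv_cancel, ha.act_one]

theorem act_inv_act (ha : IsFlagAction s act) (Φ : Flag P) (u : G) : act (act Φ u⁻¹) u = Φ := by
  rw [← ha.act_mul, inv_mul_cancel, ha.act_one]

theorem exists_act_of_linked (ha : IsFlagAction s act) (h : IsPolytope 3 P) {J : Set (Fin 3)}
    {Φ Ψ : Flag P} (hL : h.Linked J Φ Ψ) : ∃ w ∈ Subgroup.closure (s '' J), act Φ w = Ψ := by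
  induction hL with
  | refl => exact ⟨1, one_mem _, ha.act_one Φ⟩
  | tail _ hs ih =>
    obtain ⟨w, hw, rfl⟩ := ih
    obtain ⟨j, hj, rfl⟩ := hs
    exact ⟨w * s j, mul_mem hw (Subgroup.subset_closure ⟨j, hj, rfl⟩),
      by rw [ha.act_mul, ha.act_gen_eq_adj h]⟩

theorem exists_act (ha : IsFlagAction s act) (h : IsPolytope 3 P) (Φ Ψ : Flag P) :
    ∃ w, act Φ w = Ψ :=
  let ⟨w, _, hw⟩ := ha.exists_act_of_linked h (h.linked_univ Φ Ψ)
  ⟨w, hw⟩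

theorem face_act (ha : IsFlagAction s act) (h : IsPolytope 3 P) {J : Set (Fin 3)} {w : G}
    (hw : w ∈ Subgroup.closure (s '' J)) {k : Fin 5} (hk : ∀ j ∈ J, (j : ℕ) + 1 ≠ k)
    (Φ : Flag P) : h.face (act Φ w) k = h.face Φ k := by
  induction hw using Subgroup.closure_induction generalizing Φ with
  | mem x hx =>
    obtain ⟨j, hj, rfl⟩ := hx
    rw [ha.act_gen_eq_adj h, h.face_adj j Φ (hk j hj).symm]
  | one => rw [ha.act_one]
  | mul x y _ _ hx hy => rw [ha.act_mul, hy, hx]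
  | inv x _ hx =>
    rw [← hx (act Φ x⁻¹), ha.act_inv_act]

theorem mem_stabilizer (ha : IsFlagAction s act) {Φ : Flag P} {w : G} :
    w ∈ ha.stabilizer Φ ↔ act Φ w = Φ := Iff.rfl

/-- The action is transitive, so the flag stabilizers are conjugate and the core of one of them is
their intersection, the kernel of the action. -/
theorem mem_normalCore_stabilizer (ha : IsFlagAction s act) (h : IsPolytope 3 P) {Φ : Flag P}
    {w : G} : w ∈ (ha.stabilizer Φ).normalCore ↔ ∀ Ψ, act Ψ w = Ψ := by
  constructor
  · intro hw Ψ
    obtain ⟨u, rfl⟩ := ha.exists_act h Φ Ψ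
    have := hw u
    rw [ha.mem_stabilizer, ha.act_mul, ha.act_mul] at this
    conv_rhs => rw [← this]
    rw [ha.act_inv_act]
  · intro hw u
    rw [ha.mem_stabilizer, ha.act_mul, ha.act_mul, hw, ha.act_act_inv]

/-- Orbit-stabilizer theorem. Acting by inverses turns the right action into a left action with the
same stabilizers. -/
theorem card_stabilizer (ha : IsFlagAction s act) (h : IsPolytope 3 P) (Φ : Flag P) :
    Nat.card (ha.stabilizer Φ) * Nat.card (Flag P) = Nat.card G := by
  let _ : MulAction G (Flag P) :=
    { smul := fun w Ψ => act Ψ w⁻¹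
      one_smul := fun Ψ => by change act Ψ 1⁻¹ = Ψ; rw [inv_one, ha.act_one]
      mul_smul := fun u v Ψ => by
        change act Ψ (u * v)⁻¹ = act (act Ψ v⁻¹) u⁻¹
        rw [mul_inv_rev, ha.act_mul] }
  have hpre : MulAction.IsPretransitive G (Flag P) := by
    refine ⟨fun Ψ Ψ' => ?_⟩
    obtain ⟨w, hw⟩ := ha.exists_act h Ψ Ψ'
    exact ⟨w⁻¹, by change act Ψ w⁻¹⁻¹ = Ψ'; rwa [inv_inv]⟩
  have hst : MulAction.stabilizer G Φ = ha.stabilizer Φ := by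
    ext w
    rw [MulAction.mem_stabilizer_iff, ha.mem_stabilizer]
    change act Φ w⁻¹ = Φ ↔ _
    constructor
    · intro h1
      conv_lhs => rw [← h1]
      rw [ha.act_inv_act]
    · intro h1
      conv_lhs => rw [← h1]
      rw [ha.act_act_inv]
  rw [← hst, ← MulAction.index_stabilizer_of_transitive G Φ, Subgroup.card_mul_index]

/-- A polytope with a flag action of a string C-group is the quotient of its regular polytope by
a flag stabilizer. -/
theorem nonempty_orderIso_quotient {S : StringCGroup G 3} {act : Flag P → G → Flag P}
    (ha : IsFlagAction S.gen act) (h : IsPolytope 3 P) (Φ : Flag P) :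
    Nonempty (P ≃o S.QuotientFace (ha.stabilizer Φ)) := by
  let N := ha.stabilizer Φ
  -- The isomorphism comes from sending the coset of `u` to the face of `Φ^u` at the same level; the
  -- elements of `faceStab k` do not change that face.
  have hstab : ∀ (k : Fin 5) (u v : G), S.mkFace k u = S.mkFace k v →
      h.face (act Φ u) k = h.face (act Φ v) k := by
    intro k u v huv
    rw [StringCGroup.mkFace_eq_iff] at huv
    rw [← ha.face_act h huv (k := k) (fun j hj => hj) (act Φ u), ← ha.act_mul,
      mul_inv_cancel_left]
  have hlift : ∀ F : S.Face, ∃ x : P, ∀ u, S.mkFace F.level u = F →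
      h.face (act Φ u) F.level = x := by
    intro F
    obtain ⟨w, hw⟩ := StringCGroup.exists_mkFace F
    exact ⟨_, fun u hu => hstab _ u w (hu.trans hw.symm)⟩
  choose f hf using hlift
  have hf' : ∀ k u, f (S.mkFace k u) = h.face (act Φ u) k := fun k u =>
    (hf (S.mkFace k u) u rfl).symm
  have hfN : ∀ (n : N) (F : S.Face), f (n • F) = f F := by
    intro n F
    obtain ⟨w, hw⟩ := StringCGroup.exists_mkFace F
    rw [← hw, show n • S.mkFace F.level w = S.mkFace F.level (n * w) from rfl, hf', hf',
      ha.act_mul, show act Φ n = Φ from n.2]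
  -- If `Φ^u` and `Φ^v` share the face at a level, an element `x` of the stabilizer of that level
  -- carries `Φ^u` to `Φ^v`. Then `u * x * v⁻¹` fixes `Φ` and maps the coset of `v` to that of `u`.
  have hinj : ∀ F G : S.Face, f F = f G → ∃ n : N, n • G = F := by
    intro F G hFG
    obtain ⟨u, hu⟩ := StringCGroup.exists_mkFace F
    obtain ⟨v, hv⟩ := StringCGroup.exists_mkFace G
    rw [← hu, ← hv, hf', hf'] at hFG
    have hl : F.level = G.level := by
      have := congrArg natHeight hFG
      rw [h.natHeight_face, h.natHeight_face] at this
      exact Fin.ext this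
    rw [← hl] at hFG hv
    obtain ⟨x, hx, hxe⟩ := ha.exists_act_of_linked h (h.linked_of_face_eq hFG)
    refine ⟨⟨u * x * v⁻¹, ?_⟩, ?_⟩
    · rw [ha.mem_stabilizer, ha.act_mul, ha.act_mul, hxe, ha.act_act_inv]
    · rw [← hu, ← hv]
      change S.mkFace F.level (u * x * v⁻¹ * v) = _
      rw [inv_mul_cancel_right, StringCGroup.mkFace_mul _ hx]
  let g : S.QuotientFace N → P := fun q =>
    Quotient.liftOn' (s₁ := MulAction.orbitRel N S.Face) q f (by
      rintro F G hFG
      obtain ⟨n, rfl⟩ := MulAction.orbitRel_apply.1 hFG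
      exact hfN n G)
  have hg : ∀ F : S.Face, g (Quotient.mk'' F : MulAction.orbitRel.Quotient N S.Face) = f F :=
    fun F => rfl
  have hgsurj : Function.Surjective g := by
    intro x
    obtain ⟨Ψ, hx, -⟩ := h.exists_flag_of_le (le_refl x)
    obtain ⟨k, rfl⟩ := h.mem_iff_face.1 hx
    obtain ⟨w, rfl⟩ := ha.exists_act h Φ Ψ
    exact ⟨(Quotient.mk'' (S.mkFace k w) : MulAction.orbitRel.Quotient N S.Face), hf' k w⟩
  have hginj : Function.Injective g := by
    intro q q' hq
    induction q using Quotient.inductionOn' with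
    | h F =>
      induction q' using Quotient.inductionOn' with
      | h G =>
        obtain ⟨n, hn⟩ := hinj F G hq
        exact Quotient.sound' (MulAction.orbitRel_apply.2 ⟨n, hn⟩)
  refine ⟨OrderIso.symm ⟨Equiv.ofBijective g ⟨hginj, hgsurj⟩, ?_⟩⟩
  intro q q'
  constructor
  · intro hxy
    -- Two incident faces lie in a flag `Φ^w`, so the cosets of this single `w` are incident
    -- representatives.
    obtain ⟨Ψ, hx, hy⟩ := h.exists_flag_of_le (show g q ≤ g q' from hxy)
    obtain ⟨k, hk⟩ := h.mem_iff_face.1 hx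
    obtain ⟨l, hl⟩ := h.mem_iff_face.1 hy
    obtain ⟨w, rfl⟩ := ha.exists_act h Φ Ψ
    have hkl : k ≤ l := by
      have := h.natHeight_strictMono.monotone (show g q ≤ g q' from hxy)
      rw [← hk, ← hl, h.natHeight_face, h.natHeight_face] at this
      exact this
    exact ⟨S.mkFace k w, S.mkFace l w, StringCGroup.mkFace_le_mkFace hkl w,
      hginj ((hg _).trans ((hf' k w).trans hk)), hginj ((hg _).trans ((hf' l w).trans hl))⟩
  · rintro ⟨F, G, hFG, rfl, rfl⟩
    obtain ⟨w, hF, hG⟩ := StringCGroup.exists_of_le hFG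
    change f F ≤ f G
    rw [hF, hG, hf', hf']
    exact h.face_le_face _ hFG.1

end IsFlagAction

namespace IsPolytope

variable {P : Type*} [PartialOrder P]

/-- The permutation of the flags that sends each flag to its `i`-adjacent flag. -/
noncomputable def adjPerm (h : IsPolytope 3 P) (i : Fin 3) : Equiv.Perm (Flag P) :=
  Function.Involutive.toPerm (h.adj i) (h.adj_adj i)

/-- The monodromy group: the group generated by the permutations `adjPerm i` of the flags,
multiplied from left to right. -/
def monodromy (h : IsPolytope 3 P) : Subgroup (Equiv.Perm (Flag P))ᵐᵒᵖ :=
  Subgroup.closure (Set.range fun i => MulOpposite.op (h.adjPerm i))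

/-- The distinguished generators of the monodromy group. -/
noncomputable def monodromyGen (h : IsPolytope 3 P) (i : Fin 3) : h.monodromy :=
  ⟨MulOpposite.op (h.adjPerm i), Subgroup.subset_closure ⟨i, rfl⟩⟩

/-- The action of the monodromy group on the flags. -/
def monodromyAct (h : IsPolytope 3 P) (Φ : Flag P) (w : h.monodromy) : Flag P :=
  (w : (Equiv.Perm (Flag P))ᵐᵒᵖ).unop Φ

theorem isFlagAction_monodromyAct (h : IsPolytope 3 P) :
    IsFlagAction h.monodromyGen h.monodromyAct where
  act_one _ := rfl
  act_mul _ _ _ := rfl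
  act_gen Φ i := h.adjacent_adj i Φ

theorem monodromy_ext (h : IsPolytope 3 P) {u v : h.monodromy}
    (huv : ∀ Φ, h.monodromyAct Φ u = h.monodromyAct Φ v) : u = v :=
  Subtype.ext (MulOpposite.unop_injective (Equiv.ext huv))

theorem closure_range_monodromyGen (h : IsPolytope 3 P) :
    Subgroup.closure (Set.range h.monodromyGen) = ⊤ := by
  refine Eq.trans ?_ (Subgroup.closure_closure_coe_preimage
    (k := Set.range fun i => MulOpposite.op (h.adjPerm i)))
  refine congrArg _ (Set.ext ?_)
  rintro ⟨w, hw⟩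
  simp only [Set.mem_range]
  exact exists_congr fun i => Subtype.ext_iff

theorem nonempty_flag (_ : IsPolytope 3 P) : Nonempty (Flag P) :=
  ⟨((IsChain.empty (r := (· ≤ · : P → P → Prop))).exists_subset_flag).choose⟩

theorem orderOf_monodromyGen (h : IsPolytope 3 P) (i : Fin 3) : orderOf (h.monodromyGen i) = 2 := by
  refine orderOf_eq_prime (h.monodromy_ext fun Φ => ?_) fun h1 => ?_
  · exact h.adj_adj i Φ
  · obtain ⟨Φ⟩ := h.nonempty_flag
    exact h.adj_ne i Φ (congrArg (h.monodromyAct Φ) h1)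

/-- The monodromy group of an orientable polyhedron is a string C-group. -/
noncomputable def stringCGroup (h : IsPolytope 3 P) (ε : Flag P → Bool)
    (hε : ∀ i Φ, ε (h.adj i Φ) = !ε Φ) : StringCGroup h.monodromy 3 where
  gen := h.monodromyGen
  gen_injective := by
    intro i j hij
    by_contra hne
    obtain ⟨Φ⟩ := h.nonempty_flag
    have h1 : h.adj i Φ = h.adj j Φ := congrArg (h.monodromyAct Φ) hij
    refine h.face_adj_ne i Φ (j := ⟨i + 1, by omega⟩) rfl ?_
    rw [h1, h.face_adj j Φ]
    intro h2
    exact hne (Fin.ext (by simpa using h2))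
  orderOf_gen := h.orderOf_monodromyGen
  closure_gen := h.closure_range_monodromyGen
  string i j hij := by
    refine h.monodromy_ext fun Φ => ?_
    change h.adj j (h.adj i (h.adj j (h.adj i Φ))) = Φ
    rw [h.adj_comm hij, h.adj_adj, h.adj_adj]
  inter I J := by
    have ha := h.isFlagAction_monodromyAct
    refine le_antisymm ?_ (le_inf (Subgroup.closure_mono (Set.image_mono Set.inter_subset_left))
      (Subgroup.closure_mono (Set.image_mono Set.inter_subset_right)))
    by_cases hIJ : I ⊆ J
    · rw [Set.inter_eq_left.2 hIJ]; exact inf_le_left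
    by_cases hJI : J ⊆ I
    · rw [Set.inter_eq_right.2 hJI]; exact inf_le_right
    obtain ⟨i, hiI, hiJ⟩ := Set.not_subset.1 hIJ
    obtain ⟨j, hjJ, hjI⟩ := Set.not_subset.1 hJI
    have hij : i ≠ j := fun e => hiJ (e ▸ hjJ)
    -- Neither `i` nor `j` is in `I ∩ J`, so `m` is the only possible element.
    obtain ⟨m, hm⟩ : ∃ m : Fin 3, ∀ k, k = i ∨ k = j ∨ k = m := by
      clear hiI hiJ hjJ hjI
      revert i j; decide
    rintro w ⟨hwI, hwJ⟩
    -- A rank outside `I ∩ J` is missing from `I` or from `J`, and `w` is a word in the generators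
    -- of either set.
    have hface : ∀ k : Fin 5, (∀ l ∈ I ∩ J, (l : ℕ) + 1 ≠ k) → ∀ Φ,
        h.face (h.monodromyAct Φ w) k = h.face Φ k := by
      intro k hk Φ
      by_cases hkI : ∀ l ∈ I, (l : ℕ) + 1 ≠ k
      · exact ha.face_act h hwI hkI Φ
      · push Not at hkI
        obtain ⟨l, hl, hlk⟩ := hkI
        refine ha.face_act h hwJ (fun l' hl' e => ?_) Φ
        obtain rfl : l = l' := Fin.ext (by omega)
        exact hk l ⟨hl, hl'⟩ hlk
    by_cases hmIJ : m ∈ I ∩ J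
    · have hcase : ∀ Φ, h.monodromyAct Φ w = Φ ∨ h.monodromyAct Φ w = h.adj m Φ := by
        intro Φ
        refine h.eq_or_eq_adj m fun k hk => (hface k (fun l hl e => ?_) Φ).symm
        rcases hm l with rfl | rfl | rfl
        · exact hiJ hl.2
        · exact hjI hl.1
        · exact hk e.symm
      -- By `hε` an element reverses the sign `ε` of all flags or of none, so the same alternative
      -- of `hcase` holds for all flags.
      obtain ⟨c, hc⟩ : ∃ c, ∀ Φ, ε (h.monodromyAct Φ w) = (c ^^ ε Φ) := by
        have hw : w ∈ Subgroup.closure (Set.range h.monodromyGen) := by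
          rw [h.closure_range_monodromyGen]; trivial
        clear hcase hface hwI hwJ
        induction hw using Subgroup.closure_induction with
        | mem x hx =>
          obtain ⟨k, rfl⟩ := hx
          exact ⟨true, fun Φ => by rw [ha.act_gen_eq_adj h, hε, Bool.true_xor]⟩
        | one => exact ⟨false, fun Φ => by rw [ha.act_one, Bool.false_xor]⟩
        | mul x y _ _ hx hy =>
          obtain ⟨c, hc⟩ := hx
          obtain ⟨d, hd⟩ := hy
          exact ⟨d ^^ c, fun Φ => by rw [ha.act_mul, hd, hc, Bool.xor_assoc]⟩
        | inv x _ hx =>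
          obtain ⟨c, hc⟩ := hx
          refine ⟨c, fun Φ => ?_⟩
          have := hc (h.monodromyAct Φ x⁻¹)
          rw [ha.act_inv_act] at this
          rw [this, ← Bool.xor_assoc, Bool.xor_self, Bool.false_xor]
      cases c with
      | false =>
        have : w = 1 := h.monodromy_ext fun Φ => by
          refine ((hcase Φ).resolve_right fun e => ?_).trans (ha.act_one Φ).symm
          have := hc Φ
          rw [e, hε, Bool.false_xor] at this
          simp at this
        rw [this]
        exact one_mem _
      | true =>
        have : w = h.monodromyGen m := h.monodromy_ext fun Φ => by
          refine ((hcase Φ).resolve_left fun e => ?_).trans (ha.act_gen_eq_adj h Φ m).symm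
          have := hc Φ
          rw [e, Bool.true_xor] at this
          simp at this
        rw [this]
        exact Subgroup.subset_closure ⟨m, hmIJ, rfl⟩
    · have : w = 1 := h.monodromy_ext fun Φ => by
        refine (h.flag_ext fun k => hface k (fun l hl => ?_) Φ).trans (ha.act_one Φ).symm
        rcases hm l with rfl | rfl | rfl
        · exact absurd hl.2 hiJ
        · exact absurd hl.1 hjI
        · exact absurd hl hmIJ
      rw [this]
      exact one_mem _

theorem normalCore_stabilizer_monodromy (h : IsPolytope 3 P) (Φ : Flag P) :
    (h.isFlagAction_monodromyAct.stabilizer Φ).normalCore = ⊥ := by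
  rw [eq_bot_iff]
  intro w hw
  rw [h.isFlagAction_monodromyAct.mem_normalCore_stabilizer h] at hw
  exact h.monodromy_ext hw

section Regular

variable {R : Type*} [PartialOrder R] {Ψ : Flag R} {ρ : Fin 3 → (R ≃o R)}

/-- Automorphisms commute with adjacency, so each adjacency step multiplies by a generator on the
right; a path of flags that starts at `Ψ` spells a word in the `ρ i`. -/
theorem adj_map_gen (h : IsPolytope 3 R) (hρ : ∀ i : Fin 3, Adjacent i Ψ (Flag.map (ρ i) Ψ))
    (i : Fin 3) (g : R ≃o R) : h.adj i (Flag.map g Ψ) = Flag.map (g * ρ i) Ψ := by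
  rw [h.adj_map, ← h.eq_adj (hρ i)]
  refine h.flag_ext fun k => ?_
  simp only [h.face_map]
  rfl

theorem exists_map_of_linked (h : IsPolytope 3 R)
    (hρ : ∀ i : Fin 3, Adjacent i Ψ (Flag.map (ρ i) Ψ)) {J : Set (Fin 3)} {X : Flag R}
    (hL : h.Linked J Ψ X) : ∃ g ∈ Subgroup.closure (ρ '' J), X = Flag.map g Ψ := by
  induction hL with
  | refl =>
    refine ⟨1, one_mem _, h.flag_ext fun k => ?_⟩
    rw [h.face_map]; rfl
  | tail _ hs ih =>
    obtain ⟨g, hg, rfl⟩ := ih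
    obtain ⟨j, hj, rfl⟩ := hs
    exact ⟨g * ρ j, mul_mem hg (Subgroup.subset_closure ⟨j, hj, rfl⟩), h.adj_map_gen hρ j g⟩

theorem eq_of_map_eq (h : IsPolytope 3 R) {g g' : R ≃o R} (he : Flag.map g Ψ = Flag.map g' Ψ) :
    g = g' := by
  refine (inv_mul_eq_one.1 (h.eq_one_of_map_flag (Φ := Ψ) (g := g'⁻¹ * g) ?_)).symm
  refine h.flag_ext fun k => ?_
  have := congrArg (fun Φ => h.face Φ k) he
  simp only [h.face_map] at this
  rw [h.face_map, RelIso.mul_apply, this]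
  exact RelIso.inv_apply_self _ _

theorem closure_range_eq_top (h : IsPolytope 3 R)
    (hρ : ∀ i : Fin 3, Adjacent i Ψ (Flag.map (ρ i) Ψ)) :
    Subgroup.closure (Set.range ρ) = ⊤ := by
  rw [eq_top_iff]
  intro g _
  obtain ⟨g', hg', he⟩ := h.exists_map_of_linked hρ (h.linked_univ Ψ (Flag.map g Ψ))
  rw [h.eq_of_map_eq he]
  rwa [Set.image_univ] at hg'

/-- A homomorphism of the group of a regular polytope onto a string C-group that respects the
distinguished generators induces a covering. -/
theorem exists_isCovering (h : IsPolytope 3 R)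
    (hρ : ∀ i : Fin 3, Adjacent i Ψ (Flag.map (ρ i) Ψ)) {W : Type*} [Group W]
    (S : StringCGroup W 3) (π : (R ≃o R) →* W) (hsurj : Function.Surjective π)
    (hπ : ∀ i, π (ρ i) = S.gen i) : ∃ γ : R → S.Face, IsCovering γ := by
  have hflag : ∀ X : Flag R, ∃ g : R ≃o R, X = Flag.map g Ψ := fun X =>
    let ⟨g, _, hg⟩ := h.exists_map_of_linked hρ (h.linked_univ Ψ X)
    ⟨g, hg⟩
  -- The covering is well defined: if `g` and `g'` agree on the base face of height `k`, then by
  -- strong flag-connectedness `g⁻¹ * g'` is a word in the `ρ j` with `j + 1 ≠ k`, which `π` maps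
  -- into `faceStab k`.
  have hwd : ∀ (k : Fin 5) (g g' : R ≃o R), g (h.face Ψ k) = g' (h.face Ψ k) →
      S.mkFace k (π g) = S.mkFace k (π g') := by
    intro k g g' hgg
    have h1 : h.face Ψ k = h.face (Flag.map (g⁻¹ * g') Ψ) k := by
      rw [h.face_map, RelIso.mul_apply, ← hgg]
      exact (RelIso.inv_apply_self _ _).symm
    obtain ⟨x, hx, hxe⟩ := h.exists_map_of_linked hρ (h.linked_of_face_eq h1)
    rw [StringCGroup.mkFace_eq_iff, ← map_inv, ← map_mul, h.eq_of_map_eq hxe]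
    have h2 := Subgroup.mem_map_of_mem π hx
    rw [MonoidHom.map_closure, ← Set.image_comp] at h2
    rwa [show (π ∘ ρ) = S.gen from funext hπ] at h2
  have hlift : ∀ x : R, ∃ F : S.Face, ∀ (k : Fin 5) (g : R ≃o R), g (h.face Ψ k) = x →
      F = S.mkFace k (π g) := by
    intro x
    obtain ⟨X, hx, -⟩ := h.exists_flag_of_le (le_refl x)
    obtain ⟨k, rfl⟩ := h.mem_iff_face.1 hx
    obtain ⟨g, rfl⟩ := hflag X
    refine ⟨S.mkFace k (π g), fun l g' hg' => ?_⟩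
    rw [h.face_map] at hg'
    obtain rfl : l = k := by
      have := congrArg natHeight hg'
      rw [natHeight_orderIso, natHeight_orderIso, h.natHeight_face, h.natHeight_face] at this
      exact Fin.ext this
    exact hwd l g g' hg'.symm
  choose γ hγ using hlift
  have hγ' : ∀ k g, γ (g (h.face Ψ k)) = S.mkFace k (π g) := fun k g => hγ _ k g rfl
  have himg : ∀ g : R ≃o R, γ '' (Flag.map g Ψ : Flag R) = S.flag (π g) := by
    intro g
    rw [StringCGroup.coe_flag]
    ext F
    simp only [Set.mem_image, SetLike.mem_coe, Set.mem_range, h.mem_iff_face]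
    constructor
    · rintro ⟨_, ⟨k, rfl⟩, rfl⟩
      exact ⟨k, by rw [h.face_map, hγ']⟩
    · rintro ⟨k, rfl⟩
      exact ⟨_, ⟨k, rfl⟩, by rw [h.face_map, hγ']⟩
  refine ⟨γ, ⟨?_, ?_, ?_, ?_⟩⟩
  · intro F
    obtain ⟨w, hw⟩ := StringCGroup.exists_mkFace F
    obtain ⟨g, rfl⟩ := hsurj w
    exact ⟨_, (hγ' F.level g).trans hw⟩
  · intro x y hxy
    obtain ⟨X, hx, hy⟩ := h.exists_flag_of_le hxy
    obtain ⟨k, rfl⟩ := h.mem_iff_face.1 hx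
    obtain ⟨l, rfl⟩ := h.mem_iff_face.1 hy
    obtain ⟨g, rfl⟩ := hflag X
    have hkl := h.natHeight_strictMono.monotone hxy
    rw [h.natHeight_face, h.natHeight_face] at hkl
    rw [h.face_map, h.face_map, hγ', hγ']
    exact StringCGroup.mkFace_le_mkFace hkl _
  · intro x
    obtain ⟨X, hx, -⟩ := h.exists_flag_of_le (le_refl x)
    obtain ⟨k, rfl⟩ := h.mem_iff_face.1 hx
    obtain ⟨g, rfl⟩ := hflag X
    rw [StringCGroup.isGraded_level.height_eq, h.height_eq, h.face_map, hγ', natHeight_orderIso,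
      h.natHeight_face]
    rfl
  · intro i X Y hXY
    have hi := h.lt_of_adjacent hXY
    obtain ⟨g, rfl⟩ := hflag X
    obtain rfl : Y = Flag.map (g * ρ ⟨i, hi⟩) Ψ := by
      rw [← h.adj_map_gen hρ]
      exact h.eq_adj (i := ⟨i, hi⟩) hXY
    refine ⟨S.flag (π g), S.flag (π (g * ρ ⟨i, hi⟩)), (himg _).symm, (himg _).symm, ?_⟩
    rw [map_mul, hπ]
    exact StringCGroup.adjacent_flag _ ⟨i, hi⟩

/-- If the group of a regular polytope has a flag action on `P`, then the monodromy group of `P` is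
its quotient by the core of a flag stabilizer. -/
theorem exists_hom_monodromy (h : IsPolytope 3 P) (hR : IsPolytope 3 R)
    (hρ : ∀ i : Fin 3, Adjacent i Ψ (Flag.map (ρ i) Ψ)) {act : Flag P → (R ≃o R) → Flag P}
    (ha : IsFlagAction ρ act) :
    ∃ π : (R ≃o R) →* h.monodromy, Function.Surjective π ∧ (∀ i, π (ρ i) = h.monodromyGen i) ∧
      ∀ Φ : Flag P, π.ker = (ha.stabilizer Φ).normalCore := by
  -- A right action is a homomorphism to the opposite of the symmetric group.
  let φ : (R ≃o R) →* (Equiv.Perm (Flag P))ᵐᵒᵖ :=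
    { toFun := fun u => MulOpposite.op
        ⟨fun Φ => act Φ u, fun Φ => act Φ u⁻¹, fun Φ => ha.act_act_inv Φ u,
          fun Φ => ha.act_inv_act Φ u⟩
      map_one' := MulOpposite.unop_injective (Equiv.ext ha.act_one)
      map_mul' := fun u v => MulOpposite.unop_injective (Equiv.ext fun Φ => ha.act_mul Φ u v) }
  have hφ : ∀ i, φ (ρ i) = MulOpposite.op (h.adjPerm i) := fun i =>
    MulOpposite.unop_injective (Equiv.ext fun Φ => ha.act_gen_eq_adj h Φ i)
  have hmem : ∀ u, φ u ∈ h.monodromy := by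
    intro u
    have hu : u ∈ Subgroup.closure (Set.range ρ) := by rw [hR.closure_range_eq_top hρ]; trivial
    have h1 := Subgroup.mem_map_of_mem φ hu
    rw [MonoidHom.map_closure, ← Set.range_comp] at h1
    rwa [show φ ∘ ρ = fun i => MulOpposite.op (h.adjPerm i) from funext hφ] at h1
  refine ⟨φ.codRestrict h.monodromy hmem, ?_, fun i => Subtype.ext (hφ i), fun Φ => ?_⟩
  · rw [← MonoidHom.range_eq_top, eq_top_iff, ← h.closure_range_monodromyGen,
      Subgroup.closure_le]
    rintro _ ⟨i, rfl⟩
    exact ⟨ρ i, Subtype.ext (hφ i)⟩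
  · ext u
    rw [ha.mem_normalCore_stabilizer h, MonoidHom.mem_ker]
    constructor
    · intro hu X
      exact congrArg (h.monodromyAct X) hu
    · intro hu
      exact h.monodromy_ext hu

end Regular

end IsPolytope

end ArchPoly

/-! ### Face lattices of polyhedra given by boundary cycles -/

namespace ArchPoly

theorem length_darts (f : List ℕ) : (darts f).length = f.length := by
  simp [darts]

theorem getElem_darts (f : List ℕ) {i : ℕ} (hi : i < (darts f).length) :
    (darts f)[i] = (f[i]'(length_darts f ▸ hi),
      f[(i + 1) % f.length]'(Nat.mod_lt _ (by rw [length_darts] at hi; omega))) := by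
  simp [darts, List.getElem_rotate]

section Darts

variable {f : List ℕ} {u v w : ℕ}

theorem mem_darts_iff : (u, v) ∈ darts f ↔ ∃ (i : ℕ) (hi : i < f.length),
    f[i] = u ∧ f[(i + 1) % f.length]'(Nat.mod_lt _ (by omega)) = v := by
  rw [List.mem_iff_getElem]
  constructor
  · rintro ⟨i, hi, h⟩
    rw [getElem_darts] at h
    exact ⟨i, length_darts f ▸ hi, (Prod.mk.inj h).1, (Prod.mk.inj h).2⟩
  · rintro ⟨i, hi, rfl, rfl⟩
    exact ⟨i, by rwa [length_darts], getElem_darts f _⟩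

theorem fst_mem_of_mem_darts (h : (u, v) ∈ darts f) : u ∈ f := by
  obtain ⟨i, hi, rfl, -⟩ := mem_darts_iff.1 h
  exact List.getElem_mem _

theorem snd_mem_of_mem_darts (h : (u, v) ∈ darts f) : v ∈ f := by
  obtain ⟨i, hi, -, rfl⟩ := mem_darts_iff.1 h
  exact List.getElem_mem _

theorem exists_dart_fst (h : u ∈ f) : ∃ v, (u, v) ∈ darts f := by
  obtain ⟨i, hi, rfl⟩ := List.mem_iff_getElem.1 h
  exact ⟨_, mem_darts_iff.2 ⟨i, hi, rfl, rfl⟩⟩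

theorem exists_dart_snd (h : u ∈ f) : ∃ v, (v, u) ∈ darts f := by
  obtain ⟨i, hi, rfl⟩ := List.mem_iff_getElem.1 h
  rcases i with _ | i
  · refine ⟨_, mem_darts_iff.2 ⟨f.length - 1, by omega, rfl, ?_⟩⟩
    congr 1
    rw [Nat.sub_add_cancel hi, Nat.mod_self]
  · refine ⟨_, mem_darts_iff.2 ⟨i, by omega, rfl, ?_⟩⟩
    congr 1
    exact Nat.mod_eq_of_lt hi

variable (hf : f.Nodup)
include hf

theorem dart_snd_unique (h1 : (u, v) ∈ darts f) (h2 : (u, w) ∈ darts f) : v = w := by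
  obtain ⟨i, hi, hiu, rfl⟩ := mem_darts_iff.1 h1
  obtain ⟨j, hj, hju, rfl⟩ := mem_darts_iff.1 h2
  have := (hf.getElem_inj_iff (hi := hi) (hj := hj)).1 (hiu.trans hju.symm)
  subst this
  rfl

theorem dart_fst_unique (h1 : (v, u) ∈ darts f) (h2 : (w, u) ∈ darts f) : v = w := by
  obtain ⟨i, hi, rfl, hiu⟩ := mem_darts_iff.1 h1
  obtain ⟨j, hj, rfl, hju⟩ := mem_darts_iff.1 h2
  have h3 := hf.getElem_inj_iff.1 (hiu.trans hju.symm)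
  have h4 : i = j := by
    rcases Nat.lt_or_ge (i + 1) f.length with h | h <;>
    rcases Nat.lt_or_ge (j + 1) f.length with h' | h'
    · rw [Nat.mod_eq_of_lt h, Nat.mod_eq_of_lt h'] at h3; omega
    · rw [Nat.mod_eq_of_lt h, show j + 1 = f.length by omega, Nat.mod_self] at h3; omega
    · rw [Nat.mod_eq_of_lt h', show i + 1 = f.length by omega, Nat.mod_self] at h3; omega
    · omega
  subst h4
  rfl

/-- Both darts on one cycle would force `i + 2 ≡ i` modulo its length, which is at least 3. -/
theorem swap_notMem_darts (hl : 3 ≤ f.length) (h : (u, v) ∈ darts f) : (v, u) ∉ darts f := by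
  intro h'
  obtain ⟨i, hi, rfl, rfl⟩ := mem_darts_iff.1 h
  obtain ⟨j, hj, h1, h2⟩ := mem_darts_iff.1 h'
  have e1 := hf.getElem_inj_iff.1 h1
  have e2 := hf.getElem_inj_iff.1 h2
  rw [e1] at e2
  rcases Nat.lt_or_ge (i + 1) f.length with h | h
  · rw [Nat.mod_eq_of_lt h] at e2
    rcases Nat.lt_or_ge (i + 1 + 1) f.length with h' | h'
    · rw [Nat.mod_eq_of_lt h'] at e2; omega
    · rw [show i + 1 + 1 = f.length by omega, Nat.mod_self] at e2; omega
  · rw [show i + 1 = f.length by omega, Nat.mod_self, Nat.mod_eq_of_lt (by omega)] at e2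
    omega

theorem ne_of_mem_darts (hl : 3 ≤ f.length) (h : (u, v) ∈ darts f) : u ≠ v := by
  rintro rfl
  exact swap_notMem_darts hf hl h h

end Darts

/-- The faces in `L` are the boundary cycles of a polyhedron in which no face has a chord and every
vertex has the symbol `sym`. -/
structure IsPolyhedralMap (L : List (List ℕ)) (sym : List ℕ) : Prop where
  nodup : ∀ f ∈ L, f.Nodup
  three_le_length : ∀ f ∈ L, 3 ≤ f.length
  nodup_darts : (L.flatMap darts).Nodup
  swap_mem : ∀ d ∈ L.flatMap darts, (d.2, d.1) ∈ L.flatMap darts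
  eq_of_subset : ∀ f ∈ L, ∀ g ∈ L, f ⊆ g → f = g
  exists_not_subset : ∀ f ∈ L, ∃ g ∈ L, ¬ g ⊆ f
  chord : ∀ f ∈ L, ∀ d ∈ L.flatMap darts, d.1 ∈ f → d.2 ∈ f → d ∈ darts f ∨ (d.2, d.1) ∈ darts f
  symbol : ∀ v ∈ L.flatten, ∃ F : List (List ℕ), F.Perm (L.filter (v ∈ ·)) ∧
    F.map List.length = sym ∧ ∀ p ∈ F.zip (F.rotate 1), ∃ d ∈ darts p.1,
      (d.1 = v ∧ d.2 ∈ p.2) ∨ (d.2 = v ∧ d.1 ∈ p.2)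
  connected : ∃ u ∈ L.flatten, ∀ v ∈ L.flatten,
    Relation.ReflTransGen (fun v w => ∃ f ∈ L, v ∈ f ∧ w ∈ f) u v

namespace FaceLattice

variable {L : List (List ℕ)} {sym : List ℕ}

theorem mem_faceSets {s : Finset ℕ} : s ∈ faceSets L ↔ s = ∅ ∨ (∃ v ∈ L.flatten, {v} = s) ∨
    (∃ d ∈ L.flatMap darts, {d.1, d.2} = s) ∨ (∃ f ∈ L, f.toFinset = s) ∨
      s = (vertices L).toFinset := by
  simp only [faceSets, vertices, Finset.mem_union, Finset.mem_singleton, Finset.mem_image,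
    List.mem_toFinset, List.mem_dedup, or_assoc]

theorem mem_flatten_of_mem_darts {d : ℕ × ℕ} (hd : d ∈ L.flatMap darts) :
    d.1 ∈ L.flatten ∧ d.2 ∈ L.flatten := by
  obtain ⟨f, hf, hdf⟩ := List.mem_flatMap.1 hd
  exact ⟨List.mem_flatten.2 ⟨f, hf, fst_mem_of_mem_darts hdf⟩,
    List.mem_flatten.2 ⟨f, hf, snd_mem_of_mem_darts hdf⟩⟩

variable (L) in
/-- The least face. -/
def bot : FaceLattice L := ⟨∅, mem_faceSets.2 (Or.inl rfl)⟩

variable (L) in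
/-- The greatest face. -/
def top : FaceLattice L :=
  ⟨(vertices L).toFinset, mem_faceSets.2 (Or.inr (Or.inr (Or.inr (Or.inr rfl))))⟩

/-- The vertex `v`. -/
def vtx (v : ℕ) (hv : v ∈ L.flatten) : FaceLattice L :=
  ⟨{v}, mem_faceSets.2 (Or.inr (Or.inl ⟨v, hv, rfl⟩))⟩

/-- The edge with the dart `d`. -/
def edg (d : ℕ × ℕ) (hd : d ∈ L.flatMap darts) : FaceLattice L :=
  ⟨{d.1, d.2}, mem_faceSets.2 (Or.inr (Or.inr (Or.inl ⟨d, hd, rfl⟩)))⟩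

/-- The 2-face with boundary `f`. -/
def fac (f : List ℕ) (hf : f ∈ L) : FaceLattice L :=
  ⟨f.toFinset, mem_faceSets.2 (Or.inr (Or.inr (Or.inr (Or.inl ⟨f, hf, rfl⟩))))⟩

theorem cases_face (x : FaceLattice L) : x = bot L ∨ (∃ v hv, x = vtx v hv) ∨
    (∃ d hd, x = edg d hd) ∨ (∃ f hf, x = fac f hf) ∨ x = top L := by
  rcases mem_faceSets.1 x.2 with h | ⟨v, hv, h⟩ | ⟨d, hd, h⟩ | ⟨f, hf, h⟩ | h
  · exact Or.inl (Subtype.ext h)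
  · exact Or.inr (Or.inl ⟨v, hv, Subtype.ext h.symm⟩)
  · exact Or.inr (Or.inr (Or.inl ⟨d, hd, Subtype.ext h.symm⟩))
  · exact Or.inr (Or.inr (Or.inr (Or.inl ⟨f, hf, Subtype.ext h.symm⟩)))
  · exact Or.inr (Or.inr (Or.inr (Or.inr (Subtype.ext h))))

theorem le_top (x : FaceLattice L) : x ≤ top L := by
  intro a ha
  change a ∈ (vertices L).toFinset
  rw [List.mem_toFinset, vertices, List.mem_dedup]
  rcases cases_face x with rfl | ⟨v, hv, rfl⟩ | ⟨d, hd, rfl⟩ | ⟨f, hf, rfl⟩ | rfl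
  · simp [bot] at ha
  · simp only [vtx, Finset.mem_singleton] at ha
    exact ha ▸ hv
  · simp only [edg, Finset.mem_insert, Finset.mem_singleton] at ha
    have := mem_flatten_of_mem_darts hd
    rcases ha with rfl | rfl
    · exact this.1
    · exact this.2
  · simp only [fac, List.mem_toFinset] at ha
    exact List.mem_flatten.2 ⟨f, hf, ha⟩
  · simpa [top, vertices] using ha

theorem bot_le (x : FaceLattice L) : bot L ≤ x := Finset.empty_subset _

theorem vtx_le_iff {v : ℕ} {hv : v ∈ L.flatten} {x : FaceLattice L} : vtx v hv ≤ x ↔ v ∈ x.1 :=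
  Finset.singleton_subset_iff

theorem edg_le_iff {d : ℕ × ℕ} {hd : d ∈ L.flatMap darts} {x : FaceLattice L} :
    edg d hd ≤ x ↔ d.1 ∈ x.1 ∧ d.2 ∈ x.1 := by
  change ({d.1, d.2} : Finset ℕ) ⊆ x.1 ↔ _
  rw [Finset.insert_subset_iff, Finset.singleton_subset_iff]

theorem mem_fac {f : List ℕ} {hf : f ∈ L} {v : ℕ} : v ∈ (fac f hf).1 ↔ v ∈ f := List.mem_toFinset

theorem mem_edg {d : ℕ × ℕ} {hd : d ∈ L.flatMap darts} {v : ℕ} :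
    v ∈ (edg d hd).1 ↔ v = d.1 ∨ v = d.2 := by
  simp [edg]

/-- The rank plus one. -/
def height (x : FaceLattice L) : ℕ :=
  if x.1.card ≤ 2 then x.1.card else if x = top L then 4 else 3

theorem height_bot : height (bot L) = 0 := by simp [height, bot]

theorem height_vtx {v : ℕ} {hv : v ∈ L.flatten} : height (vtx v hv) = 1 := by simp [height, vtx]

theorem card_fac (hL : IsPolyhedralMap L sym) {f : List ℕ} (hf : f ∈ L) :
    (fac f hf).1.card = f.length :=
  List.toFinset_card_of_nodup (hL.nodup f hf)

theorem height_edg (hL : IsPolyhedralMap L sym) {d : ℕ × ℕ} {hd : d ∈ L.flatMap darts} :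
    height (edg d hd) = 2 := by
  obtain ⟨f, hf, hdf⟩ := List.mem_flatMap.1 hd
  have := Finset.card_pair (ne_of_mem_darts (hL.nodup f hf) (hL.three_le_length f hf) hdf)
  simp [height, edg, this]

theorem fac_ne_top (hL : IsPolyhedralMap L sym) {f : List ℕ} (hf : f ∈ L) : fac f hf ≠ top L := by
  intro h
  obtain ⟨g, hg, hgf⟩ := hL.exists_not_subset f hf
  refine hgf fun a ha => ?_
  have : fac g hg ≤ fac f hf := h ▸ le_top _
  exact mem_fac.1 (this (mem_fac (hf := hg).2 ha))

theorem height_fac (hL : IsPolyhedralMap L sym) {f : List ℕ} {hf : f ∈ L} :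
    height (fac f hf) = 3 := by
  have h1 := card_fac hL hf
  have h2 := hL.three_le_length f hf
  rw [height, if_neg (by omega), if_neg (fac_ne_top hL hf)]

theorem exists_face (hL : IsPolyhedralMap L sym) : ∃ f, f ∈ L := by
  obtain ⟨u, hu, -⟩ := hL.connected
  obtain ⟨f, hf, -⟩ := List.mem_flatten.1 hu
  exact ⟨f, hf⟩

theorem height_top (hL : IsPolyhedralMap L sym) : height (top L) = 4 := by
  obtain ⟨f, hf⟩ := exists_face hL
  have h1 := card_fac hL hf
  have h2 := hL.three_le_length f hf
  have h3 := Finset.card_le_card (le_top (fac f hf))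
  rw [height, if_neg (by omega), if_pos rfl]

/-- The least face, the vertices and the edges are exactly the faces with at most two vertices, and
there cardinality decides. Two larger faces can be strictly comparable only if the upper one is the
greatest face, since no boundary contains another one. -/
theorem height_strictMono (hL : IsPolyhedralMap L sym) :
    StrictMono (height : FaceLattice L → ℕ) := by
  intro x y hxy
  have hcard := Finset.card_lt_card hxy
  by_cases hy : y.1.card ≤ 2
  · rw [height, height, if_pos hy, if_pos (by omega)]
    exact hcard
  by_cases hx : x.1.card ≤ 2
  · rw [height, height, if_neg hy, if_pos hx]
    split_ifs <;> omega
  have hxt : x ≠ top L := by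
    rintro rfl
    exact hxy.not_ge (le_top y)
  have hyt : y = top L := by
    have hbig : ∀ z : FaceLattice L, ¬ z.1.card ≤ 2 → z ≠ top L → ∃ f hf, z = fac f hf := by
      intro z hz hzt
      rcases cases_face z with rfl | ⟨v, hv, rfl⟩ | ⟨d, hd, rfl⟩ | h | rfl
      · simp [bot] at hz
      · simp [vtx] at hz
      · exact absurd Finset.card_le_two hz
      · exact h
      · exact absurd rfl hzt
    by_contra hyt
    obtain ⟨f, hf, rfl⟩ := hbig x hx hxt
    obtain ⟨g, hg, rfl⟩ := hbig y hy hyt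
    have := hL.eq_of_subset f hf g hg fun a ha => mem_fac.1 (hxy.le (mem_fac (hf := hf).2 ha))
    subst this
    exact lt_irrefl _ hxy
  rw [height, height, if_neg hy, if_neg hx, if_pos hyt, if_neg hxt]
  norm_num

theorem lt_of_le_of_height_lt {x y : FaceLattice L} (h : x ≤ y) (hr : height x < height y) :
    x < y :=
  lt_of_le_of_ne h fun e => by simp [e] at hr

theorem isGraded (hL : IsPolyhedralMap L sym) : IsGraded 3 (height : FaceLattice L → ℕ) where
  strictMono := height_strictMono hL
  bot := ⟨bot L, bot_le, height_bot⟩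
  top := ⟨top L, le_top, height_top hL⟩
  between := by
    intro x y hxy hr
    suffices H : ∃ z, x ≤ z ∧ z ≤ y ∧ height z = height x + 1 by
      obtain ⟨z, h1, h2, h3⟩ := H
      exact ⟨z, lt_of_le_of_height_lt h1 (by omega), lt_of_le_of_height_lt h2 (by omega)⟩
    rcases cases_face x with rfl | ⟨v, hv, rfl⟩ | ⟨d, hd, rfl⟩ | ⟨f, hf, rfl⟩ | rfl
    · obtain ⟨a, ha⟩ : y.1.Nonempty := by
        rw [Finset.nonempty_iff_ne_empty]
        intro h
        exact hxy.ne (Subtype.ext h.symm)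
      have hav : a ∈ L.flatten := by
        have := le_top y ha
        simpa [top, vertices] using this
      exact ⟨vtx a hav, bot_le _, vtx_le_iff.2 ha, by rw [height_vtx, height_bot]⟩
    · rw [height_vtx] at hr
      obtain ⟨f, hf, hvf, hfy⟩ : ∃ f, ∃ hf : f ∈ L, v ∈ f ∧ fac f hf ≤ y := by
        rcases cases_face y with rfl | ⟨v, hv, rfl⟩ | ⟨d, hd, rfl⟩ | ⟨f, hf, rfl⟩ | rfl
        · simp [height_bot] at hr
        · simp [height_vtx] at hr
        · simp [height_edg hL] at hr
        · exact ⟨f, hf, mem_fac.1 (vtx_le_iff.1 hxy.le), le_rfl⟩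
        · obtain ⟨f, hf, hvf⟩ := List.mem_flatten.1 hv
          exact ⟨f, hf, hvf, le_top _⟩
      obtain ⟨w, hw⟩ := exists_dart_fst hvf
      refine ⟨edg (v, w) (List.mem_flatMap.2 ⟨f, hf, hw⟩), vtx_le_iff.2 (mem_edg.2 (Or.inl rfl)),
        le_trans (edg_le_iff.2 ⟨mem_fac.2 hvf, mem_fac.2 (snd_mem_of_mem_darts hw)⟩) hfy, ?_⟩
      rw [height_edg hL, height_vtx]
    · rw [height_edg hL] at hr
      obtain ⟨f, hf, hdf⟩ := List.mem_flatMap.1 hd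
      refine ⟨fac f hf, edg_le_iff.2 ⟨mem_fac.2 (fst_mem_of_mem_darts hdf),
        mem_fac.2 (snd_mem_of_mem_darts hdf)⟩, ?_, by rw [height_fac hL, height_edg hL]⟩
      rcases cases_face y with rfl | ⟨v, hv, rfl⟩ | ⟨d, hd, rfl⟩ | ⟨f, hf, rfl⟩ | rfl
      · simp [height_bot] at hr
      · simp [height_vtx] at hr
      · simp [height_edg hL] at hr
      · simp [height_fac hL] at hr
      · exact le_top _
    · rw [height_fac hL] at hr
      have := (height_strictMono hL).monotone (le_top y)
      rw [height_top hL] at this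
      omega
    · exact absurd (le_top y) hxy.not_ge

theorem order_height_eq (hL : IsPolyhedralMap L sym) (x : FaceLattice L) :
    Order.height x = height x := (isGraded hL).height_eq x

theorem exists_vtx {x : FaceLattice L} (hL : IsPolyhedralMap L sym) (hx : height x = 1) :
    ∃ v hv, x = vtx v hv := by
  rcases cases_face x with rfl | h | ⟨d, hd, rfl⟩ | ⟨f, hf, rfl⟩ | rfl
  · rw [height_bot] at hx; omega
  · exact h
  · rw [height_edg hL] at hx; omega
  · rw [height_fac hL] at hx; omega
  · rw [height_top hL] at hx; omega

theorem exists_edg {x : FaceLattice L} (hL : IsPolyhedralMap L sym) (hx : height x = 2) :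
    ∃ d hd, x = edg d hd := by
  rcases cases_face x with rfl | ⟨v, hv, rfl⟩ | h | ⟨f, hf, rfl⟩ | rfl
  · rw [height_bot] at hx; omega
  · rw [height_vtx] at hx; omega
  · exact h
  · rw [height_fac hL] at hx; omega
  · rw [height_top hL] at hx; omega

theorem exists_fac {x : FaceLattice L} (hL : IsPolyhedralMap L sym) (hx : height x = 3) :
    ∃ f hf, x = fac f hf := by
  rcases cases_face x with rfl | ⟨v, hv, rfl⟩ | ⟨d, hd, rfl⟩ | h | rfl
  · rw [height_bot] at hx; omega
  · rw [height_vtx] at hx; omega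
  · rw [height_edg hL] at hx; omega
  · exact h
  · rw [height_top hL] at hx; omega

theorem eq_top {x : FaceLattice L} (hL : IsPolyhedralMap L sym) (hx : height x = 4) :
    x = top L := by
  rcases (le_top x).eq_or_lt with h | h
  · exact h
  · have := height_strictMono hL h
    rw [height_top hL] at this
    omega

theorem pairwise_disjoint_darts (hL : IsPolyhedralMap L sym) :
    L.Pairwise (Function.onFun List.Disjoint darts) :=
  (List.nodup_flatMap.1 hL.nodup_darts).2

theorem nodup_faces (hL : IsPolyhedralMap L sym) : L.Nodup := by
  refine (pairwise_disjoint_darts hL).imp_of_mem fun {f g} hf _ h => ?_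
  rintro rfl
  have h3 := hL.three_le_length f hf
  obtain ⟨d, hd⟩ := List.length_pos_iff_exists_mem.1
    (show 0 < (darts f).length by rw [length_darts]; omega)
  exact h hd hd

theorem face_eq_of_dart_mem (hL : IsPolyhedralMap L sym) {f g : List ℕ} (hf : f ∈ L) (hg : g ∈ L)
    {d : ℕ × ℕ} (h1 : d ∈ darts f) (h2 : d ∈ darts g) : f = g := by
  by_contra hne
  have : Std.Symm (Function.onFun List.Disjoint darts) := ⟨fun _ _ h => h.symm⟩
  exact (pairwise_disjoint_darts hL).forall hf hg hne h1 h2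

/-- The two faces in between are the ends of an edge, or the edges before and after a vertex on a
boundary, or the 2-faces on the two sides of an edge. In the last two cases `chord` excludes further
ones: a 2-face that contains both ends of an edge has this edge on its boundary. -/
theorem diamond (hL : IsPolyhedralMap L sym) {x y : FaceLattice L} (hxy : x < y)
    (hr : height y = height x + 2) : (Set.Ioo x y).ncard = 2 := by
  have hmid : ∀ z ∈ Set.Ioo x y, height z = height x + 1 := by
    intro z hz
    have h1 := height_strictMono hL hz.1
    have h2 := height_strictMono hL hz.2
    omega
  suffices H : ∃ a b, a ≠ b ∧ ((x ≤ a ∧ a ≤ y ∧ height a = height x + 1) ∧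
      (x ≤ b ∧ b ≤ y ∧ height b = height x + 1)) ∧
      ∀ z, x < z → z < y → height z = height x + 1 → z = a ∨ z = b by
    obtain ⟨a, b, hab, ⟨⟨a1, a2, a3⟩, b1, b2, b3⟩, hz⟩ := H
    refine Set.ncard_eq_two.2 ⟨a, b, hab, Set.Subset.antisymm (fun z h => hz z h.1 h.2 (hmid z h)) ?_⟩
    rintro _ (rfl | rfl)
    · exact ⟨lt_of_le_of_height_lt a1 (by omega), lt_of_le_of_height_lt a2 (by omega)⟩
    · exact ⟨lt_of_le_of_height_lt b1 (by omega), lt_of_le_of_height_lt b2 (by omega)⟩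
  rcases cases_face x with rfl | ⟨v, hv, rfl⟩ | ⟨d, hd, rfl⟩ | ⟨f, hf, rfl⟩ | rfl
  · rw [height_bot] at hr ⊢
    obtain ⟨d, hd, rfl⟩ := exists_edg hL hr
    obtain ⟨hd1, hd2⟩ := mem_flatten_of_mem_darts hd
    refine ⟨vtx d.1 hd1, vtx d.2 hd2, ?_, ⟨⟨bot_le _, vtx_le_iff.2 (mem_edg.2 (Or.inl rfl)),
      height_vtx⟩, bot_le _, vtx_le_iff.2 (mem_edg.2 (Or.inr rfl)), height_vtx⟩, ?_⟩
    · intro h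
      obtain ⟨f, hf, hdf⟩ := List.mem_flatMap.1 hd
      refine ne_of_mem_darts (hL.nodup f hf) (hL.three_le_length f hf) hdf ?_
      exact Finset.singleton_injective (congrArg Subtype.val h)
    · intro z _ hz hz1
      obtain ⟨w, hw, rfl⟩ := exists_vtx hL hz1
      rcases mem_edg.1 (vtx_le_iff.1 hz.le) with rfl | rfl
      · exact Or.inl rfl
      · exact Or.inr rfl
  · rw [height_vtx] at hr ⊢
    obtain ⟨f, hf, rfl⟩ := exists_fac hL hr
    have hvf : v ∈ f := mem_fac.1 (vtx_le_iff.1 hxy.le)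
    obtain ⟨w, hw⟩ := exists_dart_fst hvf
    obtain ⟨u, hu⟩ := exists_dart_snd hvf
    have hnd := hL.nodup f hf
    have hl := hL.three_le_length f hf
    have huw : u ≠ w := by
      rintro rfl
      exact swap_notMem_darts hnd hl hw hu
    have hvw := ne_of_mem_darts hnd hl hw
    have huv := ne_of_mem_darts hnd hl hu
    refine ⟨edg (v, w) (List.mem_flatMap.2 ⟨f, hf, hw⟩), edg (u, v) (List.mem_flatMap.2 ⟨f, hf, hu⟩),
      ?_, ⟨⟨vtx_le_iff.2 (mem_edg.2 (Or.inl rfl)), edg_le_iff.2 ⟨mem_fac.2 hvf,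
        mem_fac.2 (snd_mem_of_mem_darts hw)⟩, height_edg hL⟩,
        vtx_le_iff.2 (mem_edg.2 (Or.inr rfl)), edg_le_iff.2 ⟨mem_fac.2 (fst_mem_of_mem_darts hu),
        mem_fac.2 hvf⟩, height_edg hL⟩, ?_⟩
    · intro h
      have h1 : u ∈ (edg (v, w) (List.mem_flatMap.2 ⟨f, hf, hw⟩)).1 := by
        rw [h]; exact mem_edg.2 (Or.inl rfl)
      rcases mem_edg.1 h1 with h2 | h2
      · exact huv h2
      · exact huw h2
    · intro z hvz hzf hz
      obtain ⟨⟨a, b⟩, hd, rfl⟩ := exists_edg hL hz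
      obtain ⟨ha, hb⟩ := edg_le_iff.1 hzf.le
      have hv' := mem_edg.1 (vtx_le_iff.1 hvz.le)
      simp only at hv' ha hb
      rcases hL.chord f hf _ hd (mem_fac.1 ha) (mem_fac.1 hb) with hc | hc
      · rcases hv' with rfl | rfl
        · obtain rfl := dart_snd_unique hnd hc hw
          exact Or.inl rfl
        · obtain rfl := dart_fst_unique hnd hc hu
          exact Or.inr rfl
      · rcases hv' with rfl | rfl
        · obtain rfl := dart_fst_unique hnd hc hu
          exact Or.inr (Subtype.ext (Finset.pair_comm _ _))
        · obtain rfl := dart_snd_unique hnd hc hw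
          exact Or.inl (Subtype.ext (Finset.pair_comm _ _))
  · rw [height_edg hL] at hr ⊢
    obtain rfl := eq_top hL hr
    obtain ⟨a, b⟩ := d
    obtain ⟨f, hf, hdf⟩ := List.mem_flatMap.1 hd
    obtain ⟨g, hg, hdg⟩ := List.mem_flatMap.1 (hL.swap_mem _ hd)
    simp only at hdg
    refine ⟨fac f hf, fac g hg, ?_, ⟨⟨edg_le_iff.2 ⟨mem_fac.2 (fst_mem_of_mem_darts hdf),
        mem_fac.2 (snd_mem_of_mem_darts hdf)⟩, le_top _, height_fac hL⟩,
        edg_le_iff.2 ⟨mem_fac.2 (snd_mem_of_mem_darts hdg),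
        mem_fac.2 (fst_mem_of_mem_darts hdg)⟩, le_top _, height_fac hL⟩, ?_⟩
    · intro h
      have hfg : f = g := hL.eq_of_subset f hf g hg fun a ha => by
        have h1 : a ∈ (fac f hf).1 := mem_fac.2 ha
        rw [h] at h1
        exact mem_fac.1 h1
      subst hfg
      exact swap_notMem_darts (hL.nodup f hf) (hL.three_le_length f hf) hdf hdg
    · intro z hdz _ hz
      obtain ⟨k, hk, rfl⟩ := exists_fac hL hz
      obtain ⟨ha, hb⟩ := edg_le_iff.1 hdz.le
      rcases hL.chord k hk _ hd (mem_fac.1 ha) (mem_fac.1 hb) with hc | hc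
      · obtain rfl := face_eq_of_dart_mem hL hk hf hc hdf
        exact Or.inl rfl
      · obtain rfl := face_eq_of_dart_mem hL hk hg hc hdg
        exact Or.inr rfl
  · rw [height_fac hL] at hr
    have := (height_strictMono hL).monotone (le_top y)
    rw [height_top hL] at this
    omega
  · exact absurd (le_top y) hxy.not_ge

/-- With both ends of a step required to lie in the interval, the relation is symmetric; so it is
enough to reach every face from one fixed face. -/
theorem reflTransGen_of_hub {P : Type*} [PartialOrder P] {H K c : P}
    (hc : ∀ x ∈ Set.Ioo H K, Relation.ReflTransGen
      (fun x y => x ∈ Set.Ioo H K ∧ y ∈ Set.Ioo H K ∧ (x < y ∨ y < x)) c x) {F G : P}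
    (hF : F ∈ Set.Ioo H K) (hG : G ∈ Set.Ioo H K) :
    Relation.ReflTransGen (fun x y => y ∈ Set.Ioo H K ∧ (x < y ∨ y < x)) F G := by
  have hsymm : Std.Symm (fun x y => x ∈ Set.Ioo H K ∧ y ∈ Set.Ioo H K ∧ (x < y ∨ y < x)) :=
    ⟨fun x y h => ⟨h.2.1, h.1, h.2.2.symm⟩⟩
  have h1 := (Relation.ReflTransGen.stdSymm.symm _ _ (hc F hF)).trans (hc G hG)
  exact Relation.ReflTransGen.mono (fun _ _ h => h.2) _ _ h1

/-- Below a 2-face the path follows its boundary, below the greatest face it comes from `connected`,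
and above a vertex from the cyclic arrangement in `symbol`. All other sections are too short. -/
theorem strongly_connected (hL : IsPolyhedralMap L sym) {H K : FaceLattice L}
    (hr : height H + 3 ≤ height K) {F G : FaceLattice L} (hF : F ∈ Set.Ioo H K)
    (hG : G ∈ Set.Ioo H K) :
    Relation.ReflTransGen (fun x y => y ∈ Set.Ioo H K ∧ (x < y ∨ y < x)) F G := by
  have hIoo : ∀ {x}, H ≤ x → x ≤ K → height H < height x → height x < height K →
      x ∈ Set.Ioo H K := fun h1 h2 h3 h4 =>
    ⟨lt_of_le_of_height_lt h1 h3, lt_of_le_of_height_lt h2 h4⟩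
  have hlink : ∀ {x y}, x ∈ Set.Ioo H K → y ∈ Set.Ioo H K → (x ≤ y ∨ y ≤ x) →
      Relation.ReflTransGen
        (fun x y => x ∈ Set.Ioo H K ∧ y ∈ Set.Ioo H K ∧ (x < y ∨ y < x)) x y := by
    intro x y hx hy h
    by_cases he : x = y
    · exact he ▸ Relation.ReflTransGen.refl
    · exact Relation.ReflTransGen.single ⟨hx, hy, h.imp (fun h => lt_of_le_of_ne h he)
        fun h => lt_of_le_of_ne h (Ne.symm he)⟩
  have hKh := (height_strictMono hL).monotone (le_top K)
  rw [height_top hL] at hKh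
  rcases cases_face H with rfl | ⟨v, hv, rfl⟩ | ⟨d, hd, rfl⟩ | ⟨f, hf, rfl⟩ | rfl
  · rw [height_bot] at hIoo hr
    have hpt : ∀ x ∈ Set.Ioo (bot L) K, ∃ a, ∃ ha : a ∈ L.flatten, a ∈ x.1 ∧ a ∈ K.1 ∧
        vtx a ha ≤ x := by
      intro x hx
      obtain ⟨a, ha⟩ : x.1.Nonempty := by
        rw [Finset.nonempty_iff_ne_empty]
        intro h
        exact hx.1.ne (Subtype.ext h.symm)
      have hav : a ∈ L.flatten := by
        have := le_top x ha
        simpa [top, vertices] using this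
      exact ⟨a, hav, ha, hx.2.le ha, vtx_le_iff.2 ha⟩
    have hvK : ∀ {a} (ha : a ∈ L.flatten), a ∈ K.1 → vtx a ha ∈ Set.Ioo (bot L) K := fun ha haK =>
      hIoo (bot_le _) (vtx_le_iff.2 haK) (by rw [height_vtx]; norm_num)
        (by rw [height_vtx]; omega)
    suffices Hv : ∃ u, ∃ hu : u ∈ L.flatten, ∀ a (ha : a ∈ L.flatten), a ∈ K.1 →
        Relation.ReflTransGen (fun x y => x ∈ Set.Ioo (bot L) K ∧ y ∈ Set.Ioo (bot L) K ∧
          (x < y ∨ y < x)) (vtx u hu) (vtx a ha) by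
      obtain ⟨u, hu, Hv⟩ := Hv
      refine reflTransGen_of_hub (c := vtx u hu) (fun x hx => ?_) hF hG
      obtain ⟨a, ha, -, haK, hax⟩ := hpt x hx
      exact (Hv a ha haK).trans (hlink (hvK ha haK) hx (Or.inl hax))
    rcases (show height K = 3 ∨ height K = 4 by omega) with h3 | h4
    · obtain ⟨f, hf, rfl⟩ := exists_fac hL h3
      have hl := hL.three_le_length f hf
      have hfl : ∀ {a}, a ∈ f → a ∈ L.flatten := fun ha => List.mem_flatten.2 ⟨f, hf, ha⟩
      refine ⟨f[0], hfl (List.getElem_mem _), fun a ha haK => ?_⟩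
      obtain ⟨i, hi, rfl⟩ := List.mem_iff_getElem.1 (mem_fac.1 haK)
      induction i with
      | zero => exact Relation.ReflTransGen.refl
      | succ i ih =>
        have hi' : i < f.length := by omega
        have hdart : (f[i], f[i + 1]) ∈ darts f :=
          mem_darts_iff.2 ⟨i, hi', rfl, by congr 1; exact Nat.mod_eq_of_lt hi⟩
        have h1 := ih hi' (hfl (List.getElem_mem _)) (mem_fac.2 (List.getElem_mem _))
        have hd : (f[i], f[i + 1]) ∈ L.flatMap darts := List.mem_flatMap.2 ⟨f, hf, hdart⟩
        have he : edg _ hd ∈ Set.Ioo (bot L) (fac f hf) := hIoo (bot_le _)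
          (edg_le_iff.2 ⟨mem_fac.2 (fst_mem_of_mem_darts hdart),
            mem_fac.2 (snd_mem_of_mem_darts hdart)⟩) (by rw [height_edg hL]; norm_num)
          (by rw [height_edg hL]; omega)
        refine (h1.trans (hlink (hvK _ (mem_fac.2 (List.getElem_mem _))) he
          (Or.inl (vtx_le_iff.2 (mem_edg.2 (Or.inl rfl)))))).trans
          (hlink he (hvK _ haK) (Or.inr (vtx_le_iff.2 (mem_edg.2 (Or.inr rfl)))))
    · obtain rfl := eq_top hL h4
      obtain ⟨u, hu, hconn⟩ := hL.connected
      refine ⟨u, hu, fun a ha _ => ?_⟩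
      have hmem : ∀ {a} (_ : a ∈ L.flatten), a ∈ (top L).1 := fun ha => by
        simpa [top, vertices] using ha
      have := hconn a ha
      induction this with
      | refl => exact Relation.ReflTransGen.refl
      | @tail b c _ hs ih =>
        obtain ⟨f, hf, hb, hc⟩ := hs
        have hb' : b ∈ L.flatten := List.mem_flatten.2 ⟨f, hf, hb⟩
        have he : fac f hf ∈ Set.Ioo (bot L) (top L) := hIoo (bot_le _) (le_top _)
          (by rw [height_fac hL]; norm_num) (by rw [height_fac hL]; omega)
        exact ((ih hb' (hmem hb')).trans (hlink (hvK hb' (hmem hb')) he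
          (Or.inl (vtx_le_iff.2 (mem_fac.2 hb))))).trans
          (hlink he (hvK ha (hmem ha)) (Or.inr (vtx_le_iff.2 (mem_fac.2 hc))))
  · rw [height_vtx] at hIoo hr
    obtain rfl := eq_top hL (show height K = 4 by omega)
    obtain ⟨M, hM, -, hcyc⟩ := hL.symbol v hv
    have hmem : ∀ {g}, g ∈ M ↔ g ∈ L ∧ v ∈ g := by
      intro g
      rw [hM.mem_iff]
      simp
    have hfac : ∀ {g} (hg : g ∈ L), v ∈ g → fac g hg ∈ Set.Ioo (vtx v hv) (top L) := fun hg hvg =>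
      hIoo (vtx_le_iff.2 (mem_fac.2 hvg)) (le_top _) (by rw [height_fac hL]; norm_num)
        (by rw [height_fac hL]; omega)
    obtain ⟨f₀, hf₀, hvf₀⟩ := List.mem_flatten.1 hv
    have hMpos : 0 < M.length := List.length_pos_of_mem (hmem.2 ⟨hf₀, hvf₀⟩)
    have hM0 := hmem.1 (List.getElem_mem hMpos)
    have main : ∀ i (hi : i < M.length) (hg : M[i] ∈ L), Relation.ReflTransGen
        (fun x y => x ∈ Set.Ioo (vtx v hv) (top L) ∧ y ∈ Set.Ioo (vtx v hv) (top L) ∧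
          (x < y ∨ y < x)) (fac M[0] hM0.1) (fac M[i] hg) := by
      intro i
      induction i with
      | zero => exact fun _ _ => Relation.ReflTransGen.refl
      | succ i ih =>
        intro hi hg
        have hi' : i < M.length := by omega
        have hMi := hmem.1 (List.getElem_mem hi')
        have hMi1 := hmem.1 (List.getElem_mem hi)
        obtain ⟨d, hd, hdv⟩ := hcyc (M[i], M[i + 1]) (by
          rw [List.mem_iff_getElem]
          refine ⟨i, by simpa using hi', ?_⟩
          rw [List.getElem_zip, List.getElem_rotate]
          congr 2
          exact Nat.mod_eq_of_lt hi)
        have hdL : d ∈ L.flatMap darts := List.mem_flatMap.2 ⟨_, hMi.1, hd⟩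
        have hdv' : v = d.1 ∨ v = d.2 := hdv.imp (fun h => h.1.symm) fun h => h.1.symm
        have hd2 : d.1 ∈ M[i + 1] ∧ d.2 ∈ M[i + 1] := by
          rcases hdv with ⟨h1, h2⟩ | ⟨h1, h2⟩
          · exact ⟨h1 ▸ hMi1.2, h2⟩
          · exact ⟨h2, h1 ▸ hMi1.2⟩
        have he : edg d hdL ∈ Set.Ioo (vtx v hv) (top L) :=
          hIoo (vtx_le_iff.2 (mem_edg.2 hdv')) (le_top _) (by rw [height_edg hL]; norm_num)
            (by rw [height_edg hL]; omega)
        exact ((ih hi' hMi.1).trans (hlink (hfac _ hMi.2) he (Or.inr (edg_le_iff.2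
          ⟨mem_fac.2 (fst_mem_of_mem_darts hd), mem_fac.2 (snd_mem_of_mem_darts hd)⟩)))).trans
          (hlink he (hfac _ hMi1.2) (Or.inl (edg_le_iff.2 ⟨mem_fac.2 hd2.1, mem_fac.2 hd2.2⟩)))
    have hall : ∀ g (hg : g ∈ L), v ∈ g → Relation.ReflTransGen
        (fun x y => x ∈ Set.Ioo (vtx v hv) (top L) ∧ y ∈ Set.Ioo (vtx v hv) (top L) ∧
          (x < y ∨ y < x)) (fac M[0] hM0.1) (fac g hg) := by
      intro g hg hvg
      obtain ⟨i, hi, rfl⟩ := List.mem_iff_getElem.1 (hmem.2 ⟨hg, hvg⟩)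
      exact main i hi hg
    refine reflTransGen_of_hub (c := fac M[0] hM0.1) (fun x hx => ?_) hF hG
    have hx1 := height_strictMono hL hx.1
    have hx2 := height_strictMono hL hx.2
    rw [height_vtx] at hx1
    rw [height_top hL] at hx2
    rcases (show height x = 2 ∨ height x = 3 by omega) with h2 | h3
    · obtain ⟨d, hd, rfl⟩ := exists_edg hL h2
      obtain ⟨f, hf, hdf⟩ := List.mem_flatMap.1 hd
      have hvf : v ∈ f := by
        rcases mem_edg.1 (vtx_le_iff.1 hx.1.le) with rfl | rfl
        · exact fst_mem_of_mem_darts hdf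
        · exact snd_mem_of_mem_darts hdf
      exact (hall f hf hvf).trans (hlink (hfac hf hvf) hx (Or.inr (edg_le_iff.2
        ⟨mem_fac.2 (fst_mem_of_mem_darts hdf), mem_fac.2 (snd_mem_of_mem_darts hdf)⟩)))
    · obtain ⟨g, hg, rfl⟩ := exists_fac hL h3
      exact hall g hg (mem_fac.1 (vtx_le_iff.1 hx.1.le))
  · rw [height_edg hL] at hr; omega
  · rw [height_fac hL] at hr; omega
  · rw [height_top hL] at hr; omega

theorem isPolytope (hL : IsPolyhedralMap L sym) : IsPolytope 3 (FaceLattice L) where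
  bounded := ⟨⟨bot L, bot_le⟩, top L, le_top⟩
  flag_card := (isGraded hL).ncard_flag
  strongly_connected := by
    intro H K _ hl F hF G hG
    rw [order_height_eq hL, order_height_eq hL] at hl
    exact strongly_connected hL (by exact_mod_cast hl) hF hG
  diamond := by
    intro F G hFG hl
    rw [order_height_eq hL, order_height_eq hL] at hl
    exact diamond hL hFG (by exact_mod_cast hl)

theorem natHeight_eq (hL : IsPolyhedralMap L sym) (x : FaceLattice L) : natHeight x = height x := by
  rw [natHeight, order_height_eq hL]
  rfl

theorem hasRank_iff (hL : IsPolyhedralMap L sym) {i : ℕ} {x : FaceLattice L} :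
    HasRank i x ↔ height x = i + 1 := by
  rw [(isPolytope hL).hasRank_iff, natHeight_eq hL]

theorem hasVertexSymbol (hL : IsPolyhedralMap L sym) : HasVertexSymbol (FaceLattice L) sym := by
  intro x hx
  rw [hasRank_iff hL] at hx
  obtain ⟨v, hv, rfl⟩ := exists_vtx hL hx
  obtain ⟨M, hM, hsym, hcyc⟩ := hL.symbol v hv
  have hlen : sym.length = M.length := by rw [← hsym, List.length_map]
  have hmem : ∀ {g}, g ∈ M ↔ g ∈ L ∧ v ∈ g := by
    intro g
    rw [hM.mem_iff]
    simp
  have hnd : M.Nodup := hM.nodup_iff.2 ((nodup_faces hL).filter _)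
  have hget : ∀ i : Fin sym.length, M[(i : ℕ)] ∈ L ∧ v ∈ M[(i : ℕ)] := fun i =>
    hmem.1 (List.getElem_mem _)
  have hlt : ∀ i : Fin sym.length, vtx v hv < fac _ (hget i).1 := fun i =>
    lt_of_le_of_height_lt (vtx_le_iff.2 (mem_fac.2 (hget i).2))
      (by rw [height_vtx, height_fac hL]; norm_num)
  refine ⟨fun i => fac _ (hget i).1, ?_, ?_, ?_, ?_⟩
  · intro i j hij
    have h1 : M[(i : ℕ)] = M[(j : ℕ)] := hL.eq_of_subset _ (hget i).1 _ (hget j).1 fun a ha => by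
      have h2 : a ∈ (fac _ (hget i).1).1 := mem_fac.2 ha
      rw [show fac _ (hget i).1 = fac _ (hget j).1 from hij] at h2
      exact mem_fac.1 h2
    exact Fin.ext (hnd.getElem_inj_iff.1 h1)
  · intro G
    constructor
    · rintro ⟨hG, hvG⟩
      rw [hasRank_iff hL] at hG
      obtain ⟨g, hg, rfl⟩ := exists_fac hL hG
      obtain ⟨i, hi, hgi⟩ := List.mem_iff_getElem.1
        (hmem.2 ⟨hg, mem_fac.1 (vtx_le_iff.1 hvG.le)⟩)
      subst hgi
      exact ⟨⟨i, by omega⟩, rfl⟩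
    · rintro ⟨i, rfl⟩
      exact ⟨(hasRank_iff hL).2 (height_fac hL), hlt i⟩
  · intro i
    -- With the length written as a successor, `finRotate` is addition of one modulo the length, in
    -- agreement with `List.rotate`.
    obtain ⟨n, hn⟩ : ∃ n, sym.length = n + 1 := ⟨sym.length - 1, by have := i.2; omega⟩
    have hrot : ((finRotate _ i : Fin sym.length) : ℕ) = (i + 1) % M.length := by
      rw [← hlen]
      revert i
      rw [hn]
      intro i
      rw [finRotate_apply, Fin.val_add]
      simp
    obtain ⟨d, hd, hdv⟩ := hcyc (M[(i : ℕ)], M[((finRotate _ i : Fin sym.length) : ℕ)]) (by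
      rw [List.mem_iff_getElem]
      refine ⟨i, by have := i.2; simp; omega, ?_⟩
      rw [List.getElem_zip, List.getElem_rotate]
      congr 2
      exact hrot.symm)
    have hdL : d ∈ L.flatMap darts := List.mem_flatMap.2 ⟨_, (hget i).1, hd⟩
    have hd2 : d.1 ∈ M[((finRotate _ i : Fin sym.length) : ℕ)] ∧
        d.2 ∈ M[((finRotate _ i : Fin sym.length) : ℕ)] := by
      rcases hdv with ⟨h1, h2⟩ | ⟨h1, h2⟩
      · exact ⟨by rw [h1]; exact (hget (finRotate _ i)).2, h2⟩
      · exact ⟨h2, by rw [h1]; exact (hget (finRotate _ i)).2⟩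
    refine ⟨edg d hdL, (hasRank_iff hL).2 (height_edg hL), ?_, ?_, ?_⟩
    · exact lt_of_le_of_height_lt (vtx_le_iff.2 (mem_edg.2
        (hdv.imp (fun h => h.1.symm) fun h => h.1.symm)))
        (by rw [height_vtx, height_edg hL]; norm_num)
    · exact lt_of_le_of_height_lt (edg_le_iff.2 ⟨mem_fac.2 (fst_mem_of_mem_darts hd),
        mem_fac.2 (snd_mem_of_mem_darts hd)⟩) (by rw [height_edg hL, height_fac hL]; norm_num)
    · exact lt_of_le_of_height_lt (edg_le_iff.2 ⟨mem_fac.2 hd2.1, mem_fac.2 hd2.2⟩)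
        (by rw [height_edg hL, height_fac hL]; norm_num)
  · intro i
    -- The vertices below the 2-face are counted through its boundary list, which has no
    -- repetitions.
    have hset : {u : FaceLattice L | HasRank 0 u ∧ u < fac _ (hget i).1} =
        (fun a : {a // a ∈ M[(i : ℕ)]} => vtx (L := L) a.1
          (List.mem_flatten.2 ⟨_, (hget i).1, a.2⟩)) '' Set.univ := by
      ext u
      simp only [Set.mem_ofPred_eq, Set.image_univ, Set.mem_range, Subtype.exists]
      constructor
      · rintro ⟨hu, huf⟩
        rw [hasRank_iff hL] at hu
        obtain ⟨a, ha, rfl⟩ := exists_vtx hL hu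
        exact ⟨a, mem_fac.1 (vtx_le_iff.1 huf.le), rfl⟩
      · rintro ⟨a, ha, rfl⟩
        exact ⟨(hasRank_iff hL).2 height_vtx, lt_of_le_of_height_lt (vtx_le_iff.2 (mem_fac.2 ha))
          (by rw [height_vtx, height_fac hL]; norm_num)⟩
    rw [hset, Set.ncard_image_of_injective _ (fun a b hab => Subtype.ext
      (Finset.singleton_injective (congrArg Subtype.val hab))), Set.ncard_univ,
      Nat.card_eq_fintype_card,
      Fintype.card_of_subtype M[(i : ℕ)].toFinset (fun a => List.mem_toFinset),
      List.toFinset_card_of_nodup (hL.nodup _ (hget i).1)]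
    simp [← hsym]

end FaceLattice

end ArchPoly

/-! ### A verified Schreier–Sims computation on coded permutations -/

namespace ArchPoly

/-- Evaluates `n` before it is passed to `f`, also under lazy evaluation. -/
def force {α : Type*} (n : ℕ) (f : ℕ → α) : α :=
  Nat.rec (f 0) (fun k _ => f (Nat.succ k)) n

/-- The image of `x` under the permutation with code `p`: the digit of index `x` in base `128`.
The last 64 bits of `p` are a checksum. -/
def codeApply (p x : ℕ) : ℕ := Nat.land (Nat.shiftRight p (Nat.add 64 (Nat.mul 7 x))) 127

/-- The code with digits `f 0, …, f (d - 1)`. -/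
def encode (f : ℕ → ℕ) (d : ℕ) : ℕ :=
  force (Nat.rec 0 (fun k r => Nat.add r (Nat.shiftLeft (f k) (Nat.mul 7 k))) d) fun n =>
    Nat.add (Nat.shiftLeft n 64) (Nat.mod n 2305843009213693951)

/-- An element of a table: a point and the codes of a permutation and of its inverse. -/
abbrev Entry := ℕ × ℕ × ℕ

/-- Passes the codes stored for the point `y` to `k`; fails if there are none. -/
def lookup (y : ℕ) (t : List Entry) (fail : Bool) (k : ℕ → ℕ → Bool) : Bool :=
  List.rec fail (fun e _ r => Bool.rec r (k e.2.1 e.2.2) (Nat.beq e.1 y)) t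

/-- Orbit algorithm: extends the table by the images of the entry `e` under the generators `ss`. -/
def orbitStep (d : ℕ) (e : Entry) (ss : List (ℕ × ℕ)) : List Entry → List Entry →
    (List Entry → List Entry → Bool) → Bool :=
  List.rec (fun q t k => k q t)
    (fun s _ r q t k =>
      force (codeApply s.1 e.1) fun y =>
        lookup y t
          (force (encode (fun x => codeApply s.1 (codeApply e.2.1 x)) d) fun u =>
            force (encode (fun x => codeApply e.2.2 (codeApply s.2 x)) d) fun v =>
              r ((y, u, v) :: q) ((y, u, v) :: t) k)
          (fun _ _ => r q t k)) ss

/-- At most `n` queue entries are processed, and the table is passed on in any case. An incomplete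
orbit does no harm: `checkLevel` looks up the image of every entry under every generator and fails
if it is missing. -/
def orbitTable (d : ℕ) (S : List (ℕ × ℕ)) (n : ℕ) :
    List Entry → List Entry → (List Entry → Bool) → Bool :=
  Nat.rec (fun _ t k => k t)
    (fun _ r q t k => List.rec (k t) (fun e q _ => orbitStep d e S q t fun q t => r q t k) q) n

def nth (S : List (ℕ × ℕ)) (j : ℕ) (k : ℕ × ℕ → Bool) : Bool :=
  List.rec (motive := fun _ => ℕ → Bool) (fun _ => false)
    (fun s _ r j => Nat.rec (k s) (fun i _ => r i) j) S j

/-- The Schreier generators with the given indices. -/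
def schreierGens (d : ℕ) (S : List (ℕ × ℕ)) (t : List Entry) (l : List (ℕ × ℕ)) :
    (List (ℕ × ℕ) → Bool) → Bool :=
  List.rec (fun k => k [])
    (fun p _ r k =>
      nth S p.1 fun s =>
        lookup p.2 t false fun u u' =>
          force (codeApply s.1 p.2) fun y =>
            lookup y t false fun v v' =>
              force (encode (fun x => codeApply v' (codeApply s.1 (codeApply u x))) d) fun a =>
              force (encode (fun x => codeApply u' (codeApply s.2 (codeApply v x))) d) fun b =>
                r fun S' => k ((a, b) :: S')) l

/-- At each level the element is multiplied by the inverse of the table entry with the same image of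
the base point; the identity code has to be reached at some level. An element that fixes the base
point goes to the next level unchanged. -/
def sift (d iden : ℕ) (l : List (ℕ × List Entry)) : ℕ → Bool :=
  List.rec (fun g => Nat.beq g iden)
    (fun e _ r g => Bool.rec
      (force (codeApply g e.1) fun y => Bool.rec
        (lookup y e.2 false fun _ u =>
          force (encode (fun x => codeApply u (codeApply g x)) d) r)
        (r g) (Nat.beq y e.1))
      true (Nat.beq g iden)) l

/-- All Schreier generators of the level, not just the selected ones, have to sift through the lower
levels. -/
def checkLevel (d iden : ℕ) (S : List (ℕ × ℕ)) (t : List Entry) (l : List (ℕ × List Entry)) :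
    Bool :=
  List.rec true (fun e _ r => List.rec r (fun s _ r' =>
    force (codeApply s.1 e.1) fun y => lookup y t false fun _ v =>
      Bool.rec false r' (force (encode (fun x => codeApply v (codeApply s.1 (codeApply e.2.1 x))) d)
        (sift d iden l))) S) t

/-- The list prescribes the base points and, for each one, which Schreier generators are to generate
the next group. This choice is not trusted; `checkLevel` confirms it. When the base is exhausted, no
generators may be left. -/
def schreierSims (d iden : ℕ) (l : List (ℕ × List (ℕ × ℕ))) : List (ℕ × ℕ) →
    (List (ℕ × List Entry) → Bool) → Bool :=
  List.rec (fun S k => List.rec (k []) (fun _ _ _ => false) S)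
    (fun e _ r S k => Bool.rec false
      (orbitTable d S d [(e.1, iden, iden)] [(e.1, iden, iden)] fun t =>
        schreierGens d S t e.2 fun S' =>
          r S' fun L => Bool.rec false (k ((e.1, t) :: L)) (checkLevel d iden S t L))
      (Nat.blt e.1 d)) l

def checkOrder (d : ℕ) (S : List (ℕ × ℕ)) (spec : List (ℕ × List (ℕ × ℕ))) (N : ℕ) : Bool :=
  force (encode (fun x => x) d) fun iden =>
    schreierSims d iden spec S fun L => Nat.beq ((L.map fun l => l.2.length).prod) N

theorem force_eq {α : Type*} (n : ℕ) (f : ℕ → α) : force n f = f n := by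
  cases n <;> rfl

theorem codeApply_eq (p x : ℕ) : codeApply p x = p / 2 ^ 64 / 2 ^ (7 * x) % 2 ^ 7 := by
  change (p >>> (64 + 7 * x)) &&& (2 ^ 7 - 1) = _
  rw [Nat.and_two_pow_sub_one_eq_mod, Nat.shiftRight_eq_div_pow, pow_add, Nat.div_div_eq_div_mul]

theorem codeApply_lt (p x : ℕ) : codeApply p x < 2 ^ 7 := by
  rw [codeApply_eq]
  exact Nat.mod_lt _ (by norm_num)

/-- Values below 128 produce no carries between the digits, and the checksum is below `2 ^ 64`, so
the division removes it. -/
theorem codeApply_encode {f : ℕ → ℕ} (hf : ∀ x, f x < 2 ^ 7) {d x : ℕ} (hx : x < d) :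
    codeApply (encode f d) x = f x := by
  rw [encode, force_eq, codeApply_eq]
  set N : ℕ → ℕ := fun d =>
    Nat.rec 0 (fun k r => Nat.add r (Nat.shiftLeft (f k) (Nat.mul 7 k))) d with hN
  have hsucc : ∀ k, N (k + 1) = N k + f k * 2 ^ (7 * k) := fun k => by
    rw [← Nat.shiftLeft_eq]; rfl
  have hlt : ∀ k, N k < 2 ^ (7 * k) := by
    intro k
    induction k with
    | zero => simp [hN]
    | succ k ih =>
      rw [hsucc, show 7 * (k + 1) = 7 * k + 7 by ring, pow_add]
      have := hf k
      nlinarith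
  have hdig : N d / 2 ^ (7 * x) % 2 ^ 7 = f x := by
    induction d with
    | zero => omega
    | succ k ih =>
      rw [hsucc]
      rcases Nat.lt_succ_iff_lt_or_eq.1 hx with h | rfl
      · obtain ⟨c, hc⟩ : ∃ c, 7 * k = 7 * x + (7 + c) := ⟨7 * (k - x - 1), by omega⟩
        rw [hc, pow_add 2 (7 * x), mul_left_comm, Nat.add_mul_div_left _ _ (by positivity),
          pow_add, mul_left_comm, Nat.add_mul_mod_self_left]
        exact ih h
      · rw [Nat.add_mul_div_right _ _ (by positivity), Nat.div_eq_of_lt (hlt x), zero_add,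
          Nat.mod_eq_of_lt (hf x)]
  change (N d <<< 64 + N d % 2305843009213693951) / 2 ^ 64 / 2 ^ (7 * x) % 2 ^ 7 = f x
  rw [Nat.shiftLeft_eq, mul_comm, Nat.mul_add_div (by positivity),
    Nat.div_eq_of_lt ((Nat.mod_lt _ (by norm_num)).trans (by norm_num)), add_zero, hdig]

/-- The number `p` is a code of the permutation `π`. -/
def IsCode {d : ℕ} (p : ℕ) (π : Equiv.Perm (Fin d)) : Prop := ∀ x : Fin d, codeApply p x = π x

theorem isCode_encode {d : ℕ} {f : ℕ → ℕ} (hf : ∀ x, f x < 2 ^ 7) {π : Equiv.Perm (Fin d)}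
    (h : ∀ x : Fin d, f x = π x) : IsCode (encode f d) π := fun x =>
  (codeApply_encode hf x.2).trans (h x)

theorem isCode_one {d : ℕ} (hd : d ≤ 2 ^ 7) :
    IsCode (encode (fun x => x) d) (1 : Equiv.Perm (Fin d)) := by
  intro x
  -- `codeApply_encode` wants values below `2 ^ 7` at all arguments; the reduction achieves this and
  -- leaves the digits of index below `d` unchanged.
  have h1 : encode (fun x => x) d = encode (fun x => x % 2 ^ 7) d := by
    rw [encode, encode, force_eq, force_eq]
    have : ∀ k ≤ 2 ^ 7,
        (Nat.rec 0 (fun k r => Nat.add r (Nat.shiftLeft k (Nat.mul 7 k))) k : ℕ) =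
        Nat.rec 0 (fun k r => Nat.add r (Nat.shiftLeft (k % 2 ^ 7) (Nat.mul 7 k))) k := by
      intro k hk
      induction k with
      | zero => rfl
      | succ k ih =>
        have h2 := ih (by omega)
        simp only at h2 ⊢
        rw [h2, Nat.mod_eq_of_lt (by omega : k < 2 ^ 7)]
    rw [this d hd]
  rw [h1, codeApply_encode (fun x => Nat.mod_lt _ (by norm_num)) x.2, Nat.mod_eq_of_lt (by omega)]
  rfl

theorem IsCode.eq {d p : ℕ} {π ρ : Equiv.Perm (Fin d)} (h1 : IsCode p π) (h2 : IsCode p ρ) :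
    π = ρ := Equiv.ext fun x => Fin.ext ((h1 x).symm.trans (h2 x))

theorem lookup_eq_true {y : ℕ} {t : List Entry} {fail : Bool} {k : ℕ → ℕ → Bool}
    (h : lookup y t fail k = true) :
    (∃ u v, (y, u, v) ∈ t ∧ k u v = true) ∨ (fail = true ∧ ∀ e ∈ t, e.1 ≠ y) := by
  induction t with
  | nil => exact Or.inr ⟨h, by simp⟩
  | cons e t ih =>
    change Bool.rec (lookup y t fail k) (k e.2.1 e.2.2) (Nat.beq e.1 y) = true at h
    cases hb : Nat.beq e.1 y with
    | true =>
      rw [hb] at h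
      obtain rfl := Nat.eq_of_beq_eq_true hb
      exact Or.inl ⟨e.2.1, e.2.2, List.mem_cons_self, h⟩
    | false =>
      rw [hb] at h
      rcases ih h with ⟨u, v, hm, hk⟩ | ⟨h1, h2⟩
      · exact Or.inl ⟨u, v, List.mem_cons_of_mem _ hm, hk⟩
      · exact Or.inr ⟨h1, List.forall_mem_cons.2 ⟨Nat.ne_of_beq_eq_false hb, h2⟩⟩

theorem nth_eq_true {S : List (ℕ × ℕ)} {j : ℕ} {k : ℕ × ℕ → Bool} (h : nth S j k = true) :
    ∃ s ∈ S, k s = true := by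
  induction S generalizing j with
  | nil => exact absurd h Bool.false_ne_true
  | cons s S ih =>
    cases j with
    | zero => exact ⟨s, List.mem_cons_self, h⟩
    | succ j =>
      obtain ⟨s', hs', hk⟩ := ih (j := j) h
      exact ⟨s', List.mem_cons_of_mem _ hs', hk⟩

section Soundness

variable {d : ℕ}

/-- The pair consists of codes of an element of `G` and of its inverse. -/
def IsCodePair (G : Subgroup (Equiv.Perm (Fin d))) (s : ℕ × ℕ) : Prop :=
  ∃ π ∈ G, IsCode s.1 π ∧ IsCode s.2 π⁻¹

/-- The entry consists of a point and the codes of an element of `G` that maps `b` to the point, and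
of its inverse. -/
def IsEntry (G : Subgroup (Equiv.Perm (Fin d))) (b : Fin d) (e : Entry) : Prop :=
  ∃ π ∈ G, IsCode e.2.1 π ∧ IsCode e.2.2 π⁻¹ ∧ (π b : ℕ) = e.1

/-- A nonempty table of entries with distinct points. -/
structure IsTable (G : Subgroup (Equiv.Perm (Fin d))) (b : Fin d) (t : List Entry) : Prop where
  isEntry : ∀ e ∈ t, IsEntry G b e
  nodup : (t.map Prod.fst).Nodup
  ne_nil : t ≠ []

variable {G : Subgroup (Equiv.Perm (Fin d))} {b : Fin d}

/-- Results are handed to continuations, so soundness, here and below, takes this form: the value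
`true` means that `k` accepted some output with the invariants. An entry is added only when its
point is absent from the table, which keeps the points distinct. -/
theorem orbitStep_sound {e : Entry} (he : IsEntry G b e) {ss : List (ℕ × ℕ)}
    (hss : ∀ s ∈ ss, IsCodePair G s) {q t : List Entry} {k : List Entry → List Entry → Bool}
    (h : orbitStep d e ss q t k = true) (hq : ∀ e ∈ q, IsEntry G b e) (ht : IsTable G b t) :
    ∃ q' t', k q' t' = true ∧ (∀ e ∈ q', IsEntry G b e) ∧ IsTable G b t' := by
  induction ss generalizing q t with
  | nil => exact ⟨q, t, h, hq, ht⟩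
  | cons s ss ih =>
    have hss' := (List.forall_mem_cons.1 hss).2
    have h0 : force (codeApply s.1 e.1) (fun y => lookup y t
        (force (encode (fun x => codeApply s.1 (codeApply e.2.1 x)) d) fun u =>
          force (encode (fun x => codeApply e.2.2 (codeApply s.2 x)) d) fun v =>
            orbitStep d e ss ((y, u, v) :: q) ((y, u, v) :: t) k)
        (fun _ _ => orbitStep d e ss q t k)) = true := h
    rw [force_eq, force_eq, force_eq] at h0
    rcases lookup_eq_true h0 with ⟨-, -, -, h1⟩ | ⟨h1, h2⟩
    · exact ih hss' h1 hq ht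
    · obtain ⟨π, hπ, hπ1, hπ2, hπb⟩ := he
      obtain ⟨σ, hσ, hσ1, hσ2⟩ := (List.forall_mem_cons.1 hss).1
      have hnew : IsEntry G b (codeApply s.1 e.1,
          encode (fun x => codeApply s.1 (codeApply e.2.1 x)) d,
          encode (fun x => codeApply e.2.2 (codeApply s.2 x)) d) := by
        refine ⟨σ * π, mul_mem hσ hπ, isCode_encode (fun _ => codeApply_lt _ _) fun x => ?_,
          isCode_encode (fun _ => codeApply_lt _ _) fun x => ?_, ?_⟩
        · rw [hπ1, hσ1]; rfl
        · rw [hσ2, hπ2, mul_inv_rev]; rfl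
        · rw [← hπb, hσ1]; rfl
      exact ih hss' h1 (List.forall_mem_cons.2 ⟨hnew, hq⟩)
        ⟨List.forall_mem_cons.2 ⟨hnew, ht.isEntry⟩, List.nodup_cons.2 ⟨fun hm => by
          obtain ⟨e', he', hee⟩ := List.mem_map.1 hm
          exact h2 e' he' hee, ht.nodup⟩, List.cons_ne_nil _ _⟩

theorem orbitTable_sound {S : List (ℕ × ℕ)} (hS : ∀ s ∈ S, IsCodePair G s) {n : ℕ}
    {q t : List Entry} {k : List Entry → Bool} (h : orbitTable d S n q t k = true)
    (hq : ∀ e ∈ q, IsEntry G b e) (ht : IsTable G b t) : ∃ t', k t' = true ∧ IsTable G b t' := by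
  induction n generalizing q t with
  | zero => exact ⟨t, h, ht⟩
  | succ n ih =>
    cases q with
    | nil => exact ⟨t, h, ht⟩
    | cons e q =>
      obtain ⟨q', t', h', hq', ht'⟩ := orbitStep_sound
        (k := fun q t => orbitTable d S n q t k) (List.forall_mem_cons.1 hq).1 hS h
        (List.forall_mem_cons.1 hq).2 ht
      exact ih h' hq' ht'

/-- If `u` and `v` are the table elements for a point and for its image under `s`, the product `v⁻¹
s u` fixes `b`. -/
theorem schreierGens_sound {S : List (ℕ × ℕ)} (hS : ∀ s ∈ S, IsCodePair G s) {t : List Entry}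
    (ht : IsTable G b t) {l : List (ℕ × ℕ)} {k : List (ℕ × ℕ) → Bool}
    (h : schreierGens d S t l k = true) :
    ∃ S', k S' = true ∧ ∀ s ∈ S', IsCodePair (G ⊓ MulAction.stabilizer _ b) s := by
  induction l generalizing k with
  | nil => exact ⟨[], h, by simp⟩
  | cons p l ih =>
    have h0 : (nth S p.1 fun s => lookup p.2 t false fun u u' =>
      force (codeApply s.1 p.2) fun y => lookup y t false fun v v' =>
        force (encode (fun x => codeApply v' (codeApply s.1 (codeApply u x))) d) fun a =>
        force (encode (fun x => codeApply u' (codeApply s.2 (codeApply v x))) d) fun b =>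
          schreierGens d S t l fun S' => k ((a, b) :: S')) = true := h
    obtain ⟨s, hs, h1⟩ := nth_eq_true h0
    obtain ⟨u, u', hu, h2⟩ := (lookup_eq_true h1).resolve_right (by simp)
    rw [force_eq] at h2
    obtain ⟨v, v', hv, h3⟩ := (lookup_eq_true h2).resolve_right (by simp)
    rw [force_eq, force_eq] at h3
    obtain ⟨S', hk, hS'⟩ := ih h3
    refine ⟨_, hk, List.forall_mem_cons.2 ⟨?_, hS'⟩⟩
    obtain ⟨σ, hσ, hσ1, hσ2⟩ := hS s hs
    obtain ⟨ρ, hρ, hρ1, hρ2, hρb⟩ := ht.isEntry _ hu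
    obtain ⟨τ, hτ, hτ1, hτ2, hτb⟩ := ht.isEntry _ hv
    simp only at hρ1 hρ2 hρb hτ1 hτ2 hτb
    refine ⟨τ⁻¹ * σ * ρ, Subgroup.mem_inf.2
        ⟨mul_mem (mul_mem (inv_mem hτ) hσ) hρ, MulAction.mem_stabilizer_iff.2 ?_⟩,
      isCode_encode (fun _ => codeApply_lt _ _) fun x => ?_,
      isCode_encode (fun _ => codeApply_lt _ _) fun x => ?_⟩
    · have : τ b = σ (ρ b) := Fin.ext (by rw [hτb, ← hρb, hσ1])
      change τ⁻¹ (σ (ρ b)) = b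
      rw [← this]
      exact τ.symm_apply_apply b
    · rw [hρ1, hσ1, hτ2]; rfl
    · rw [hτ1, hσ2, hρ2, mul_inv_rev, mul_inv_rev, inv_inv]; rfl

/-- The table and the list of lower tables only accept elements of `G`. -/
def SiftSound (G : Subgroup (Equiv.Perm (Fin d))) (iden : ℕ) (l : List (ℕ × List Entry)) : Prop :=
  ∀ (g : ℕ) (π : Equiv.Perm (Fin d)), IsCode g π → sift d iden l g = true → π ∈ G

theorem siftSound_nil {iden : ℕ} (hid : IsCode iden (1 : Equiv.Perm (Fin d))) :
    SiftSound G iden [] := by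
  intro g π hg h
  obtain rfl := Nat.eq_of_beq_eq_true h
  rw [hg.eq hid]
  exact one_mem G

theorem siftSound_cons {iden : ℕ} (hid : IsCode iden (1 : Equiv.Perm (Fin d))) {t : List Entry}
    (ht : IsTable G b t) {H : Subgroup (Equiv.Perm (Fin d))} (hHG : H ≤ G)
    {l : List (ℕ × List Entry)} (hl : SiftSound H iden l) : SiftSound G iden ((b, t) :: l) := by
  intro g π hg h
  have h0 : (Bool.rec (force (codeApply g b) fun y => Bool.rec
      (lookup y t false fun _ u =>
        force (encode (fun x => codeApply u (codeApply g x)) d) (sift d iden l))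
      (sift d iden l g) (Nat.beq y b)) true (Nat.beq g iden) : Bool) = true := h
  cases hb : Nat.beq g iden with
  | true =>
    obtain rfl := Nat.eq_of_beq_eq_true hb
    rw [hg.eq hid]
    exact one_mem G
  | false =>
    rw [hb] at h0
    replace h0 : (force (codeApply g b) fun y => (Bool.rec
      (lookup y t false fun _ u =>
        force (encode (fun x => codeApply u (codeApply g x)) d) (sift d iden l))
      (sift d iden l g) (Nat.beq y b) : Bool)) = true := h0
    rw [force_eq] at h0
    cases hb' : Nat.beq (codeApply g b) b with
    | true =>
      rw [hb'] at h0
      exact hHG (hl g π hg h0)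
    | false =>
      rw [hb'] at h0
      obtain ⟨u, v, hu, h1⟩ := (lookup_eq_true h0).resolve_right (by simp)
      rw [force_eq] at h1
      obtain ⟨ρ, hρ, hρ1, hρ2, -⟩ := ht.isEntry _ hu
      have h2 := hHG (hl _ (ρ⁻¹ * π) (isCode_encode (fun _ => codeApply_lt _ _) fun x => by
        rw [hg, hρ2]; rfl) h1)
      simpa using mul_mem hρ h2

theorem checkLevel_sound {iden : ℕ} {S : List (ℕ × ℕ)} {t : List Entry}
    {l : List (ℕ × List Entry)} (h : checkLevel d iden S t l = true) {e : Entry} (he : e ∈ t)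
    {s : ℕ × ℕ} (hs : s ∈ S) : ∃ u v, (codeApply s.1 e.1, u, v) ∈ t ∧ sift d iden l
      (encode (fun x => codeApply v (codeApply s.1 (codeApply e.2.1 x))) d) = true := by
  let inner : List (ℕ × ℕ) → Entry → Bool → Bool := fun S e r => List.rec r (fun s _ r' =>
    force (codeApply s.1 e.1) fun y => lookup y t false fun _ v =>
      Bool.rec false r' (force (encode (fun x => codeApply v (codeApply s.1 (codeApply e.2.1 x))) d)
        (sift d iden l))) S
  have hinner : ∀ S e r, inner S e r = true → r = true ∧ ∀ s ∈ S,
      ∃ u v, (codeApply s.1 e.1, u, v) ∈ t ∧ sift d iden l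
        (encode (fun x => codeApply v (codeApply s.1 (codeApply e.2.1 x))) d) = true := by
    intro S e r hS
    induction S with
    | nil => exact ⟨hS, by simp⟩
    | cons s S ih =>
      have h0 : (force (codeApply s.1 e.1) fun y => lookup y t false fun _ v =>
          Bool.rec false (inner S e r)
            (force (encode (fun x => codeApply v (codeApply s.1 (codeApply e.2.1 x))) d)
              (sift d iden l))) = true := hS
      rw [force_eq] at h0
      obtain ⟨u, v, hu, h1⟩ := (lookup_eq_true h0).resolve_right (by simp)
      rw [force_eq] at h1
      cases hb : sift d iden l
          (encode (fun x => codeApply v (codeApply s.1 (codeApply e.2.1 x))) d) with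
      | false => rw [hb] at h1; exact absurd h1 Bool.false_ne_true
      | true =>
        rw [hb] at h1
        obtain ⟨hr, hS'⟩ := ih h1
        exact ⟨hr, List.forall_mem_cons.2 ⟨⟨u, v, hu, hb⟩, hS'⟩⟩
  have houter : ∀ t' : List Entry, (List.rec true (fun e _ r => inner S e r) t' : Bool) = true →
      ∀ e ∈ t', inner S e true = true ∨ ∃ r, inner S e r = true := by
    intro t' ht'
    induction t' with
    | nil => simp
    | cons e t' ih =>
      exact List.forall_mem_cons.2 ⟨Or.inr ⟨_, ht'⟩, ih (hinner _ _ _ ht').1⟩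
  rcases houter t h e he with h1 | ⟨r, h1⟩
  · exact (hinner _ _ _ h1).2 s hs
  · exact (hinner _ _ _ h1).2 s hs

/-- The group generated by the permutations with codes in the list. -/
def codeGroup (d : ℕ) (S : List (ℕ × ℕ)) : Subgroup (Equiv.Perm (Fin d)) :=
  Subgroup.closure {π | ∃ s ∈ S, IsCode s.1 π}

theorem isCodePair_codeGroup {S : List (ℕ × ℕ)}
    (hS : ∀ s ∈ S, IsCodePair (⊤ : Subgroup (Equiv.Perm (Fin d))) s) :
    ∀ s ∈ S, IsCodePair (codeGroup d S) s := by
  intro s hs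
  obtain ⟨π, -, h1, h2⟩ := hS s hs
  exact ⟨π, Subgroup.subset_closure ⟨s, hs, h1⟩, h1, h2⟩

theorem codeGroup_le {S : List (ℕ × ℕ)} (hS : ∀ s ∈ S, IsCodePair G s) : codeGroup d S ≤ G := by
  rw [codeGroup, Subgroup.closure_le]
  rintro π ⟨s, hs, h1⟩
  obtain ⟨π', hπ', h2, -⟩ := hS s hs
  rwa [h1.eq h2]

/-- Schreier's lemma as a count. The check says that the union `A` of the cosets `ρ i * codeGroup d
S'` is closed under left multiplication by the generators; as `A` contains an element of the group,
it contains the whole group. The cosets are disjoint because they map `b` to different points. It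
need not be known beforehand that the table is a full orbit or that `S'` generates the full
stabilizer. -/
theorem card_codeGroup {iden : ℕ} {S S' : List (ℕ × ℕ)} {t : List Entry}
    (ht : IsTable (codeGroup d S) b t)
    (hS' : ∀ s ∈ S', IsCodePair (codeGroup d S ⊓ MulAction.stabilizer _ b) s)
    {l : List (ℕ × List Entry)} (hl : SiftSound (codeGroup d S') iden l)
    (hc : checkLevel d iden S t l = true) :
    Nat.card (codeGroup d S) = t.length * Nat.card (codeGroup d S') := by
  have hle := codeGroup_le hS'
  have hex : ∀ i : Fin t.length, IsEntry (codeGroup d S) b (t.get i) := fun i =>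
    ht.isEntry _ (List.get_mem t i)
  choose ρ hρ hρ1 hρ2 hρb using hex
  let A : Set (Equiv.Perm (Fin d)) := {π | ∃ i, (ρ i)⁻¹ * π ∈ codeGroup d S'}
  have hmul : ∀ s ∈ S, ∀ σ, IsCode s.1 σ → ∀ π ∈ A, σ * π ∈ A := by
    rintro s hs σ hσ π ⟨i, hi⟩
    obtain ⟨u, v, hu, hsift⟩ := checkLevel_sound hc (List.get_mem t i) hs
    obtain ⟨j, hj⟩ := List.get_of_mem hu
    refine ⟨j, ?_⟩
    have hv : IsCode v (ρ j)⁻¹ := by have := hρ2 j; rwa [hj] at this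
    have h1 := hl _ ((ρ j)⁻¹ * σ * ρ i)
      (isCode_encode (fun _ => codeApply_lt _ _) fun x => by rw [hρ1, hσ, hv]; rfl) hsift
    have h2 := mul_mem h1 hi
    rwa [show (ρ j)⁻¹ * σ * ρ i * ((ρ i)⁻¹ * π) = (ρ j)⁻¹ * (σ * π) by group] at h2
  have hclosed : ∀ g ∈ codeGroup d S, ∀ π ∈ A, g * π ∈ A := by
    intro g hg
    induction hg using Subgroup.closure_induction with
    | mem σ hσ =>
      obtain ⟨s, hs, hσ⟩ := hσ
      exact hmul s hs σ hσ
    | one => intro π hπ; rwa [one_mul]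
    | mul x y _ _ hx hy => intro π hπ; rw [mul_assoc]; exact hx _ (hy _ hπ)
    | inv x _ hx =>
      -- In a finite group the inverse of `x` is a power with a natural exponent, so closure under
      -- `x` suffices.
      have hpow : ∀ n : ℕ, ∀ π ∈ A, x ^ n * π ∈ A := by
        intro n
        induction n with
        | zero => intro π hπ; rwa [pow_zero, one_mul]
        | succ n ih => intro π hπ; rw [pow_succ, mul_assoc]; exact ih _ (hx _ hπ)
      have : x⁻¹ = x ^ (orderOf x - 1) := by
        rw [inv_eq_iff_mul_eq_one, ← pow_succ', Nat.sub_add_cancel (orderOf_pos x),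
          pow_orderOf_eq_one]
      rw [this]
      exact hpow _
  have hlen : 0 < t.length := List.length_pos_of_ne_nil ht.ne_nil
  have hρA : ρ ⟨0, hlen⟩ ∈ A := ⟨⟨0, hlen⟩, by rw [inv_mul_cancel]; exact one_mem _⟩
  have hall : ∀ g ∈ codeGroup d S, g ∈ A := by
    intro g hg
    have := hclosed (g * (ρ ⟨0, hlen⟩)⁻¹) (mul_mem hg (inv_mem (hρ _))) _ hρA
    rwa [inv_mul_cancel_right] at this
  let f : Fin t.length × codeGroup d S' → codeGroup d S := fun p =>
    ⟨ρ p.1 * p.2, mul_mem (hρ _) (hle p.2.2).1⟩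
  have hf : Function.Bijective f := by
    constructor
    · rintro ⟨i, h⟩ ⟨j, h'⟩ he
      have he' : ρ i * h = ρ j * h' := congrArg Subtype.val he
      have hb1 : (h : Equiv.Perm (Fin d)) b = b := (hle h.2).2
      have hb2 : (h' : Equiv.Perm (Fin d)) b = b := (hle h'.2).2
      have hij : ρ i b = ρ j b := by
        have := congrArg (fun π : Equiv.Perm (Fin d) => π b) he'
        simpa [hb1, hb2] using this
      have hkey : (t.get i).1 = (t.get j).1 := by rw [← hρb, ← hρb, hij]
      obtain rfl : i = j := by
        have hnd := ht.nodup
        rw [List.nodup_iff_injective_get] at hnd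
        have := @hnd ⟨i, by simp⟩ ⟨j, by simp⟩ (by simpa using hkey)
        exact Fin.ext (by simpa using this)
      rw [mul_right_inj] at he'
      rw [Subtype.ext he']
    · rintro ⟨g, hg⟩
      obtain ⟨i, hi⟩ := hall g hg
      exact ⟨(i, ⟨_, hi⟩), Subtype.ext (mul_inv_cancel_left _ _)⟩
  rw [← Nat.card_congr (Equiv.ofBijective f hf), Nat.card_prod, Nat.card_eq_fintype_card,
    Fintype.card_fin]

/-- Each level multiplies the order by the length of its table. Sifting stays sound when a level is
added, because the lower group is contained in the group of that level. -/
theorem schreierSims_sound {iden : ℕ} (hid : IsCode iden (1 : Equiv.Perm (Fin d)))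
    {spec : List (ℕ × List (ℕ × ℕ))} {S : List (ℕ × ℕ)}
    (hS : ∀ s ∈ S, IsCodePair (⊤ : Subgroup (Equiv.Perm (Fin d))) s)
    {k : List (ℕ × List Entry) → Bool} (h : schreierSims d iden spec S k = true) :
    ∃ L, k L = true ∧ SiftSound (codeGroup d S) iden L ∧
      Nat.card (codeGroup d S) = (L.map fun l => l.2.length).prod := by
  induction spec generalizing S k with
  | nil =>
    cases S with
    | cons s S => exact absurd h Bool.false_ne_true
    | nil =>
      refine ⟨[], h, siftSound_nil hid, ?_⟩
      have : codeGroup d [] = ⊥ := by simp [codeGroup]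
      rw [this]
      simp
  | cons e spec ih =>
    have h0 : (Bool.rec false
        (orbitTable d S d [(e.1, iden, iden)] [(e.1, iden, iden)] fun t =>
          schreierGens d S t e.2 fun S' => schreierSims d iden spec S' fun L =>
            Bool.rec false (k ((e.1, t) :: L)) (checkLevel d iden S t L))
        (Nat.blt e.1 d) : Bool) = true := h
    cases hb : Nat.blt e.1 d with
    | false => rw [hb] at h0; exact absurd h0 Bool.false_ne_true
    | true =>
      rw [hb] at h0
      obtain ⟨b, picks⟩ := e
      replace hb : b < d := Nat.le_of_ble_eq_true hb
      have hS1 := isCodePair_codeGroup hS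
      have he0 : IsEntry (codeGroup d S) ⟨b, hb⟩ (b, iden, iden) :=
        ⟨1, one_mem _, hid, by rwa [inv_one], rfl⟩
      obtain ⟨t, h1, ht⟩ := orbitTable_sound (b := ⟨b, hb⟩) hS1 h0 (by simpa using he0)
        ⟨by simpa using he0, by simp, by simp⟩
      obtain ⟨S', h2, hS'⟩ := schreierGens_sound hS1 ht h1
      obtain ⟨L, h3, hL, hcard⟩ := ih (fun s hs => by
        obtain ⟨π, -, hπ⟩ := hS' s hs
        exact ⟨π, trivial, hπ⟩) h2
      cases hc : checkLevel d iden S t L with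
      | false => rw [hc] at h3; exact absurd h3 Bool.false_ne_true
      | true =>
        rw [hc] at h3
        refine ⟨_, h3, siftSound_cons (b := ⟨b, hb⟩) hid ht
          ((codeGroup_le hS').trans inf_le_left) hL, ?_⟩
        rw [card_codeGroup ht hS' hL hc, hcard]
        simp

theorem card_codeGroup_of_checkOrder (hd : d ≤ 2 ^ 7) {S : List (ℕ × ℕ)}
    (hS : ∀ s ∈ S, IsCodePair (⊤ : Subgroup (Equiv.Perm (Fin d))) s)
    {spec : List (ℕ × List (ℕ × ℕ))} {N : ℕ} (h : checkOrder d S spec N = true) :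
    Nat.card (codeGroup d S) = N := by
  rw [checkOrder, force_eq] at h
  obtain ⟨L, hL, -, hcard⟩ := schreierSims_sound (isCode_one hd) hS h
  rw [hcard]
  exact Nat.eq_of_beq_eq_true hL

end Soundness

end ArchPoly

/-! ### Flags as darts with a chosen end, and transfer to a small permutation group -/

namespace ArchPoly

namespace FaceLattice

variable {L : List (List ℕ)} {sym : List ℕ}

/-- The flag `Φ` consists of the face `f`, the edge with the dart `d` of `f`, and the end of `d` if
`b` holds, or the start of `d` otherwise. -/
def IsAt (hL : IsPolyhedralMap L sym) (Φ : Flag (FaceLattice L)) (f : List ℕ) (d : ℕ × ℕ)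
    (b : Bool) : Prop :=
  ((isPolytope hL).face Φ 1).1 = {if b then d.2 else d.1} ∧
    ((isPolytope hL).face Φ 2).1 = {d.1, d.2} ∧ ((isPolytope hL).face Φ 3).1 = f.toFinset

section Flags

variable (hL : IsPolyhedralMap L sym) {Φ Ψ : Flag (FaceLattice L)} {f f' : List ℕ} {d d' : ℕ × ℕ}
  {b b' : Bool}

theorem exists_isAt (Φ : Flag (FaceLattice L)) :
    ∃ f ∈ L, ∃ d ∈ darts f, ∃ b, IsAt hL Φ f d b := by
  have h := isPolytope hL
  have hh : ∀ i, height (h.face Φ i) = i := fun i => by rw [← natHeight_eq hL, h.natHeight_face]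
  obtain ⟨v, hv, h1⟩ := exists_vtx hL (hh 1)
  obtain ⟨e, he, h2⟩ := exists_edg hL (hh 2)
  obtain ⟨f, hf, h3⟩ := exists_fac hL (hh 3)
  have h12 := h.face_le_face Φ (i := 1) (j := 2) (by decide)
  have h23 := h.face_le_face Φ (i := 2) (j := 3) (by decide)
  rw [h1, h2, vtx_le_iff, mem_edg] at h12
  rw [h2, h3, edg_le_iff, mem_fac, mem_fac] at h23
  obtain ⟨d, hd, hde⟩ : ∃ d ∈ darts f, d = e ∨ d = (e.2, e.1) := by
    rcases hL.chord f hf e he h23.1 h23.2 with hc | hc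
    · exact ⟨_, hc, Or.inl rfl⟩
    · exact ⟨_, hc, Or.inr rfl⟩
  have hve : v = d.1 ∨ v = d.2 := by
    rcases hde with rfl | rfl
    · exact h12
    · exact h12.symm
  have hed : ((h.face Φ 2).1 : Finset ℕ) = {d.1, d.2} := by
    rw [h2]
    rcases hde with rfl | rfl
    · rfl
    · exact Finset.pair_comm _ _
  refine ⟨f, hf, d, hd, ?_⟩
  rcases hve with rfl | rfl
  · exact ⟨false, by rw [h1]; rfl, hed, by rw [h3]; rfl⟩
  · exact ⟨true, by rw [h1]; rfl, hed, by rw [h3]; rfl⟩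

theorem exists_flag_isAt (hf : f ∈ L) (hd : d ∈ darts f) (b : Bool) : ∃ Φ, IsAt hL Φ f d b := by
  have h := isPolytope hL
  have hdL : d ∈ L.flatMap darts := List.mem_flatMap.2 ⟨f, hf, hd⟩
  have hdf := mem_flatten_of_mem_darts hdL
  have hv : (if b then d.2 else d.1) ∈ L.flatten := by split_ifs <;> simp [hdf]
  have h12 : vtx _ hv ≤ edg d hdL := vtx_le_iff.2 (mem_edg.2 (by cases b <;> simp))
  have h23 : edg d hdL ≤ fac f hf := edg_le_iff.2
    ⟨mem_fac.2 (fst_mem_of_mem_darts hd), mem_fac.2 (snd_mem_of_mem_darts hd)⟩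
  have hc : IsChain (· ≤ ·) ({vtx _ hv, edg d hdL, fac f hf} : Set (FaceLattice L)) := by
    refine (IsChain.pair h23).insert fun x hx _ => Or.inl ?_
    rcases hx with rfl | rfl
    · exact h12
    · exact h12.trans h23
  obtain ⟨Φ, hΦ⟩ := hc.exists_subset_flag
  refine ⟨Φ, ?_, ?_, ?_⟩
  · rw [← h.eq_face (i := 1) (hΦ (Or.inl rfl)) (by rw [natHeight_eq hL, height_vtx]; rfl)]
    rfl
  · rw [← h.eq_face (i := 2) (hΦ (Or.inr (Or.inl rfl)))
      (by rw [natHeight_eq hL, height_edg hL]; rfl)]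
    rfl
  · rw [← h.eq_face (i := 3) (hΦ (Or.inr (Or.inr rfl)))
      (by rw [natHeight_eq hL, height_fac hL]; rfl)]
    rfl

variable {hL}

theorem IsAt.face_eq (h : IsAt hL Φ f d b) (h' : IsAt hL Ψ f' d' b') (hf : f ∈ L) (hf' : f' ∈ L)
    (he : (isPolytope hL).face Φ 3 = (isPolytope hL).face Ψ 3) : f = f' := by
  have h1 : f.toFinset = f'.toFinset := by rw [← h.2.2, ← h'.2.2, he]
  exact hL.eq_of_subset f hf f' hf' fun a ha =>
    List.mem_toFinset.1 (h1 ▸ List.mem_toFinset.2 ha)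

theorem IsAt.dart_eq_or (h : IsAt hL Φ f d b) (h' : IsAt hL Ψ f' d' b')
    (he : (isPolytope hL).face Φ 2 = (isPolytope hL).face Ψ 2) : d' = d ∨ d' = (d.2, d.1) := by
  have h1 : ({d.1, d.2} : Finset ℕ) = {d'.1, d'.2} := by rw [← h.2.1, ← h'.2.1, he]
  have h2 : s(d.1, d.2) = s(d'.1, d'.2) := by
    have h3 : ∀ a, a ∈ s(d.1, d.2) ↔ a ∈ s(d'.1, d'.2) := fun a => by
      simpa using Finset.ext_iff.1 h1 a
    exact Sym2.ext h3
  rcases Sym2.eq_iff.1 h2 with ⟨h3, h4⟩ | ⟨h3, h4⟩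
  · exact Or.inl (Prod.ext h3.symm h4.symm)
  · exact Or.inr (Prod.ext h4.symm h3.symm)

theorem IsAt.vertex_eq (h : IsAt hL Φ f d b) (h' : IsAt hL Ψ f' d' b')
    (he : (isPolytope hL).face Φ 1 = (isPolytope hL).face Ψ 1) :
    (if b then d.2 else d.1) = if b' then d'.2 else d'.1 :=
  Finset.singleton_injective (by rw [← h.1, ← h'.1, he])

theorem IsAt.flag_eq (h : IsAt hL Φ f d b) (h' : IsAt hL Ψ f d b) : Φ = Ψ := by
  refine (isPolytope hL).flag_ext fun i => ?_
  fin_cases i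
  · exact (isPolytope hL).face_zero_eq _ _
  · exact Subtype.ext (h.1.trans h'.1.symm)
  · exact Subtype.ext (h.2.1.trans h'.2.1.symm)
  · exact Subtype.ext (h.2.2.trans h'.2.2.symm)
  · exact (isPolytope hL).face_last_eq _ _

theorem ne_of_dart (hL : IsPolyhedralMap L sym) (hf : f ∈ L) (hd : d ∈ darts f) : d.1 ≠ d.2 :=
  ne_of_mem_darts (hL.nodup f hf) (hL.three_le_length f hf) hd

theorem bool_eq_of_end_eq (hne : d.1 ≠ d.2)
    (he : (if b then d.2 else d.1) = if b' then d.2 else d.1) : b = b' := by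
  cases b <;> cases b' <;> simp_all

theorem IsAt.dart_eq (h : IsAt hL Φ f d b) (h' : IsAt hL Ψ f d' b') (hf : f ∈ L)
    (hd : d ∈ darts f) (hd' : d' ∈ darts f)
    (he : (isPolytope hL).face Φ 2 = (isPolytope hL).face Ψ 2) : d = d' := by
  rcases h.dart_eq_or h' he with h1 | rfl
  · exact h1.symm
  · exact absurd hd' (swap_notMem_darts (hL.nodup f hf) (hL.three_le_length f hf) hd)

theorem IsAt.unique (h : IsAt hL Φ f d b) (h' : IsAt hL Φ f' d' b') (hf : f ∈ L) (hf' : f' ∈ L)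
    (hd : d ∈ darts f) (hd' : d' ∈ darts f') : f = f' ∧ d = d' ∧ b = b' := by
  obtain rfl := h.face_eq h' hf hf' rfl
  obtain rfl := h.dart_eq h' hf hd hd' rfl
  exact ⟨rfl, rfl, bool_eq_of_end_eq (ne_of_dart hL hf hd) (h.vertex_eq h' rfl)⟩

theorem IsAt.adj_zero (h : IsAt hL Φ f d b) (hf : f ∈ L) (hd : d ∈ darts f) :
    IsAt hL ((isPolytope hL).adj 0 Φ) f d !b := by
  obtain ⟨f', hf', d', hd', b', h'⟩ := exists_isAt hL ((isPolytope hL).adj 0 Φ)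
  obtain rfl := h.face_eq h' hf hf' ((isPolytope hL).face_adj 0 Φ (by decide)).symm
  obtain rfl := h.dart_eq h' hf hd hd' ((isPolytope hL).face_adj 0 Φ (by decide)).symm
  obtain rfl : b' = !b := by
    rw [Bool.eq_not]
    rintro rfl
    exact (isPolytope hL).adj_ne 0 Φ (h'.flag_eq h)
  exact h'

/-- The face across an edge traverses this edge in the opposite direction, so the fixed vertex turns
from the start of the dart into its end, or conversely. -/
theorem IsAt.adj_two (h : IsAt hL Φ f d b) (hf : f ∈ L) (hd : d ∈ darts f) :
    ∃ f' ∈ L, (d.2, d.1) ∈ darts f' ∧ IsAt hL ((isPolytope hL).adj 2 Φ) f' (d.2, d.1) !b := by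
  obtain ⟨f', hf', d', hd', b', h'⟩ := exists_isAt hL ((isPolytope hL).adj 2 Φ)
  have he := h.vertex_eq h' ((isPolytope hL).face_adj 2 Φ (by decide)).symm
  have hne := ne_of_dart hL hf hd
  rcases h.dart_eq_or h' ((isPolytope hL).face_adj 2 Φ (by decide)).symm with rfl | rfl
  · obtain rfl := face_eq_of_dart_mem hL hf hf' hd hd'
    obtain rfl := bool_eq_of_end_eq hne he
    exact absurd (h'.flag_eq h) ((isPolytope hL).adj_ne 2 Φ)
  · obtain rfl : b' = !b := by cases b <;> cases b' <;> simp_all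
    exact ⟨f', hf', hd', h'⟩

/-- At a fixed vertex of a fixed face the dart is exchanged for the next one on the boundary if `b`
holds, and for the previous one otherwise. -/
theorem IsAt.adj_one (h : IsAt hL Φ f d b) (hf : f ∈ L) (hd : d ∈ darts f) :
    ∃ d' ∈ darts f, IsAt hL ((isPolytope hL).adj 1 Φ) f d' (!b) ∧
      (if b then d.2 else d.1) = if b then d'.1 else d'.2 := by
  obtain ⟨f', hf', d', hd', b', h'⟩ := exists_isAt hL ((isPolytope hL).adj 1 Φ)
  obtain rfl := h.face_eq h' hf hf' ((isPolytope hL).face_adj 1 Φ (by decide)).symm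
  have he := h.vertex_eq h' ((isPolytope hL).face_adj 1 Φ (by decide)).symm
  obtain rfl : b' = !b := by
    rw [Bool.eq_not]
    rintro rfl
    have hdd : d = d' := by
      obtain ⟨u, v⟩ := d
      obtain ⟨u', v'⟩ := d'
      cases b' with
      | false =>
        obtain rfl : u = u' := he
        rw [dart_snd_unique (hL.nodup f hf) hd hd']
      | true =>
        obtain rfl : v = v' := he
        rw [dart_fst_unique (hL.nodup f hf) hd hd']
    subst hdd
    exact (isPolytope hL).adj_ne 1 Φ (h'.flag_eq h)
  refine ⟨d', hd', h', ?_⟩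
  cases b <;> exact he

variable (hL)

/-- The position of a flag, as in `IsAt`. -/
noncomputable def position (Φ : Flag (FaceLattice L)) : {d // d ∈ L.flatMap darts} × Bool :=
  let H := exists_isAt hL Φ
  (⟨H.choose_spec.2.choose, List.mem_flatMap.2 ⟨_, H.choose_spec.1, H.choose_spec.2.choose_spec.1⟩⟩,
    H.choose_spec.2.choose_spec.2.choose)

theorem exists_isAt_position (Φ : Flag (FaceLattice L)) : ∃ f ∈ L,
    ((position hL Φ).1 : ℕ × ℕ) ∈ darts f ∧ IsAt hL Φ f (position hL Φ).1 (position hL Φ).2 :=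
  let H := exists_isAt hL Φ
  ⟨_, H.choose_spec.1, H.choose_spec.2.choose_spec.1, H.choose_spec.2.choose_spec.2.choose_spec⟩

variable {hL}

theorem IsAt.position_eq (h : IsAt hL Φ f d b) (hf : f ∈ L) (hd : d ∈ darts f) :
    position hL Φ = (⟨d, List.mem_flatMap.2 ⟨f, hf, hd⟩⟩, b) := by
  obtain ⟨f', hf', hd', h'⟩ := exists_isAt_position hL Φ
  obtain ⟨-, h1, h2⟩ := h'.unique h hf' hf hd' hd
  exact Prod.ext (Subtype.ext h1) h2

/-- A dart lies on exactly one face, so the dart and the chosen end determine the flag. -/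
theorem position_bijective : Function.Bijective (position hL) := by
  constructor
  · intro Φ Ψ he
    obtain ⟨f, hf, hd, h⟩ := exists_isAt_position hL Φ
    obtain ⟨f', hf', hd', h'⟩ := exists_isAt_position hL Ψ
    rw [he] at hd h
    obtain rfl := face_eq_of_dart_mem hL hf hf' hd hd'
    exact h.flag_eq h'
  · rintro ⟨⟨d, hdL⟩, b⟩
    obtain ⟨f, hf, hd⟩ := List.mem_flatMap.1 hdL
    obtain ⟨Φ, hΦ⟩ := exists_flag_isAt hL hf hd b
    exact ⟨Φ, hΦ.position_eq hf hd⟩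

theorem card_flag (hL : IsPolyhedralMap L sym) :
    Nat.card (Flag (FaceLattice L)) = 2 * (L.flatMap darts).length := by
  rw [Nat.card_eq_of_bijective _ (position_bijective (hL := hL)), Nat.card_prod,
    Nat.card_eq_fintype_card, Nat.card_eq_fintype_card, Fintype.card_bool,
    Fintype.card_of_subtype (L.flatMap darts).toFinset (fun a => List.mem_toFinset),
    List.toFinset_card_of_nodup hL.nodup_darts, mul_comm]

/-- The chosen end is a two-colouring of the flags that every adjacency reverses. This is the
orientation that `IsPolytope.stringCGroup` requires. -/
theorem position_adj_snd (i : Fin 3) (Φ : Flag (FaceLattice L)) :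
    (position hL ((isPolytope hL).adj i Φ)).2 = !(position hL Φ).2 := by
  obtain ⟨f, hf, hd, h⟩ := exists_isAt_position hL Φ
  fin_cases i
  · exact congrArg Prod.snd ((h.adj_zero hf hd).position_eq hf hd)
  · obtain ⟨d', hd', h', -⟩ := h.adj_one hf hd
    exact congrArg Prod.snd (h'.position_eq hf hd')
  · obtain ⟨f', hf', hd', h'⟩ := h.adj_two hf hd
    exact congrArg Prod.snd (h'.position_eq hf' hd')

end Flags

/-- The function `t` labels each dart by a family of points, compatibly with the involutions `g i`: if
`t d` belongs to the flag at the start of `d`, then `g i` describes the change to the `i`-adjacent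
flag. -/
structure IsLabelling (L : List (List ℕ)) {Ω κ : Type*} (g : Fin 3 → Equiv.Perm Ω)
    (t : ℕ × ℕ → κ → Ω) : Prop where
  gen_gen : ∀ i x, g i (g i x) = x
  rot : ∀ f ∈ L, ∀ u v w, (u, v) ∈ darts f → (v, w) ∈ darts f →
    ∀ k, t (v, w) k = g 1 (g 0 (t (u, v) k))
  swap : ∀ u v, (u, v) ∈ L.flatMap darts → ∀ k, t (v, u) k = g 2 (g 0 (t (u, v) k))

section Labelling

variable {Ω κ : Type*} {g : Fin 3 → Equiv.Perm Ω} {t : ℕ × ℕ → κ → Ω}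

/-- The family of points that belongs to a flag. -/
noncomputable def flagLabel (hL : IsPolyhedralMap L sym) (g : Fin 3 → Equiv.Perm Ω)
    (t : ℕ × ℕ → κ → Ω) (Φ : Flag (FaceLattice L)) (k : κ) : Ω :=
  if (position hL Φ).2 then g 0 (t (position hL Φ).1 k) else t (position hL Φ).1 k

theorem IsAt.flagLabel_eq {hL : IsPolyhedralMap L sym} {Φ : Flag (FaceLattice L)} {f : List ℕ}
    {d : ℕ × ℕ} {b : Bool} (h : IsAt hL Φ f d b) (hf : f ∈ L) (hd : d ∈ darts f) (k : κ) :
    flagLabel hL g t Φ k = if b then g 0 (t d k) else t d k := by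
  rw [flagLabel, h.position_eq hf hd]

/-- `rot` and `swap` describe steps from the end of a dart to the start of another one; the opposite
steps follow because the generators are involutions. -/
theorem flagLabel_adj (hL : IsPolyhedralMap L sym) (ht : IsLabelling L g t) (i : Fin 3)
    (Φ : Flag (FaceLattice L)) (k : κ) :
    flagLabel hL g t ((isPolytope hL).adj i Φ) k = g i (flagLabel hL g t Φ k) := by
  obtain ⟨f, hf, hd, h⟩ := exists_isAt_position hL Φ
  rw [h.flagLabel_eq hf hd]
  generalize (position hL Φ).2 = b at h ⊢
  generalize ((position hL Φ).1 : ℕ × ℕ) = d at h hd ⊢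
  obtain ⟨u, v⟩ := d
  fin_cases i
  · refine ((h.adj_zero hf hd).flagLabel_eq hf hd k).trans ?_
    cases b
    · rfl
    · exact (ht.gen_gen 0 _).symm
  · obtain ⟨⟨u', v'⟩, hd', h', he⟩ := h.adj_one hf hd
    refine (h'.flagLabel_eq hf hd' k).trans ?_
    cases b
    · obtain rfl : u = v' := he
      change g 0 (t (u', u) k) = g 1 (t (u, v) k)
      rw [ht.rot f hf _ _ _ hd' hd, ht.gen_gen]
    · obtain rfl : v = u' := he
      exact ht.rot f hf _ _ _ hd hd' k
  · obtain ⟨f', hf', hd', h'⟩ := h.adj_two hf hd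
    refine (h'.flagLabel_eq hf' hd' k).trans ?_
    cases b
    · change g 0 (t (v, u) k) = g 2 (t (u, v) k)
      rw [ht.swap v u (List.mem_flatMap.2 ⟨f', hf', hd'⟩), ht.gen_gen]
    · exact ht.swap u v (List.mem_flatMap.2 ⟨f, hf, hd⟩) k

end Labelling

end FaceLattice

namespace IsPolytope

variable {P : Type*} [PartialOrder P] {Ω κ : Type*} {g : Fin 3 → Equiv.Perm Ω}
  {τ : Flag P → κ → Ω}

/-- The group generated by the pairs of corresponding generators. -/
def pairGroup (h : IsPolytope 3 P) (g : Fin 3 → Equiv.Perm Ω) :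
    Subgroup (Equiv.Perm (Flag P) × Equiv.Perm Ω) :=
  Subgroup.closure (Set.range fun i => (h.adjPerm i, g i))

theorem map_of_mem_pairGroup (h : IsPolytope 3 P)
    (hτ : ∀ i Φ k, τ (h.adj i Φ) k = g i (τ Φ k)) {a : Equiv.Perm (Flag P) × Equiv.Perm Ω}
    (ha : a ∈ h.pairGroup g) : ∀ Φ k, τ (a.1 Φ) k = a.2 (τ Φ k) := by
  induction ha using Subgroup.closure_induction with
  | mem a ha =>
    obtain ⟨i, rfl⟩ := ha
    exact hτ i
  | one => exact fun _ _ => rfl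
  | mul a b _ _ ha hb => exact fun Φ k => (ha _ k).trans (congrArg a.2 (hb Φ k))
  | inv a _ ha =>
    intro Φ k
    have := ha (a.1⁻¹ Φ) k
    rw [show a.1 (a.1⁻¹ Φ) = Φ from a.1.apply_symm_apply Φ] at this
    exact (Equiv.Perm.inv_eq_iff_eq.2 this).symm

theorem exists_mem_pairGroup (h : IsPolytope 3 P) (g : Fin 3 → Equiv.Perm Ω) (Φ Ψ : Flag P) :
    ∃ a ∈ h.pairGroup g, a.1 Φ = Ψ := by
  have := h.linked_univ Φ Ψ
  induction this with
  | refl => exact ⟨1, one_mem _, rfl⟩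
  | tail _ hs ih =>
    obtain ⟨a, ha, rfl⟩ := ih
    obtain ⟨i, -, rfl⟩ := hs
    exact ⟨(h.adjPerm i, g i) * a, mul_mem (Subgroup.subset_closure ⟨i, rfl⟩) ha, rfl⟩

variable (h : IsPolytope 3 P) (hτ : ∀ i Φ k, τ (h.adj i Φ) k = g i (τ Φ k)) {Φ₀ : Flag P}
  (hbase : ∀ Φ, τ Φ = τ Φ₀ → Φ = Φ₀) (hsurj : ∀ x, ∃ Φ k, τ Φ k = x)

-- If the permutation of the flags is trivial, its companion fixes every point that occurs in a
-- label, that is, every point.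
include hτ hsurj in
theorem injective_fst_pairGroup :
    Function.Injective ((MonoidHom.fst _ _).comp (h.pairGroup g).subtype) := by
  rw [injective_iff_map_eq_one]
  rintro ⟨⟨a, b⟩, hab⟩ (rfl : a = 1)
  refine Subtype.ext (Prod.ext rfl (Equiv.ext fun x => ?_))
  obtain ⟨Φ, k, rfl⟩ := hsurj x
  exact (h.map_of_mem_pairGroup hτ hab Φ k).symm

-- If the permutation of the points is trivial, `a Φ` and `Φ` have the same label. A group element
-- that carries `Φ` to `Φ₀` then carries `a Φ` to a flag with the label of `Φ₀`, hence to `Φ₀` as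
-- well. Because of transitivity it is enough that the labels single out one flag.
include hτ hbase in
theorem injective_snd_pairGroup :
    Function.Injective ((MonoidHom.snd _ _).comp (h.pairGroup g).subtype) := by
  rw [injective_iff_map_eq_one]
  rintro ⟨⟨a, b⟩, hab⟩ (rfl : b = 1)
  refine Subtype.ext (Prod.ext (Equiv.ext fun Φ => ?_) rfl)
  obtain ⟨c, hc, hcΦ⟩ := h.exists_mem_pairGroup g Φ Φ₀
  have h1 : τ (a Φ) = τ Φ := funext fun k => h.map_of_mem_pairGroup hτ hab Φ k
  have h2 : c.1 (a Φ) = Φ₀ := hbase _ <| funext fun k => by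
    rw [h.map_of_mem_pairGroup hτ hc, h1, ← h.map_of_mem_pairGroup hτ hc, hcΦ]
  exact c.1.injective (h2.trans hcΦ.symm)

-- Both groups are isomorphic to `pairGroup`, whose two projections are injective; passing to the
-- opposite group does not change the order.
include hτ hbase hsurj in
theorem card_monodromy : Nat.card h.monodromy = Nat.card (Subgroup.closure (Set.range g)) := by
  have h1 : Nat.card h.monodromy = Nat.card (Subgroup.closure (Set.range h.adjPerm)) := by
    have : h.monodromy = (Subgroup.closure (Set.range h.adjPerm)).op := by
      rw [Subgroup.op_closure, monodromy]
      congr 1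
      ext x
      simp only [Set.mem_range]
      exact ⟨fun ⟨i, hi⟩ => ⟨i, hi ▸ rfl⟩, fun ⟨i, hi⟩ => ⟨i, hi ▸ rfl⟩⟩
    rw [this]
    exact Nat.card_congr (Subgroup.equivOp _).symm
  have hfst : (h.pairGroup g).map (MonoidHom.fst _ _) = Subgroup.closure (Set.range h.adjPerm) := by
    rw [pairGroup, MonoidHom.map_closure, ← Set.range_comp]
    rfl
  have hsnd : (h.pairGroup g).map (MonoidHom.snd _ _) = Subgroup.closure (Set.range g) := by
    rw [pairGroup, MonoidHom.map_closure, ← Set.range_comp]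
    rfl
  have e1 := Nat.card_range_of_injective (h.injective_fst_pairGroup hτ hsurj)
  have e2 := Nat.card_range_of_injective (h.injective_snd_pairGroup hτ hbase)
  rw [← MonoidHom.coe_range, MonoidHom.range_comp, Subgroup.range_subtype] at e1 e2
  rw [h1, ← hfst, ← hsnd]
  exact e1.trans e2.symm

-- The factors change places because the monodromy group is multiplied from left to right and
-- permutations from right to left.
include hτ hbase hsurj in
theorem orderOf_monodromyGen_mul (i j : Fin 3) :
    orderOf (h.monodromyGen i * h.monodromyGen j) = orderOf (g j * g i) := by
  let p : Fin 3 → h.pairGroup g := fun i => ⟨(h.adjPerm i, g i), Subgroup.subset_closure ⟨i, rfl⟩⟩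
  have h1 := orderOf_injective _ (h.injective_fst_pairGroup hτ hsurj) (p j * p i)
  have h2 := orderOf_injective _ (h.injective_snd_pairGroup hτ hbase) (p j * p i)
  have h3 : orderOf (h.monodromyGen i * h.monodromyGen j) =
      orderOf (MulOpposite.op (h.adjPerm j * h.adjPerm i)) :=
    (orderOf_injective h.monodromy.subtype Subtype.val_injective _).symm
  have h4 : orderOf (MulOpposite.op (h.adjPerm j * h.adjPerm i)) =
      orderOf (h.adjPerm j * h.adjPerm i) :=
    orderOf_eq_orderOf_iff.2 fun n => by rw [← MulOpposite.op_pow, MulOpposite.op_eq_one_iff]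
  rw [h3, h4]
  exact h1.trans h2.symm

end IsPolytope

end ArchPoly

/-! ### Evaluable tests for polyhedral maps -/

namespace ArchPoly

variable {α : Type*}

/-- In these recursions `Bool.rec a b c` is `b` if `c` holds and `a` otherwise, so evaluation can
stop at the first element that decides the answer. -/
def allB (l : List α) (p : α → Bool) : Bool := List.rec true (fun x _ r => Bool.rec false r (p x)) l

def anyB (l : List α) (p : α → Bool) : Bool := List.rec false (fun x _ r => Bool.rec r true (p x)) l

def allBelow (n : ℕ) (p : ℕ → Bool) : Bool := Nat.rec true (fun k r => Bool.rec false r (p k)) n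

def anyBelow (n : ℕ) (p : ℕ → Bool) : Bool := Nat.rec false (fun k r => Bool.rec r true (p k)) n

def memB (v : ℕ) (l : List ℕ) : Bool := anyB l (Nat.beq v)

def subsetB (l m : List ℕ) : Bool := allB l fun v => memB v m

def nodupB (l : List ℕ) : Bool := List.rec true (fun v l r => Bool.rec r false (memB v l)) l

def eqB (l : List ℕ) : List ℕ → Bool :=
  List.rec (fun m => List.rec true (fun _ _ _ => false) m)
    (fun u _ r m => List.rec false (fun v m _ => Bool.rec false (r m) (Nat.beq u v)) m) l

def filterB (l : List α) (p : α → Bool) : (List α → Bool) → Bool :=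
  List.rec (fun k => k []) (fun x _ r k => r fun t => Bool.rec (k t) (k (x :: t)) (p x)) l

/-- Passes the list of pairs of cyclically consecutive elements of `l` to `k`. -/
def cyclicPairs (l : List α) (k : List (α × α) → Bool) : Bool :=
  List.rec (k []) (fun a l _ => List.rec (motive := fun _ => α → (List (α × α) → Bool) → Bool)
    (fun x k => k [(x, a)]) (fun y _ r x k => r y fun t => k ((x, y) :: t)) l a k) l

def insertB (a : α) (l : List α) : (List α → Bool) → Bool :=
  List.rec (fun k => k [a])
    (fun b p r k => Bool.rec (r fun q => k (b :: q)) true (k (a :: b :: p))) l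

/-- Searches for a permutation of `l` that satisfies `k`. -/
def permB (l : List α) : (List α → Bool) → Bool :=
  List.rec (fun k => k []) (fun a _ r k => r fun p => insertB a p k) l

theorem boolRec_false_eq_true {a b : Bool} :
    (Bool.rec false b a : Bool) = true ↔ a = true ∧ b = true := by
  cases a <;> simp

theorem boolRec_true_eq_true {a b : Bool} :
    (Bool.rec b true a : Bool) = true ↔ a = true ∨ b = true := by
  cases a <;> simp

theorem boolRec_not_eq_true {a b : Bool} :
    (Bool.rec b false a : Bool) = true ↔ ¬ a = true ∧ b = true := by
  cases a <;> simp

theorem allB_eq_true {l : List α} {p : α → Bool} : allB l p = true ↔ ∀ x ∈ l, p x = true := by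
  induction l with
  | nil => simp [allB]
  | cons x l ih =>
    rw [List.forall_mem_cons, ← ih]
    exact boolRec_false_eq_true

theorem anyB_eq_true {l : List α} {p : α → Bool} : anyB l p = true ↔ ∃ x ∈ l, p x = true := by
  induction l with
  | nil => simp [anyB]
  | cons x l ih =>
    rw [List.exists_mem_cons_iff, ← ih]
    exact boolRec_true_eq_true

theorem allBelow_eq_true {n : ℕ} {p : ℕ → Bool} :
    allBelow n p = true ↔ ∀ k < n, p k = true := by
  induction n with
  | zero => simp [allBelow]
  | succ n ih =>
    rw [Nat.forall_lt_succ_right, ← ih, and_comm]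
    exact boolRec_false_eq_true

theorem anyBelow_eq_true {n : ℕ} {p : ℕ → Bool} :
    anyBelow n p = true ↔ ∃ k < n, p k = true := by
  induction n with
  | zero => simp [anyBelow]
  | succ n ih =>
    rw [Nat.exists_lt_succ_right, ← ih, or_comm]
    exact boolRec_true_eq_true

theorem natBeq_eq_true {m n : ℕ} : Nat.beq m n = true ↔ m = n :=
  ⟨Nat.eq_of_beq_eq_true, fun h => h ▸ Nat.beq_refl m⟩

theorem natBlt_eq_true {m n : ℕ} : Nat.blt m n = true ↔ m < n :=
  ⟨Nat.le_of_ble_eq_true, Nat.ble_eq_true_of_le⟩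

theorem memB_eq_true {v : ℕ} {l : List ℕ} : memB v l = true ↔ v ∈ l := by
  simp [memB, anyB_eq_true]

theorem subsetB_eq_true {l m : List ℕ} : subsetB l m = true ↔ l ⊆ m := by
  simp only [subsetB, allB_eq_true, memB_eq_true]
  rfl

theorem nodupB_eq_true {l : List ℕ} : nodupB l = true ↔ l.Nodup := by
  induction l with
  | nil => simp [nodupB]
  | cons v l ih =>
    rw [List.nodup_cons, ← ih, ← memB_eq_true]
    exact boolRec_not_eq_true

theorem eq_of_eqB {l m : List ℕ} (h : eqB l m = true) : l = m := by
  induction l generalizing m with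
  | nil =>
    cases m with
    | nil => rfl
    | cons v m => exact absurd h Bool.false_ne_true
  | cons u l ih =>
    cases m with
    | nil => exact absurd h Bool.false_ne_true
    | cons v m =>
      obtain ⟨h1, h2⟩ := boolRec_false_eq_true.1 h
      rw [natBeq_eq_true.1 h1, ih h2]

theorem filterB_eq {l : List α} {p : α → Bool} {k : List α → Bool} :
    filterB l p k = k (l.filter p) := by
  induction l generalizing k with
  | nil => rfl
  | cons x l ih =>
    change filterB l p (fun t => Bool.rec (k t) (k (x :: t)) (p x)) = _
    rw [ih]
    rw [List.filter_cons]
    cases p x <;> rfl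

theorem cyclicPairs_eq {l : List α} {k : List (α × α) → Bool} :
    cyclicPairs l k = k (l.zip (l.rotate 1)) := by
  cases l with
  | nil => rfl
  | cons a l =>
    rw [List.rotate_cons_succ, List.rotate_zero]
    change List.rec (motive := fun _ => α → (List (α × α) → Bool) → Bool)
      (fun x k => k [(x, a)]) (fun y _ r x k => r y fun t => k ((x, y) :: t)) l a k = _
    suffices H : ∀ (l : List α) (x : α) (k : List (α × α) → Bool),
        List.rec (motive := fun _ => α → (List (α × α) → Bool) → Bool)
          (fun x k => k [(x, a)]) (fun y _ r x k => r y fun t => k ((x, y) :: t)) l x k =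
        k ((x :: l).zip (l ++ [a])) from H l a k
    intro l
    induction l with
    | nil => exact fun _ _ => rfl
    | cons y l ih => exact fun x k => ih y fun t => k ((x, y) :: t)

theorem exists_of_insertB {a : α} {l : List α} {k : List α → Bool} (h : insertB a l k = true) :
    ∃ p : List α, p.Perm (a :: l) ∧ k p = true := by
  induction l generalizing k with
  | nil => exact ⟨[a], List.Perm.refl _, h⟩
  | cons b l ih =>
    rcases boolRec_true_eq_true.1 h with h | h
    · exact ⟨_, List.Perm.refl _, h⟩
    · obtain ⟨p, hp, hk⟩ := ih h
      exact ⟨b :: p, (hp.cons b).trans (List.Perm.swap a b l), hk⟩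

theorem exists_of_permB {l : List α} {k : List α → Bool} (h : permB l k = true) :
    ∃ p : List α, p.Perm l ∧ k p = true := by
  induction l generalizing k with
  | nil => exact ⟨[], List.Perm.refl _, h⟩
  | cons a l ih =>
    obtain ⟨p, hp, hk⟩ := ih h
    obtain ⟨q, hq, hk⟩ := exists_of_insertB hk
    exact ⟨q, hq.trans (hp.cons a), hk⟩

/-- A face with its darts and its number of sides. -/
abbrev FaceData := List ℕ × List (ℕ × ℕ) × ℕ

def faceData (f : List ℕ) : FaceData := (f, darts f, f.length)

def faceDataB (L : List (List ℕ)) : (List FaceData → Bool) → Bool :=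
  List.rec (fun k => k []) (fun f _ r k => cyclicPairs f fun ds =>
    force (List.rec 0 (fun _ _ n => Nat.add n 1) f) fun n => r fun t => k ((f, ds, n) :: t)) L

def memDartB (u v : ℕ) (l : List (ℕ × ℕ)) : Bool :=
  anyB l fun d => Bool.rec false (Nat.beq v d.2) (Nat.beq u d.1)

def lengthsB (l : List FaceData) : List ℕ → Bool :=
  List.rec (fun m => List.rec true (fun _ _ _ => false) m)
    (fun f _ r m => List.rec false (fun n m _ => Bool.rec false (r m) (Nat.beq f.2.2 n)) m) l

/-- The faces `p.1` and `p.2` share an edge at `v`. -/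
def shareB (v : ℕ) (p : FaceData × FaceData) : Bool :=
  anyB p.1.2.1 fun d => (Nat.beq d.1 v && memB d.2 p.2.1) || (Nat.beq d.2 v && memB d.1 p.2.1)

/-- The conditions on a polyhedral map that concern the faces at `v`. -/
def checkVertex (sym : List ℕ) (F : List FaceData) (v : ℕ) : Bool :=
  filterB F (fun f => memB v f.1) fun F =>
    (permB F fun p => lengthsB p sym && cyclicPairs p fun l => allB l (shareB v)) &&
    (List.rec true (fun f F r => (allB F fun g => allB f.2.1 fun d =>
      !(Nat.beq d.1 v && memDartB d.1 d.2 g.2.1)) && r) F : Bool) &&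
    allB F fun f => allB F fun g => allB g.2.1 fun d =>
      !(Nat.beq d.1 v && memB d.2 f.1) || memDartB d.1 d.2 f.2.1 || memDartB d.2 d.1 f.2.1

def insertVertices (f : List ℕ) : List ℕ → (List ℕ → Bool) → Bool :=
  List.rec (fun R k => k R) (fun v _ r R k => Bool.rec (r (v :: R) k) (r R k) (memB v R)) f

/-- Adds to `R` the vertices of all faces in the list that meet `R`; the other faces are put into
`q`. -/
def growOnce (L : List (List ℕ)) : List ℕ → List (List ℕ) →
    (List ℕ → List (List ℕ) → Bool) → Bool :=
  List.rec (fun R q k => k R q)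
    (fun f _ r R q k => Bool.rec (r R (f :: q) k) (insertVertices f R fun R => r R q k)
      (anyB f fun v => memB v R)) L

/-- Finds the vertices that are connected to `R`; fails if there are others. -/
def grow (n : ℕ) : List ℕ → List (List ℕ) → (List ℕ → Bool) → Bool :=
  Nat.rec (fun R q k => List.rec (k R) (fun _ _ _ => false) q)
    (fun _ r R q k => growOnce q R [] fun R q => r R q k) n

/-- The number 20 bounds the rounds of the connectivity search, which fails if faces are left over;
the vertices it has found are then tested one by one. Reversibility of the darts is not tested here,
since the test of the labels implies it. -/
def checkMap (L : List (List ℕ)) (sym : List ℕ) : Bool :=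
  faceDataB L fun F =>
    (allB F fun f => nodupB f.1 && Nat.ble 3 f.2.2 && (anyB F fun g => !subsetB g.1 f.1) &&
      allB F fun g => !subsetB f.1 g.1 || eqB f.1 g.1) &&
    (List.rec false (fun f _ _ => List.rec false (fun u _ _ =>
      grow 20 [u] L fun R => allB R (checkVertex sym F)) f) L : Bool)

theorem faceDataB_eq {L : List (List ℕ)} {k : List FaceData → Bool} :
    faceDataB L k = k (L.map faceData) := by
  have hlen : ∀ f : List ℕ, (List.rec 0 (fun _ _ n => Nat.add n 1) f : ℕ) = f.length := by
    intro f
    induction f with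
    | nil => rfl
    | cons v f ih => exact congrArg (· + 1) ih
  induction L generalizing k with
  | nil => rfl
  | cons f L ih =>
    change cyclicPairs f (fun ds => force (List.rec 0 (fun _ _ n => Nat.add n 1) f : ℕ)
      fun n => faceDataB L fun t => k ((f, ds, n) :: t)) = _
    rw [cyclicPairs_eq, force_eq, hlen, ih]
    rfl

theorem memDartB_eq_true {u v : ℕ} {l : List (ℕ × ℕ)} :
    memDartB u v l = true ↔ (u, v) ∈ l := by
  simp only [memDartB, anyB_eq_true, boolRec_false_eq_true, natBeq_eq_true]
  constructor
  · rintro ⟨d, hd, rfl, rfl⟩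
    exact hd
  · exact fun h => ⟨_, h, rfl, rfl⟩

theorem eq_of_lengthsB {l : List FaceData} {m : List ℕ} (h : lengthsB l m = true) :
    l.map (fun f => f.2.2) = m := by
  induction l generalizing m with
  | nil =>
    cases m with
    | nil => rfl
    | cons v m => exact absurd h Bool.false_ne_true
  | cons u l ih =>
    cases m with
    | nil => exact absurd h Bool.false_ne_true
    | cons v m =>
      obtain ⟨h1, h2⟩ := boolRec_false_eq_true.1 h
      rw [List.map_cons, natBeq_eq_true.1 h1, ih h2]

theorem exists_of_insertVertices {f R : List ℕ} {k : List ℕ → Bool}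
    (h : insertVertices f R k = true) :
    ∃ R', (∀ v, v ∈ R' ↔ v ∈ f ∨ v ∈ R) ∧ k R' = true := by
  induction f generalizing R with
  | nil => exact ⟨R, by simp, h⟩
  | cons u f ih =>
    change (Bool.rec (insertVertices f (u :: R) k) (insertVertices f R k) (memB u R) : Bool) = true
      at h
    cases hu : memB u R with
    | true =>
      rw [hu] at h
      obtain ⟨R', hR', hk⟩ := ih h
      have := memB_eq_true.1 hu
      refine ⟨R', fun v => ?_, hk⟩
      rw [hR', List.mem_cons]
      constructor
      · rintro (h | h)
        · exact Or.inl (Or.inr h)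
        · exact Or.inr h
      · rintro ((rfl | h) | h)
        · exact Or.inr this
        · exact Or.inl h
        · exact Or.inr h
    | false =>
      rw [hu] at h
      obtain ⟨R', hR', hk⟩ := ih h
      refine ⟨R', fun v => ?_, hk⟩
      rw [hR', List.mem_cons, List.mem_cons]
      tauto

section Grow

variable {L : List (List ℕ)} {u : ℕ}

/-- All elements of `R` are vertices connected to `u`, and every face has its vertices in `R` or
belongs to `q`. -/
structure IsGrown (L : List (List ℕ)) (u : ℕ) (R : List ℕ) (q : List (List ℕ)) : Prop where
  mem : ∀ v ∈ R, v ∈ L.flatten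
  conn : ∀ v ∈ R, Relation.ReflTransGen (fun v w => ∃ f ∈ L, v ∈ f ∧ w ∈ f) u v
  sub : q ⊆ L
  cover : ∀ f ∈ L, f ⊆ R ∨ f ∈ q

/-- The invariant holds for the unprocessed faces `p` and the deferred faces `q` together. A face
that meets `R` is absorbed: the common vertex connects all its vertices to `u`. -/
theorem IsGrown.of_growOnce {p : List (List ℕ)} {R : List ℕ} {q : List (List ℕ)}
    {k : List ℕ → List (List ℕ) → Bool} (hR : IsGrown L u R (p ++ q))
    (h : growOnce p R q k = true) : ∃ R' q', IsGrown L u R' q' ∧ k R' q' = true := by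
  induction p generalizing R q with
  | nil => exact ⟨R, q, hR, h⟩
  | cons f p ih =>
    change (Bool.rec (growOnce p R (f :: q) k) (insertVertices f R fun R => growOnce p R q k)
      (anyB f fun v => memB v R) : Bool) = true at h
    cases hf : anyB f fun v => memB v R with
    | false =>
      rw [hf] at h
      refine ih ⟨hR.mem, hR.conn, fun g hg => hR.sub ?_, fun g hg => ?_⟩ h
      · simp only [List.mem_append, List.mem_cons] at hg ⊢
        tauto
      · refine (hR.cover g hg).imp_right fun hg => ?_
        simp only [List.mem_append, List.mem_cons] at hg ⊢
        tauto
    | true =>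
      rw [hf] at h
      obtain ⟨w, hwf, hw⟩ := anyB_eq_true.1 hf
      obtain ⟨R', hR', hk⟩ := exists_of_insertVertices h
      have hfL : f ∈ L := hR.sub (by simp)
      refine ih ⟨fun v hv => ?_, fun v hv => ?_, fun g hg => hR.sub ?_, fun g hg => ?_⟩ hk
      · rcases (hR' v).1 hv with hv | hv
        · exact List.mem_flatten.2 ⟨f, hfL, hv⟩
        · exact hR.mem v hv
      · rcases (hR' v).1 hv with hv | hv
        · exact (hR.conn w (memB_eq_true.1 hw)).tail ⟨f, hfL, hwf, hv⟩
        · exact hR.conn v hv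
      · simp only [List.mem_append, List.mem_cons] at hg ⊢
        tauto
      · rcases hR.cover g hg with h1 | h1
        · exact Or.inl fun v hv => (hR' v).2 (Or.inr (h1 hv))
        · simp only [List.cons_append, List.mem_cons] at h1
          rcases h1 with rfl | h1
          · exact Or.inl fun v hv => (hR' v).2 (Or.inl hv)
          · exact Or.inr h1

theorem IsGrown.of_grow {n : ℕ} {R : List ℕ} {q : List (List ℕ)} {k : List ℕ → Bool}
    (hR : IsGrown L u R q) (h : grow n R q k = true) : ∃ R', IsGrown L u R' [] ∧ k R' = true := by
  induction n generalizing R q with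
  | zero =>
    cases q with
    | nil => exact ⟨R, hR, h⟩
    | cons f q => exact absurd h Bool.false_ne_true
  | succ n ih =>
    obtain ⟨R', q', hR', hk⟩ := IsGrown.of_growOnce (p := q) (q := []) (by simpa using hR) h
    exact ih hR' hk

end Grow

theorem of_checkVertex {L : List (List ℕ)} {sym : List ℕ} {v : ℕ}
    (h : checkVertex sym (L.map faceData) v = true) :
    (∃ M : List (List ℕ), M.Perm (L.filter (v ∈ ·)) ∧ M.map List.length = sym ∧
      ∀ p ∈ M.zip (M.rotate 1), ∃ d ∈ darts p.1,
        (d.1 = v ∧ d.2 ∈ p.2) ∨ (d.2 = v ∧ d.1 ∈ p.2)) ∧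
    ((L.filter (v ∈ ·)).Pairwise fun f g => ∀ d ∈ darts f, d.1 = v → d ∉ darts g) ∧
    ∀ f ∈ L, v ∈ f → ∀ g ∈ L, v ∈ g → ∀ d ∈ darts g, d.1 = v → d.2 ∈ f →
      d ∈ darts f ∨ (d.2, d.1) ∈ darts f := by
  have hfilter : (L.map faceData).filter (fun f => memB v f.1) =
      (L.filter (v ∈ ·)).map faceData := by
    rw [List.filter_map]
    congr 2
    funext f
    rw [Bool.eq_iff_iff]
    simp [faceData, memB_eq_true]
  rw [checkVertex, filterB_eq, hfilter, Bool.and_eq_true, Bool.and_eq_true] at h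
  obtain ⟨⟨h1, h2⟩, h3⟩ := h
  refine ⟨?_, ?_, ?_⟩
  · obtain ⟨p, hp, hk⟩ := exists_of_permB h1
    -- The permuted data belong to a list of faces, recovered from the first components.
    have hpM : p = (p.map Prod.fst).map faceData := by
      rw [List.map_map]
      refine (List.map_id p).symm.trans (List.map_congr_left fun x hx => ?_)
      obtain ⟨f, -, rfl⟩ := List.mem_map.1 (hp.mem_iff.1 hx)
      rfl
    have hM := hp.map Prod.fst
    rw [List.map_map, show Prod.fst ∘ faceData = id from rfl, List.map_id] at hM
    generalize p.map Prod.fst = M at hpM hM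
    subst hpM
    rw [cyclicPairs_eq, Bool.and_eq_true, ← List.map_rotate, List.zip_map, allB_eq_true] at hk
    refine ⟨M, hM, ?_, fun q hq => ?_⟩
    · rw [← eq_of_lengthsB hk.1, List.map_map]
      rfl
    · have := hk.2 _ (List.mem_map_of_mem hq)
      simp only [shareB, anyB_eq_true, Bool.or_eq_true, Bool.and_eq_true, natBeq_eq_true,
        memB_eq_true] at this
      exact this
  · clear h1 h3 hfilter
    generalize L.filter (v ∈ ·) = F at h2 ⊢
    induction F with
    | nil => exact List.Pairwise.nil
    | cons f F ih =>
      rw [List.map_cons] at h2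
      obtain ⟨h3, h4⟩ := Bool.and_eq_true_iff.1 h2
      refine List.Pairwise.cons (fun g hg d hd hdv hdg => ?_) (ih h4)
      have := allB_eq_true.1 (allB_eq_true.1 h3 _ (List.mem_map_of_mem hg)) d hd
      rw [Bool.not_eq_true', ← Bool.not_eq_true, Bool.and_eq_true, natBeq_eq_true,
        memDartB_eq_true] at this
      exact this ⟨hdv, hdg⟩
  · intro f hf hvf g hg hvg d hd hdv hdf
    have hmem : ∀ {f}, f ∈ L → v ∈ f → faceData f ∈ (L.filter (v ∈ ·)).map faceData :=
      fun hf hv => List.mem_map_of_mem (List.mem_filter.2 ⟨hf, by simpa using hv⟩)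
    have := allB_eq_true.1 (allB_eq_true.1 (allB_eq_true.1 h3 _ (hmem hf hvf)) _ (hmem hg hvg)) d hd
    simp only [Bool.or_eq_true, Bool.not_eq_true', ← Bool.not_eq_true, Bool.and_eq_true,
      natBeq_eq_true, memB_eq_true, memDartB_eq_true] at this
    rcases this with (h | h) | h
    · exact absurd ⟨hdv, hdf⟩ h
    · exact Or.inl h
    · exact Or.inr h

/-- The conditions on darts are tested only among the faces around the start of a dart. This
suffices: faces with a common dart both contain its start, and a chord of `f` starts at a vertex of
`f`. -/
theorem isPolyhedralMap_of_checkMap {L : List (List ℕ)} {sym : List ℕ}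
    (h : checkMap L sym = true)
    (hswap : ∀ d ∈ L.flatMap darts, (d.2, d.1) ∈ L.flatMap darts) : IsPolyhedralMap L sym := by
  rw [checkMap, faceDataB_eq, Bool.and_eq_true, allB_eq_true] at h
  obtain ⟨h1, h2⟩ := h
  simp only [faceData, Bool.and_eq_true, Bool.or_eq_true, Bool.not_eq_true',
    ← Bool.not_eq_true, nodupB_eq_true, allB_eq_true, anyB_eq_true, subsetB_eq_true, List.mem_map, exists_exists_and_eq_and,
    forall_exists_index, and_imp, forall_apply_eq_imp_iff₂] at h1
  have hu : ∃ u ∈ L.flatten, ∃ R, IsGrown L u R [] ∧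
      ∀ v ∈ R, checkVertex sym (L.map faceData) v = true := by
    cases L with
    | nil => exact absurd h2 Bool.false_ne_true
    | cons f L =>
      cases f with
      | nil => exact absurd h2 Bool.false_ne_true
      | cons u f =>
        have hu : u ∈ ((u :: f) :: L).flatten := by simp
        obtain ⟨R, hR, hk⟩ := IsGrown.of_grow (L := (u :: f) :: L) (u := u)
          ⟨by simp, by simp [Relation.ReflTransGen.refl], List.Subset.refl _,
            fun f hf => Or.inr hf⟩ h2
        exact ⟨u, hu, R, hR, allB_eq_true.1 hk⟩
  obtain ⟨u, huL, R, hR, hv⟩ := hu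
  have hmemR : ∀ v ∈ L.flatten, v ∈ R := by
    intro v hv
    obtain ⟨f, hf, hvf⟩ := List.mem_flatten.1 hv
    exact (hR.cover f hf).resolve_right (by simp) hvf
  have hvertex := fun v hvL => of_checkVertex (hv v (hmemR v hvL))
  refine ⟨fun f hf => (h1 f hf).1.1.1, fun f hf => Nat.le_of_ble_eq_true (h1 f hf).1.1.2, ?_, hswap,
    fun f hf g hg hfg => eq_of_eqB (((h1 f hf).2 g hg).resolve_left (not_not_intro hfg)),
    fun f hf => (h1 f hf).1.2, ?_, fun v hv => (hvertex v hv).1, u, huL,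
    fun v hv => hR.conn v (hmemR v hv)⟩
  · refine List.nodup_flatMap.2 ⟨fun f hf => ?_, List.pairwise_iff_forall_sublist.2 ?_⟩
    · refine List.Nodup.of_map Prod.fst ?_
      rw [darts, List.map_fst_zip (by simp)]
      exact (h1 f hf).1.1.1
    · intro f g hs d hdf hdg
      have hvf := fst_mem_of_mem_darts hdf
      have hvg := fst_mem_of_mem_darts hdg
      -- Two-element sublists represent pairs of positions in the list; this pair survives the
      -- filter at the start of the common dart.
      have h3 := hs.filter (d.1 ∈ ·)
      rw [List.filter_cons_of_pos (by simpa using hvf), List.filter_cons_of_pos (by simpa using hvg),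
        List.filter_nil] at h3
      exact List.pairwise_iff_forall_sublist.1 (hvertex d.1
        (List.mem_flatten.2 ⟨f, hs.subset (by simp), hvf⟩)).2.1 h3 d hdf rfl hdg
  · intro f hf d hd hdf1 hdf2
    obtain ⟨g, hg, hdg⟩ := List.mem_flatMap.1 hd
    exact (hvertex d.1 (FaceLattice.mem_flatten_of_mem_darts hd).1).2.2 f hf hdf1 g hg
      (fst_mem_of_mem_darts hdg) d hdg rfl hdf2

end ArchPoly

/-! ### Certificates: labels of darts, orders of products, order of the group -/

namespace ArchPoly

/-- The code of the tuple, or of the permutation, with code `c` followed by the permutations with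
codes `a` and `b`. -/
def mulCode (d a b c : ℕ) : ℕ := encode (fun x => codeApply b (codeApply a (codeApply c x))) d

/-- A labelled dart: the dart from the first to the second number, and the code of its label. -/
abbrev LabelledDart := ℕ × ℕ × ℕ

/-- Labels the darts in the list, the first one with `c`, and each other one with the image under
`step` of the label before it; fails if the image of the last label is not `s`. -/
def labelDarts (step : ℕ → ℕ) (s : ℕ) (l : List (ℕ × ℕ)) : ℕ → List LabelledDart →
    (List LabelledDart → Bool) → Bool :=
  List.rec (fun c t k => Bool.rec false (k t) (Nat.beq c s))
    (fun d _ r c t k => force (step c) fun c' => r c' ((d.1, d.2, c) :: t) k) l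

/-- Labels all darts; the label of the first dart of each face is given. -/
def labelFaces (step : ℕ → ℕ) (L : List (List ℕ × ℕ)) : List LabelledDart →
    (List LabelledDart → Bool) → Bool :=
  List.rec (fun t k => k t) (fun p _ r t k => cyclicPairs p.1 fun l =>
    labelDarts step p.2 l p.2 t fun t => r t k) L

def checkInvolution (d g : ℕ) : Bool :=
  allBelow d fun x => force (codeApply g x) fun y =>
    Bool.rec false (Nat.beq (codeApply g y) x) (Nat.blt y d)

def checkLabel (d m a b : ℕ) (t : List LabelledDart) (e : LabelledDart) : Bool :=
  (allBelow m fun k => Nat.blt (codeApply e.2.2 k) d) &&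
    force (mulCode m a b e.2.2) fun c => anyB t fun e' =>
      Bool.rec false (Bool.rec false (Nat.beq e'.2.2 c) (Nat.beq e'.2.1 e.1)) (Nat.beq e'.1 e.2.1)

/-- The disjunction separates the start of `e₀` from the starts of the other darts. The last
condition separates it from the ends of all darts, whose labels are the images under `a`. -/
def checkBase (m a : ℕ) (e₀ e : LabelledDart) : Bool :=
  ((Nat.beq e.1 e₀.1 && Nat.beq e.2.1 e₀.2.1) ||
      anyBelow m fun k => !Nat.beq (codeApply e.2.2 k) (codeApply e₀.2.2 k)) &&
    anyBelow m fun k => !Nat.beq (codeApply a (codeApply e.2.2 k)) (codeApply e₀.2.2 k)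

def checkSurjective (d m a : ℕ) (t : List LabelledDart) : Bool :=
  allBelow d fun x => anyB t fun e => anyBelow m fun k =>
    force (codeApply e.2.2 k) fun y => Nat.beq y x || Nat.beq (codeApply a y) x

/-- Whether the permutation with code `c` has order `n + 1` if `c'` is its power with exponent
`p - n`. -/
def checkPowers (d a b : ℕ) (n : ℕ) : ℕ → Bool :=
  Nat.rec (fun c => allBelow d fun x => Nat.beq (codeApply c x) x)
    (fun _ r c => Bool.rec false (force (mulCode d a b c) r)
      (anyBelow d fun x => !Nat.beq (codeApply c x) x)) n

def checkMulOrder (d a b p : ℕ) : Bool :=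
  Nat.rec false (fun n _ => force (mulCode d a b (encode (fun x => x) d)) (checkPowers d a b n)) p

/-- A certificate for the monodromy group of a polyhedron: the degree of a permutation
representation, the codes of the generators, the length of the labels, the labels of the first darts
of the faces, and the data for the order of the group. -/
structure Certificate where
  degree : ℕ
  gen₀ : ℕ
  gen₁ : ℕ
  gen₂ : ℕ
  width : ℕ
  seeds : List ℕ
  base : List (ℕ × List (ℕ × ℕ))

def checkLabels (C : Certificate) (L : List (List ℕ)) : Bool :=
  Nat.beq L.length C.seeds.length &&
  labelFaces (mulCode C.width C.gen₀ C.gen₁) (L.zip C.seeds) [] fun t =>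
    allB t (checkLabel C.degree C.width C.gen₀ C.gen₂ t) &&
    checkSurjective C.degree C.width C.gen₀ t &&
    (List.rec false (fun e₀ _ _ => allB t (checkBase C.width C.gen₀ e₀)) t : Bool)

def checkGroup (C : Certificate) (p q N : ℕ) : Bool :=
  Nat.blt 0 C.degree && Nat.ble C.degree 128 && checkInvolution C.degree C.gen₀ &&
    checkInvolution C.degree C.gen₁ && checkInvolution C.degree C.gen₂ &&
    checkMulOrder C.degree C.gen₀ C.gen₁ p && checkMulOrder C.degree C.gen₁ C.gen₂ q &&
    checkOrder C.degree [(C.gen₀, C.gen₀), (C.gen₁, C.gen₁), (C.gen₂, C.gen₂)] C.base N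

theorem codeApply_mulCode {d a b c x : ℕ} (hx : x < d) :
    codeApply (mulCode d a b c) x = codeApply b (codeApply a (codeApply c x)) :=
  codeApply_encode (fun _ => codeApply_lt _ _) hx

section Labels

variable {step : ℕ → ℕ}

theorem exists_of_labelDarts {s : ℕ} {l : List (ℕ × ℕ)} {c : ℕ} {t : List LabelledDart}
    {k : List LabelledDart → Bool} (h : labelDarts step s l c t k = true) :
    step^[l.length] c = s ∧ ∃ t', (∀ e : LabelledDart, e ∈ t' ↔ e ∈ t ∨
      ∃ (i : ℕ) (hi : i < l.length), l[i] = (e.1, e.2.1) ∧ step^[i] c = e.2.2) ∧ k t' = true := by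
  induction l generalizing c t with
  | nil =>
    obtain ⟨h1, h2⟩ := boolRec_false_eq_true.1 h
    exact ⟨natBeq_eq_true.1 h1, t, by simp, h2⟩
  | cons d l ih =>
    change force (step c) (fun c' => labelDarts step s l c' ((d.1, d.2, c) :: t) k) = true at h
    rw [force_eq] at h
    obtain ⟨h1, t', ht', hk⟩ := ih h
    refine ⟨h1, t', fun e => ?_, hk⟩
    rw [ht', List.mem_cons]
    constructor
    · rintro ((rfl | h2) | ⟨i, hi, h2, h3⟩)
      · exact Or.inr ⟨0, by simp, rfl, rfl⟩
      · exact Or.inl h2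
      · exact Or.inr ⟨i + 1, by simpa using hi, h2, h3⟩
    · rintro (h2 | ⟨i, hi, h2, h3⟩)
      · exact Or.inl (Or.inr h2)
      · cases i with
        | zero =>
          refine Or.inl (Or.inl ?_)
          obtain ⟨u, v, c'⟩ := e
          obtain rfl : c = c' := h3
          obtain rfl : d = (u, v) := h2
          rfl
        | succ i => exact Or.inr ⟨i, by simpa using hi, h2, h3⟩

/-- The dart `d` of a face in `L` has the label `c`. -/
def IsLabel (step : ℕ → ℕ) (L : List (List ℕ × ℕ)) (d : ℕ × ℕ) (c : ℕ) : Prop :=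
  ∃ p ∈ L, ∃ (i : ℕ) (hi : i < (darts p.1).length), (darts p.1)[i] = d ∧ step^[i] p.2 = c

theorem exists_of_labelFaces {L : List (List ℕ × ℕ)} {t : List LabelledDart}
    {k : List LabelledDart → Bool} (h : labelFaces step L t k = true) :
    (∀ p ∈ L, step^[(darts p.1).length] p.2 = p.2) ∧ ∃ t', (∀ e : LabelledDart, e ∈ t' ↔ e ∈ t ∨
      IsLabel step L (e.1, e.2.1) e.2.2) ∧ k t' = true := by
  induction L generalizing t with
  | nil => exact ⟨by simp, t, by simp [IsLabel], h⟩
  | cons p L ih =>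
    change (cyclicPairs p.1 fun l => labelDarts step p.2 l p.2 t fun t => labelFaces step L t k) =
      true at h
    rw [cyclicPairs_eq] at h
    obtain ⟨h1, t', ht', hk⟩ := exists_of_labelDarts h
    obtain ⟨h2, t'', ht'', hk⟩ := ih hk
    refine ⟨List.forall_mem_cons.2 ⟨h1, h2⟩, t'', fun e => ?_, hk⟩
    rw [ht'', ht', or_assoc]
    refine or_congr_right ?_
    rw [IsLabel, IsLabel, List.exists_mem_cons_iff]
    rfl

variable {L : List (List ℕ × ℕ)}

/-- Inside the list of darts of a face this is the construction of the labels; from the last dart to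
the first it is the closing condition `hcyc`. -/
theorem IsLabel.next (hL : ∀ p ∈ L, (p.1).Nodup)
    (hcyc : ∀ p ∈ L, step^[(darts p.1).length] p.2 = p.2)
    (huniq : ∀ d c c', IsLabel step L d c → IsLabel step L d c' → c = c')
    {p : List ℕ × ℕ} (hp : p ∈ L) {u v w : ℕ}
    (h1 : (u, v) ∈ darts p.1) (h2 : (v, w) ∈ darts p.1) {c : ℕ} (hc : IsLabel step L (u, v) c) :
    IsLabel step L (v, w) (step c) := by
  obtain ⟨i, hi, hui, hvi⟩ := mem_darts_iff.1 h1
  obtain ⟨j, hj, hvj, hwj⟩ := mem_darts_iff.1 h2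
  have hij := (hL p hp).getElem_inj_iff.1 (hvj.trans hvi.symm)
  have hci : step^[i] p.2 = c := huniq (u, v) _ _
    ⟨p, hp, i, by rwa [length_darts], by rw [getElem_darts]; exact Prod.ext hui hvi, rfl⟩ hc
  refine ⟨p, hp, j, by rwa [length_darts], by rw [getElem_darts]; exact Prod.ext hvj hwj, ?_⟩
  rw [← hci, ← Function.iterate_succ_apply' step]
  rcases Nat.lt_or_ge (i + 1) p.1.length with h | h
  · rw [hij, Nat.mod_eq_of_lt h]
  · have h3 : i + 1 = p.1.length := by omega
    rw [hij, h3, Nat.mod_self, Nat.succ_eq_add_one, h3, ← length_darts, hcyc p hp]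
    rfl

end Labels

section Group

variable {d : ℕ}

theorem exists_of_checkInvolution {c : ℕ} (h : checkInvolution d c = true) :
    ∃ π : Equiv.Perm (Fin d), IsCode c π ∧ ∀ x, π (π x) = x := by
  simp only [checkInvolution, allBelow_eq_true, force_eq, boolRec_false_eq_true, natBlt_eq_true,
    natBeq_eq_true] at h
  let f : Fin d → Fin d := fun x => ⟨codeApply c x, (h x x.2).1⟩
  have hf : Function.Involutive f := fun x => Fin.ext (h x x.2).2
  exact ⟨hf.toPerm, fun x => rfl, hf⟩

theorem IsCode.mulCode {a b c : ℕ} {α β γ : Equiv.Perm (Fin d)} (ha : IsCode a α) (hb : IsCode b β)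
    (hc : IsCode c γ) : IsCode (mulCode d a b c) (β * α * γ) := fun x => by
  rw [codeApply_mulCode x.2, hc, ha, hb]
  rfl

/-- From the exponent `j` on, `n` consecutive powers are found to move a point, and the next one is
trivial. With `j = 1` this says that the order is `n + 1`. -/
theorem pow_of_checkPowers {a b : ℕ} {α β : Equiv.Perm (Fin d)} (ha : IsCode a α)
    (hb : IsCode b β) {n : ℕ} {j c : ℕ} (hc : IsCode c ((β * α) ^ j))
    (h : checkPowers d a b n c = true) :
    (β * α) ^ (j + n) = 1 ∧ ∀ i < n, (β * α) ^ (j + i) ≠ 1 := by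
  induction n generalizing j c with
  | zero =>
    refine ⟨Equiv.ext fun x => Fin.ext ?_, by simp⟩
    exact (hc x).symm.trans (natBeq_eq_true.1 (allBelow_eq_true.1 h x x.2))
  | succ n ih =>
    obtain ⟨h1, h2⟩ := boolRec_false_eq_true.1 h
    rw [force_eq] at h2
    obtain ⟨h3, h4⟩ := ih (j := j + 1) (by rw [pow_succ']; exact ha.mulCode hb hc) h2
    refine ⟨by rw [← h3]; congr 1; omega, fun i hi => ?_⟩
    cases i with
    | zero =>
      obtain ⟨x, hx, hne⟩ := anyBelow_eq_true.1 h1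
      intro h5
      rw [Bool.not_eq_true', ← Bool.not_eq_true, natBeq_eq_true] at hne
      have := hc ⟨x, hx⟩
      rw [show (β * α) ^ j = 1 from h5] at this
      exact hne this
    | succ i =>
      rw [show j + (i + 1) = j + 1 + i by omega]
      exact h4 i (by omega)

theorem orderOf_of_checkMulOrder (hd : d ≤ 2 ^ 7) {a b p : ℕ} {α β : Equiv.Perm (Fin d)}
    (ha : IsCode a α) (hb : IsCode b β) (h : checkMulOrder d a b p = true) :
    orderOf (β * α) = p := by
  cases p with
  | zero => exact absurd h Bool.false_ne_true
  | succ n =>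
    change force _ _ = true at h
    rw [force_eq] at h
    obtain ⟨h1, h2⟩ := pow_of_checkPowers ha hb (j := 1)
      (by rw [pow_one, ← mul_one (β * α)]; exact ha.mulCode hb (isCode_one hd)) h
    rw [orderOf_eq_iff n.succ_pos]
    refine ⟨by rw [← h1]; congr 1; omega, fun m hm hm0 => ?_⟩
    obtain ⟨i, rfl⟩ : ∃ i, m = 1 + i := ⟨m - 1, by omega⟩
    exact h2 i (by omega)

theorem codeGroup_gens {g : Fin 3 → Equiv.Perm (Fin d)} {a b c : ℕ} (ha : IsCode a (g 0))
    (hb : IsCode b (g 1)) (hc : IsCode c (g 2)) :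
    codeGroup d [(a, a), (b, b), (c, c)] = Subgroup.closure (Set.range g) := by
  rw [codeGroup]
  congr 1
  ext π
  simp only [List.mem_cons, List.not_mem_nil, or_false, exists_eq_or_imp, exists_eq_left,
    Set.mem_ofPred_eq, Set.mem_range]
  constructor
  · rintro (h | h | h)
    · exact ⟨0, ha.eq h⟩
    · exact ⟨1, hb.eq h⟩
    · exact ⟨2, hc.eq h⟩
  · rintro ⟨i, rfl⟩
    fin_cases i
    · exact Or.inl ha
    · exact Or.inr (Or.inl hb)
    · exact Or.inr (Or.inr hc)

theorem exists_of_checkGroup {C : Certificate} {p q N : ℕ} (h : checkGroup C p q N = true) :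
    0 < C.degree ∧ ∃ g : Fin 3 → Equiv.Perm (Fin C.degree),
      IsCode C.gen₀ (g 0) ∧ IsCode C.gen₁ (g 1) ∧ IsCode C.gen₂ (g 2) ∧
      (∀ i x, g i (g i x) = x) ∧ orderOf (g 1 * g 0) = p ∧ orderOf (g 2 * g 1) = q ∧
      Nat.card (Subgroup.closure (Set.range g)) = N := by
  simp only [checkGroup, Bool.and_eq_true, natBlt_eq_true] at h
  obtain ⟨⟨⟨⟨⟨⟨⟨h1, h2⟩, h3⟩, h4⟩, h5⟩, h6⟩, h7⟩, h8⟩ := h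
  have hd : C.degree ≤ 2 ^ 7 := Nat.le_of_ble_eq_true h2
  obtain ⟨α, ha, hα⟩ := exists_of_checkInvolution h3
  obtain ⟨β, hb, hβ⟩ := exists_of_checkInvolution h4
  obtain ⟨γ, hc, hγ⟩ := exists_of_checkInvolution h5
  have hinv : ∀ {π : Equiv.Perm (Fin C.degree)}, (∀ x, π (π x) = x) → π⁻¹ = π := fun h =>
    inv_eq_of_mul_eq_one_left (Equiv.ext h)
  refine ⟨h1, ![α, β, γ], ha, hb, hc, fun i => ?_, orderOf_of_checkMulOrder hd ha hb h6,
    orderOf_of_checkMulOrder hd hb hc h7, ?_⟩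
  · fin_cases i
    · exact hα
    · exact hβ
    · exact hγ
  · rw [← codeGroup_gens (g := ![α, β, γ]) ha hb hc]
    refine card_codeGroup_of_checkOrder hd ?_ h8
    simp only [List.forall_mem_cons, List.not_mem_nil, false_imp_iff, implies_true, and_true]
    exact ⟨⟨α, trivial, ha, by rwa [hinv hα]⟩, ⟨β, trivial, hb, by rwa [hinv hβ]⟩,
      ⟨γ, trivial, hc, by rwa [hinv hγ]⟩⟩

end Group

/-- The permutations `g` and the labels `t` of the darts determine the monodromy group: the labels
distinguish the flag at the start of some dart from all other flags, and every point occurs in a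
label. -/
structure IsFaithfulLabelling (L : List (List ℕ)) {Ω κ : Type*} (g : Fin 3 → Equiv.Perm Ω)
    (t : ℕ × ℕ → κ → Ω) : Prop extends FaceLattice.IsLabelling L g t where
  base : ∃ d₀ ∈ L.flatMap darts, ∀ d ∈ L.flatMap darts,
    (t d = t d₀ → d = d₀) ∧ ∃ k, g 0 (t d k) ≠ t d₀ k
  surj : ∀ x, ∃ d ∈ L.flatMap darts, ∃ k, t d k = x ∨ g 0 (t d k) = x

theorem exists_of_checkLabels {C : Certificate} {L : List (List ℕ)} {sym : List ℕ}
    (hmap : checkMap L sym = true) (h : checkLabels C L = true) (hd : 0 < C.degree)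
    {g : Fin 3 → Equiv.Perm (Fin C.degree)} (h0 : IsCode C.gen₀ (g 0)) (h1 : IsCode C.gen₁ (g 1))
    (h2 : IsCode C.gen₂ (g 2)) (hg : ∀ i x, g i (g i x) = x) :
    IsPolyhedralMap L sym ∧
      ∃ t : ℕ × ℕ → Fin C.width → Fin C.degree, IsFaithfulLabelling L g t := by
  have : NeZero C.degree := ⟨hd.ne'⟩
  rw [checkLabels, Bool.and_eq_true, natBeq_eq_true] at h
  obtain ⟨hlen, h⟩ := h
  set step := mulCode C.width C.gen₀ C.gen₁ with hstep
  set LS := L.zip C.seeds with hLS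
  have hfst : LS.map Prod.fst = L := List.map_fst_zip hlen.le
  obtain ⟨hcyc, T, hT, h⟩ := exists_of_labelFaces h
  simp only [List.not_mem_nil, false_or] at hT
  rw [Bool.and_eq_true, Bool.and_eq_true, allB_eq_true] at h
  obtain ⟨⟨hlabel, hsurj⟩, hbase⟩ := h
  have hmemL : ∀ p ∈ LS, p.1 ∈ L := fun p hp => hfst ▸ List.mem_map_of_mem hp
  have hex : ∀ d ∈ L.flatMap darts, ∃ c, IsLabel step LS d c := by
    intro d hd
    obtain ⟨f, hf, hdf⟩ := List.mem_flatMap.1 hd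
    obtain ⟨p, hp, rfl⟩ := List.mem_map.1 (hfst.symm ▸ hf)
    obtain ⟨i, hi, hdi⟩ := List.mem_iff_getElem.1 hdf
    exact ⟨_, p, hp, i, hi, hdi, rfl⟩
  have hmem : ∀ {d c}, IsLabel step LS d c → d ∈ L.flatMap darts := by
    rintro d c ⟨p, hp, i, hi, rfl, -⟩
    exact List.mem_flatMap.2 ⟨p.1, hmemL p hp, List.getElem_mem hi⟩
  have hdigit : ∀ {d c}, IsLabel step LS d c → ∀ k < C.width, codeApply c k < C.degree := by
    intro d c hc k hk
    have := hlabel (d.1, d.2, c) ((hT _).2 hc)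
    rw [checkLabel, Bool.and_eq_true, allBelow_eq_true] at this
    exact natBlt_eq_true.1 (this.1 k hk)
  have hswap : ∀ {u v c}, IsLabel step LS (u, v) c →
      IsLabel step LS (v, u) (mulCode C.width C.gen₀ C.gen₂ c) := by
    intro u v c hc
    have := hlabel (u, v, c) ((hT _).2 hc)
    rw [checkLabel, Bool.and_eq_true, force_eq, anyB_eq_true] at this
    obtain ⟨e, he, h3⟩ := this.2
    simp only [boolRec_false_eq_true, natBeq_eq_true] at h3
    obtain ⟨h3, h4, h5⟩ := h3
    have := (hT e).1 he
    rwa [h3, h4, h5] at this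
  -- The label test finds the reversed dart of every dart, which is the condition that `checkMap`
  -- leaves out.
  have hL : IsPolyhedralMap L sym := isPolyhedralMap_of_checkMap hmap fun d hd =>
    let ⟨_, hc⟩ := hex d hd
    hmem (hswap hc)
  -- A dart lies on one face and at one place of its boundary, so it has only one label.
  have huniq : ∀ d c c', IsLabel step LS d c → IsLabel step LS d c' → c = c' := by
    rintro d c c' ⟨p, hp, i, hi, hpi, rfl⟩ ⟨q, hq, j, hj, hqj, rfl⟩
    have hpq : p.1 = q.1 := FaceLattice.face_eq_of_dart_mem hL (hmemL p hp) (hmemL q hq)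
      (hpi ▸ List.getElem_mem hi) (hqj ▸ List.getElem_mem hj)
    obtain rfl : p = q := List.inj_on_of_nodup_map (hfst.symm ▸ FaceLattice.nodup_faces hL)
      hp hq hpq
    have hnd : (darts p.1).Nodup := (List.nodup_flatMap.1 hL.nodup_darts).1 _ (hmemL p hp)
    rw [hnd.getElem_inj_iff.1 (hpi.trans hqj.symm)]
  classical
  let code : ℕ × ℕ → ℕ := fun d => if h : ∃ c, IsLabel step LS d c then h.choose else 0
  have hcode : ∀ {d}, d ∈ L.flatMap darts → IsLabel step LS d (code d) := fun {d} hd => by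
    simp only [code, dif_pos (hex d hd)]
    exact (hex d hd).choose_spec
  have hcode' : ∀ {d c}, IsLabel step LS d c → code d = c := fun hc =>
    huniq _ _ _ (hcode (hmem hc)) hc
  -- On labels of darts the reduction in `Fin.ofNat` changes nothing, as their digits are below the
  -- degree by `hdigit`; elsewhere the value is irrelevant.
  let t : ℕ × ℕ → Fin C.width → Fin C.degree := fun d k => Fin.ofNat _ (codeApply (code d) k)
  have ht : ∀ {d}, d ∈ L.flatMap darts → ∀ k, (t d k : ℕ) = codeApply (code d) k := fun hd k =>
    Nat.mod_eq_of_lt (hdigit (hcode hd) k k.2)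
  have hgen : ∀ {i : Fin 3} {a : ℕ}, IsCode a (g i) → ∀ {d}, d ∈ L.flatMap darts → ∀ k,
      (g i (t d k) : ℕ) = codeApply a (codeApply (code d) k) := @fun i a ha d hd k => by
    rw [← ha, ht hd]
  have hmul : ∀ {i : Fin 3} {a : ℕ}, IsCode a (g i) → ∀ {d d'}, d ∈ L.flatMap darts →
      IsLabel step LS d' (mulCode C.width C.gen₀ a (code d)) → ∀ k,
      t d' k = g i (g 0 (t d k)) := @fun i a ha d d' hd hd' k => by
    rw [Fin.ext_iff, ht (hmem hd'), hcode' hd', codeApply_mulCode k.2, ← ha, hgen h0 hd]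
  have hT' : ∀ e ∈ T, (e.1, e.2.1) ∈ L.flatMap darts ∧ code (e.1, e.2.1) = e.2.2 := fun e he =>
    ⟨hmem ((hT e).1 he), hcode' ((hT e).1 he)⟩
  refine ⟨hL, t, ⟨⟨hg, fun f hf u v w huv hvw => ?_, fun u v huv => ?_⟩, ?_, fun x => ?_⟩⟩
  · obtain ⟨p, hp, rfl⟩ := List.mem_map.1 (hfst.symm ▸ hf)
    have hd := List.mem_flatMap.2 ⟨_, hf, huv⟩
    exact hmul h1 hd (IsLabel.next (fun p hp => hL.nodup _ (hmemL p hp)) hcyc huniq hp huv hvw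
      (hcode hd))
  · exact hmul h2 huv (hswap (hcode huv))
  · cases T with
    | nil => exact absurd hbase Bool.false_ne_true
    | cons e₀ T =>
      have hb := allB_eq_true.1 hbase
      obtain ⟨he₀, hc₀⟩ := hT' e₀ List.mem_cons_self
      refine ⟨_, he₀, fun d hd => ?_⟩
      have := hb (d.1, d.2, code d) ((hT _).2 (hcode hd))
      simp only [checkBase, Bool.and_eq_true, Bool.or_eq_true, natBeq_eq_true, anyBelow_eq_true,
        Bool.not_eq_true', ← Bool.not_eq_true] at this
      obtain ⟨h3, k, hk, h4⟩ := this
      refine ⟨fun he => ?_, ⟨k, hk⟩, fun he => h4 ?_⟩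
      · rcases h3 with ⟨h3, h5⟩ | ⟨k, hk, h3⟩
        · exact Prod.ext h3 h5
        · refine absurd ?_ h3
          rw [← hc₀]
          exact (ht hd ⟨k, hk⟩).symm.trans ((congrArg Fin.val (congrFun he ⟨k, hk⟩)).trans
            (ht he₀ ⟨k, hk⟩))
      · rw [← hc₀]
        exact (hgen h0 hd ⟨k, hk⟩).symm.trans ((congrArg Fin.val he).trans (ht he₀ ⟨k, hk⟩))
  · obtain ⟨e, he, h3⟩ := anyB_eq_true.1 (allBelow_eq_true.1 hsurj x x.2)
    obtain ⟨k, hk, h4⟩ := anyBelow_eq_true.1 h3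
    rw [force_eq, Bool.or_eq_true, natBeq_eq_true, natBeq_eq_true] at h4
    obtain ⟨hd, hc⟩ := hT' e he
    rw [← hc] at h4
    exact ⟨_, hd, ⟨k, hk⟩, h4.imp (fun h => Fin.ext ((ht hd ⟨k, hk⟩).trans h))
      fun h => Fin.ext ((hgen h0 hd ⟨k, hk⟩).trans h)⟩

end ArchPoly

/-! ### The monodromy group as the group of the minimal regular cover -/

namespace ArchPoly

universe v

theorem exists_minimal_cover {L : List (List ℕ)} {sym : List ℕ} {p q N n d : ℕ} {κ : Type*}
    (hL : IsPolyhedralMap L sym) {g : Fin 3 → Equiv.Perm (Fin d)} {t : ℕ × ℕ → κ → Fin d}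
    (ht : IsFaithfulLabelling L g t) (hp : orderOf (g 1 * g 0) = p) (hq : orderOf (g 2 * g 1) = q)
    (hN : Nat.card (Subgroup.closure (Set.range g)) = N)
    (hn : n * (2 * (L.flatMap darts).length) = N) :
    IsPolytope 3 (FaceLattice L) ∧ HasVertexSymbol (FaceLattice L) sym ∧
    ∃ (W : Type) (_ : Group W) (S : StringCGroup W 3)
      (act : Flag (FaceLattice L) → W → Flag (FaceLattice L)) (hact : IsFlagAction S.gen act),
      Finite W ∧ Finite S.Face ∧ IsRegularPolytope 3 S.Face ∧ Function.Bijective S.toAut ∧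
      orderOf (S.gen 0 * S.gen 1) = p ∧ orderOf (S.gen 1 * S.gen 2) = q ∧ Nat.card W = N ∧
      (∀ Φ : Flag (FaceLattice L), Nat.card (hact.stabilizer Φ) = n ∧
        (hact.stabilizer Φ).normalCore = ⊥ ∧
        Nonempty (FaceLattice L ≃o S.QuotientFace (hact.stabilizer Φ))) ∧
      (∀ (R : Type v) [PartialOrder R], IsRegularPolytope 3 R →
        ∀ (Ψ : Flag R) (ρ : Fin 3 → (R ≃o R)), (∀ i : Fin 3, Adjacent i Ψ (Flag.map (ρ i) Ψ)) →
        ∀ (act' : Flag (FaceLattice L) → (R ≃o R) → Flag (FaceLattice L))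
          (hact' : IsFlagAction ρ act'),
          (∃ π : (R ≃o R) →* W, Function.Surjective π ∧ (∀ i, π (ρ i) = S.gen i) ∧
            ∀ Φ : Flag (FaceLattice L), π.ker = (hact'.stabilizer Φ).normalCore) ∧
          ∃ γ : R → S.Face, IsCovering γ) := by
  have h := FaceLattice.isPolytope hL
  have hτ := fun i Φ k => FaceLattice.flagLabel_adj hL ht.toIsLabelling i Φ k
  obtain ⟨d₀, hd₀, hbase⟩ := ht.base
  -- The distinguished flag is the one at the start of `d₀`.
  obtain ⟨Φ₀, hΦ₀⟩ := (FaceLattice.position_bijective (hL := hL)).2 (⟨d₀, hd₀⟩, false)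
  have hpos : ∀ Φ k, FaceLattice.flagLabel hL g t Φ k = if (FaceLattice.position hL Φ).2 then
      g 0 (t (FaceLattice.position hL Φ).1 k) else t (FaceLattice.position hL Φ).1 k :=
    fun _ _ => rfl
  -- Flags at the start of a dart are told apart from `Φ₀` by the first half of `hbase`, flags at
  -- the end of a dart by the second half.
  have hbase' : ∀ Φ, FaceLattice.flagLabel hL g t Φ = FaceLattice.flagLabel hL g t Φ₀ → Φ = Φ₀ := by
    intro Φ he
    refine (FaceLattice.position_bijective (hL := hL)).1 ?_
    have he' := fun k => congrFun he k
    simp only [hpos, hΦ₀] at he'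
    rw [hΦ₀]
    generalize FaceLattice.position hL Φ = x at he' ⊢
    obtain ⟨⟨d, hd⟩, b⟩ := x
    cases b with
    | false =>
      obtain rfl := (hbase d hd).1 (funext he')
      rfl
    | true =>
      obtain ⟨k, hk⟩ := (hbase d hd).2
      exact absurd (he' k) hk
  have hsurj : ∀ x, ∃ Φ k, FaceLattice.flagLabel hL g t Φ k = x := by
    intro x
    obtain ⟨d, hd, k, hk⟩ := ht.surj x
    rcases hk with hk | hk
    · obtain ⟨Φ, hΦ⟩ := (FaceLattice.position_bijective (hL := hL)).2 (⟨d, hd⟩, false)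
      exact ⟨Φ, k, by rw [hpos, hΦ]; exact hk⟩
    · obtain ⟨Φ, hΦ⟩ := (FaceLattice.position_bijective (hL := hL)).2 (⟨d, hd⟩, true)
      exact ⟨Φ, k, by rw [hpos, hΦ]; exact hk⟩
  have hcard : Nat.card h.monodromy = N := (h.card_monodromy hτ hbase' hsurj).trans hN
  let S := h.stringCGroup (fun Φ => (FaceLattice.position hL Φ).2) FaceLattice.position_adj_snd
  have hD : 0 < (L.flatMap darts).length := List.length_pos_of_mem hd₀
  have hfin : Finite h.monodromy := by
    refine Nat.finite_of_card_ne_zero ?_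
    rw [h.card_monodromy hτ hbase' hsurj]
    exact Nat.card_pos.ne'
  refine ⟨h, FaceLattice.hasVertexSymbol hL, h.monodromy, inferInstance, S, h.monodromyAct,
    h.isFlagAction_monodromyAct, hfin, S.finite_face, S.isRegularPolytope, S.bijective_toAut,
    (h.orderOf_monodromyGen_mul hτ hbase' hsurj 0 1).trans hp,
    (h.orderOf_monodromyGen_mul hτ hbase' hsurj 1 2).trans hq, hcard, fun Φ => ⟨?_,
      h.normalCore_stabilizer_monodromy Φ,
      IsFlagAction.nonempty_orderIso_quotient (S := S) h.isFlagAction_monodromyAct h Φ⟩, ?_⟩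
  -- The number of flags is twice the number of darts, so `hn` and the orbit-stabilizer theorem
  -- determine the order of the stabilizer by cancellation.
  · have h1 := h.isFlagAction_monodromyAct.card_stabilizer h Φ
    rw [hcard, ← hn, FaceLattice.card_flag hL] at h1
    exact Nat.eq_of_mul_eq_mul_right (by omega) h1
  · intro R _ hR Ψ ρ hρ act' hact'
    obtain ⟨π, hπ, hgen, hker⟩ := h.exists_hom_monodromy hR.1 hρ hact'
    exact ⟨⟨π, hπ, hgen, hker⟩, hR.1.exists_isCovering hρ S π hπ hgen⟩

def forceList (f : List ℕ) : (List ℕ → Bool) → Bool :=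
  List.rec (fun k => k []) (fun v _ r k => force v fun v' => r fun t => k (v' :: t)) f

/-- Evaluates `L` before it is passed to `k`. -/
def forceFaces (L : List (List ℕ)) : (List (List ℕ) → Bool) → Bool :=
  List.rec (fun k => k []) (fun f _ r k => forceList f fun f' => r fun t => k (f' :: t)) L

theorem forceList_eq (f : List ℕ) (k : List ℕ → Bool) : forceList f k = k f := by
  induction f generalizing k with
  | nil => rfl
  | cons v f ih =>
    change force v (fun v' => forceList f fun t => k (v' :: t)) = _
    rw [force_eq, ih]

theorem forceFaces_eq (L : List (List ℕ)) (k : List (List ℕ) → Bool) : forceFaces L k = k L := by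
  induction L generalizing k with
  | nil => rfl
  | cons f L ih =>
    change forceList f (fun f' => forceFaces L fun t => k (f' :: t)) = _
    rw [forceList_eq, ih]

/-- The certificate `C` describes the monodromy group of the polyhedron with the faces `L`. -/
def Certificate.check (C : Certificate) (L : List (List ℕ)) (sym : List ℕ) (p q N n : ℕ) : Bool :=
  forceFaces L fun L => checkMap L sym && checkLabels C L && checkGroup C p q N &&
    Nat.beq (n * (2 * (L.map List.length).sum)) N

theorem Certificate.sound {C : Certificate} {L : List (List ℕ)} {sym : List ℕ}
    {p q N n : ℕ} (h : C.check L sym p q N n = true) :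
    IsPolyhedralMap L sym ∧ ∃ g : Fin 3 → Equiv.Perm (Fin C.degree),
      (∃ t : ℕ × ℕ → Fin C.width → Fin C.degree, IsFaithfulLabelling L g t) ∧
      orderOf (g 1 * g 0) = p ∧ orderOf (g 2 * g 1) = q ∧
      Nat.card (Subgroup.closure (Set.range g)) = N ∧
      n * (2 * (L.flatMap darts).length) = N := by
  rw [Certificate.check, forceFaces_eq, Bool.and_eq_true, Bool.and_eq_true, Bool.and_eq_true, natBeq_eq_true] at h
  obtain ⟨⟨⟨h1, h2⟩, h3⟩, h4⟩ := h
  obtain ⟨hd, g, ha, hb, hc, hg, hp, hq, hN⟩ := exists_of_checkGroup h3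
  obtain ⟨hL, t, ht⟩ := exists_of_checkLabels h1 h2 hd ha hb hc hg
  refine ⟨hL, g, ⟨t, ht⟩, hp, hq, hN, ?_⟩
  rw [← h4, List.length_flatMap]
  simp only [length_darts]

end ArchPoly

/-! ### The fourteen certificates and their verification -/

namespace ArchPoly

namespace Sporadic

/-- Data for the computation of the monodromy group. -/
def certificate : Sporadic → Certificate
  | truncatedTetrahedron =>
    ⟨12, 30882678528510771241130610278554439718229280, 30839293845652259294748561119121456514191397,
    14090753964910065793305150422572416849367566, 3, [1216009369338933642592640,
    1223148259295459239068419, 1209036500079071432081414, 1822833462387683052585472,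
    3345944227065733310497928, 2443990675581704784184713, 2743842500499853545719048,
    2739175474249205029159947], [(0, [(0, 0), (1, 9)]), (5, [(0, 10), (0, 5)]), (1, [(1, 7)]), (2,
    [])]⟩
  | truncatedOctahedron =>
    ⟨18, 197798270029568194411989776660711787933411610504096044579,
    209868163190844341785955943437949973358504438388230214453,
    24811802683520230289348878619854470533230097706249116324, 3, [1211287002856063997378688,
    314203391807494792692361, 1530046740449765049320448, 2427462392891661025935881,
    311676187869396584120832, 1227981306242771141592073, 2429657555436432462578304,
    1513684478456384677036169, 4876064754491793198024844, 3662453461882441797142414,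
    4564480800342765161662097, 5175935026154015669110796, 4262230898695034158417552,
    3967046100027533913442318], [(0, [(1, 17), (1, 2), (1, 13)]), (1, [(2, 8), (1, 5), (2, 5)]), (4,
    [(0, 4), (1, 5), (0, 5)]), (2, [(2, 6), (1, 2), (0, 6)]), (3, [(1, 3), (2, 3)]), (12, [(1,
    12)]), (14, [])]⟩
  | cuboctahedron =>
    ⟨12, 28116863439873295332893959596498940620101153, 16923272342647367906553511641472603187974826,
    14025591117107924272553606107067596004592403, 3, [1211287002856063997378688,
    1518240824242590936285568, 9463179709812999979521, 611620246507913893413252,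
    11861256439395241689731, 606916326769117957750917, 3341184967094716246180742,
    3338842230597355133125383, 3043694325418002307253383, 3041314695432493775094790,
    3343601490568372197442569, 3345944227065733310497928, 3039008852423280081142665,
    3036629222437771548984072], [(0, [(1, 6), (1, 3), (0, 2)]), (1, [(0, 5), (1, 3)]), (4, [(0, 4),
    (0, 5)]), (6, [(1, 9), (0, 9)]), (7, [])]⟩
  | truncatedCube =>
    ⟨18, 197799006717383193973025483108294509473201183751664276138,
    209868163145557146009335745640218035644619381269773080083,
    74232550698341734844935340780849325092650764090927620163, 3, [2427296372194997639971328,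
    3334027630394116940153346, 630509712439392474269060, 2422647792688422832963844,
    18963252907773419062276, 3324619790916525068828676, 5175935026154015669110796,
    4876120094724014326679695, 3969370389780821316946060, 4269296001675264916686863,
    4262157111718739320211084, 3962342180288737977779983, 5168906816661932329944719,
    4868981204767488730203916], [(0, [(1, 14), (0, 2), (0, 15)]), (4, [(2, 4), (1, 11)]), (8, [(0,
    8), (0, 11)]), (1, [(1, 12), (0, 3)]), (6, [(0, 10), (0, 6)]), (12, [(0, 13)]), (13, [])]⟩
  | icosidodecahedron =>
    ⟨14, 552729785863833060827418227478219341200567719712,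
    552729786031326172894909685782888792901758408229,
    460677927738128206534286657365929693636446755991, 4, [77697095742654272705152256,
    155370579652894197184234752, 39918163879697110993536256, 930379984101614945355012,
    155370634993126418312889603, 116382758863810553716950274, 116382795757298701136053508,
    155370598099638270893786369, 38709274953570629237867778, 78301558652461587292538112,
    1232592992261198529496323, 1232574545517124819944706, 311629056438288256216450565,
    195269983193868345563776519, 273547911567171510920693254, 234560109224831941162960393,
    349710275096381296350414344, 234862322232991524747101704, 311629130225264551054657033,
    349710238202893148931311110, 349710256649637222640862727, 234560035437855646324753925,
    272641198755716465330062853, 195572233095516076567021064, 195572196202027929147917830,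
    312233556241583718222939655, 272641272542692760168269321, 195874446103675660151162375,
    312233519348095570803836421, 233653414860120969281881609, 312233537794839644513388038,
    272641254095948686458717704], [(10, [(1, 11), (1, 13)]), (0, [(0, 2), (0, 1)]), (1, [(1, 4), (0,
    4)]), (2, [(1, 4), (0, 3)]), (5, [(1, 6), (1, 8)]), (6, [(0, 9)]), (7, [])]⟩
  | truncatedIcosahedron =>
    ⟨21, 492553410375883385331115410316133972202765174785322401154955063,
    492550247498122219359120089351684660046210154483393889100693013,
    440732821519280343236045028398367089800832194346846613064472923, 4,
    [155080154114197714003576704, 349717284859129305980028804, 38721209996986319317763977,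
    194672493153320893186901889, 2755593076474806530099077, 40232275037784237238470532,
    2755519289498511691892609, 194672474706576819477350272, 348508377486258750514808709,
    154778088679990720095848329, 348206127584611019511564164, 193765946362562510982236041,
    1244435801956520061634437, 41441127070422571575035776, 156289098380556416887900033,
    196183631981095105945814912, 39930062029624653654329221, 348206072244378798382909313,
    156289245954509006564312969, 337722990501474471004036, 467597107684985832068008330,
    506282733912653965660703114, 545270646935457977675745677, 428609323789390336019827086,
    468201589041537220364945803, 544968360140322099253397898, 391132568041104610473249163,
    468201570594793146655394186, 544968397033810246672501132, 545572823050129413840783754,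
    429213768252453576897661325, 505980576244726603205216654], [(15, [(1, 17), (1, 20)]), (17, [(1,
    19), (0, 17)]), (0, [(1, 1), (1, 5)]), (1, [(1, 1), (0, 9)]), (4, [(0, 9), (1, 9), (1, 4)]), (2,
    [(2, 8), (0, 3)]), (3, [(1, 3), (1, 6)]), (6, [(1, 8), (0, 7)]), (10, [(1, 11), (0, 12)]), (11,
    [(1, 13)]), (12, [])]⟩
  | smallRhombicuboctahedron =>
    ⟨24, 1249076699453162290088258216356787550188271560883936946432433654017970,
    1195992747947235760991642681591470072968288617622952292579294989476699,
    272567983021484692840435849222513090552050089106211465343210106781417, 3,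
    [911416731193841526292736, 1213666632841572529537281, 7120443212451886924162,
    1209018053334997722529797, 311713081357544003224066, 909147781672775251443845,
    3043675878673928597701766, 2743805607011706126615814, 2441666385828417380680971,
    2137073747683325264381067, 2134620330721521894016006, 2434490602383744365101958,
    3041406929152862322852875, 2736814291007770206552971, 6099157673555031308438412,
    3671935088336328506673552, 3974240330216280638572948, 5789861115671143256476173,
    6980026596562809817253396, 6982313992827949801653904, 4880787120974662843238796,
    3681453608278362635307924, 5771026989971885804275216, 5773461960189615465088660,
    3983611276205725090794384, 6089731387333365727562125], [(0, [(0, 0), (1, 13), (1, 10)]), (2,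
    [(0, 2), (2, 3)]), (3, [(1, 4), (1, 3)]), (6, [(0, 11), (0, 9)]), (7, [(1, 9), (1, 8), (1,
    10)]), (12, [(0, 13), (2, 20), (1, 19)]), (16, [(1, 16), (1, 19)]), (14, [(0, 22)]), (17, [])]⟩
  | pseudorhombicuboctahedron =>
    ⟨96,
    267569243666483835405646019514522266385390618907045483055382183660440369958924100767148363025163608456112393326250555242412332665998507259406784141064966642633469524331365259417906915626834307683763670957511433539861490510,
    250581376752084055242122216122279733911649823158870640533860455459261586630912059936936612305018369089283136034052004277288911146603513567183129119390004517306293578955902539536346964034590095238828830207657337418147539720,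
    233404512523832050014083682485510753863330626085563364278007500813287536037129896668283283905028423303780480221233047903975471735354722902377698701940641827774361443670801713977829388907410972186298851813549245090100556177,
    2, [2361183241434822606976, 21398223125503079875720, 78214194872528498856080,
    59472302893639594413208, 40730410914750689970336, 111713482110385044592552,
    97657063126218366260398, 140269041936487430495668, 126212622952320752163514,
    154657502313980880756928, 183065488187493590247108, 202028741095267009309384,
    221065780979335266578128, 211768621966185652563160, 192952943011001909913820,
    173915903126933652645076, 164323596208604685804236, 40287689056981660731528,
    59619876846229270826144, 78361768825118175269016, 21545797078092756288656,
    111824162574827301902254, 125880581558993980234408, 140379722400929687805370,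
    97767743590660623570100, 16602069666338596455300], [(0, [(1, 25), (1, 41)]), (1, [(1, 1), (1,
    3)]), (8, [(1, 92), (0, 38)]), (10, [(1, 58), (0, 76)]), (11, [(0, 89), (0, 41)]), (12, [(1,
    60), (1, 72)]), (40, [(0, 56), (1, 88)]), (42, [(0, 76), (1, 86)]), (43, [(1, 71), (0, 69)]),
    (64, [(1, 80), (0, 74)]), (66, [(1, 78), (0, 68)]), (67, [(1, 67)]), (68, [])]⟩
  | snubCube =>
    ⟨40,
    10724710443095434132275179441889904618098042644147255294821088796377908220050197509778883826035407008549,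
    9600497481469423046550071020497789923135037366861831129940982522071677449626631492412117776006426675470,
    3952982169734722024986590516679754721069352031876464533068277418153493095224765739584048598524737983492,
    3, [1213648186097498819985664, 1813425622910091181260802, 1818184882881108245577988,
    14203992936756354745090, 1209036500079071432081414, 613907642773053877813760,
    3050796321886380484625928, 2446370305567213316343306, 4255073561994434852390156,
    4250351195511565207176204, 2451092672050082961557258, 3055518688369250129839880,
    3650647545675267684107534, 3645925179192398038893582, 8514721916519149673581328,
    10342388425854144628690454, 4916500017501364535169308, 6687498129041923747711010,
    10314054226956926757406742, 4888165818604146663885596, 6715832327939141618994722,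
    8543056115416367544865040, 10328332006869977950358300, 4902443598517197856837154,
    6729667385994423782707472, 8500665497534982995249174, 4916389337036922277859606,
    6687387448577481490401308, 8515053957912476445510434, 10342277745389702371380752,
    8500886858463867509868578, 10328110645941093435738896, 4902222237588313342217750,
    6729888746923308297326876, 6715500286545814847065616, 8543166795880809802174742,
    10314164907421369014716444, 4888276499068588921195298], [(0, [(1, 8), (2, 36), (1, 24)]), (2,
    [(2, 4), (2, 6), (1, 2)]), (4, [(1, 6), (0, 6)]), (9, [(1, 13), (0, 15)]), (11, [(1, 15), (1,
    11)]), (13, [(0, 15), (1, 13), (1, 15)]), (1, [(2, 17), (1, 19), (1, 37)]), (3, [(1, 5), (2, 3),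
    (2, 5)]), (5, [(0, 7), (0, 5), (2, 5)]), (8, [(1, 10), (0, 14), (2, 12)]), (10, [(0, 10), (1,
    14), (2, 10)]), (12, [(0, 12), (2, 14), (2, 12)]), (16, [(0, 20), (2, 28), (0, 16), (2, 24), (2,
    26)]), (22, [(3, 34), (2, 22), (0, 28), (1, 28), (4, 28)]), (28, [(4, 34), (3, 34), (1, 34), (2,
    28)]), (17, [(3, 35), (1, 29), (0, 17), (0, 29)]), (23, [(0, 35), (1, 29), (2, 23), (2, 29)]),
    (29, [(3, 29), (1, 35), (2, 35)]), (18, [(1, 30), (0, 30), (2, 24)]), (24, [(1, 30), (2, 24),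
    (1, 24)]), (30, [(1, 36), (2, 30), (1, 30)]), (19, [(2, 37), (0, 37), (1, 37)]), (25, [(2, 25),
    (1, 37)]), (31, [(1, 37), (1, 31), (0, 37)]), (20, [(2, 20), (2, 38), (2, 32)]), (26, [(2, 38),
    (2, 26)]), (32, [(0, 32), (0, 38)]), (21, [(1, 33)]), (27, [])]⟩
  | smallRhombicosidodecahedron =>
    ⟨28, 379398777653643441770709067396772374952463355200774830678503916721923233363408,
    350226379570580231486715087270062786201130775498878090793311069498683322071649,
    321046859102664968188417040115848265289883574052767045843356780026822380014332, 4,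
    [77720707575068620931222016, 77418531460397184766183939, 78325188931620009228159489,
    116104139241321244649327106, 1256204824675546755566083, 155091960030404888116611584,
    117313028167447726404995584, 155394246825540766538959363, 77720781362044915769428484,
    38732886785984977463937538, 953936476283742042769921, 77418494566909037347080705,
    311350436815798947148827397, 234281471155598558385785608, 273571523399585859146763014,
    349733868482051570866932487, 195898094829578155796335369, 196200270944249591961373446,
    350640525953274395328908037, 272362652920203451100646153, 311652742057678899280726793,
    195293595026282693789846279, 272664865928363034684787464, 234583647270269994550823685,
    272664810588130813556132613, 312257149627253992739457798, 350338349838602959163869960,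
    311350473709287094567930631, 195898039489345934667680518, 195595863374674498502642441,
    349733850035307497157380870, 234885934065405872973171464, 547095786240854874422283274,
    700931670573792731750190094, 583665939858149996635540498, 391144373957311784586284043,
    428621148152341583842413583, 390237808719809328672066578, 429829981738235844469427210,
    583363579276037823374986251, 699722763200922176284969999, 546189110322887976250756107,
    392353373563902708599262223, 429830129312188434145840146, 585781486255499302853184526,
    700629365331912779618290698, 544677953048369689782291467, 700629383778656853327842315,
    544980313630481863042845714, 391446660752447663008631822, 430132286980115796601326606,
    585781412468523008014978058, 547095878474575242970041359, 391144503084520300553145362,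
    428621129705597510132861966, 391446605412215441879976971, 699420457959042224153070603,
    428621203492573804971068434, 431038999791570842191957007, 699722744754178102575418382,
    546189091876143902541204490, 583665866071173701797334030], [(20, [(1, 21), (1, 22)]), (24, [(0,
    26), (1, 26)]), (0, [(1, 2), (0, 3)]), (1, [(1, 3), (1, 2)]), (2, [(0, 3), (1, 3), (1, 4)]), (5,
    [(2, 9), (2, 7)]), (6, [(1, 8), (1, 7)]), (7, [(0, 8), (1, 9)]), (10, [(0, 15), (1, 11)]), (11,
    [(1, 11), (1, 15)]), (14, [(0, 18), (1, 15)]), (12, [(0, 13), (1, 13)]), (13, [(0, 13)]), (16,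
    [])]⟩
  | greatRhombicosidodecahedron =>
    ⟨42,
    184959886540517455925123629174951269945017605723186561821372273207951206588868157464656543167730870397475848,
    175714784521053785299620333812230869829010437146307677417957322287767954472770373721653256972785803886212008,
    166466861085917900162669962510146971135259143560109080693114327047361819968129012036113880932810245836867075,
    4, [155720034772626550930067200, 310764771138202742594539264, 118545565819476703805837056,
    2186603255521235410472712, 310764900265411258561400583, 271776987242607246546358020,
    271777061029583541384564488, 310764826478434963723194115, 116127787967223740294500100,
    156928960592241180104838912, 2488816263680818994614023, 2488760923448597865959172,
    661967350936658994251665674, 390261346765247382059929870, 547119416520013296357904651,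
    430760435509313754252988690, 699444180471921014636450065, 431062648517473337837130001,
    661967498510611583928078610, 699444069791456572379140363, 699444125131688793507795214,
    430760287935361164576575754, 545003777888943621592502538, 391168096470190575069663505,
    391167985789726132812353803, 663176350543249918264643854, 545003925462896211268915474,
    392074735494669325822087438, 663176276756273623426437386, 428644815324988153197138194,
    663176295203017697135989003, 545003907016152137559363857, 934891983915068006842323732,
    781358423270754175355867925, 820950817650109575667847961, 1089332331157813178757616408,
    974484452081399701992510236, 975693304114038036329075480, 934892131489020596518736668,
    1089332349604557252467168025, 974484322954191186025648917, 1089332275817580957628961557,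
    974484304507447112316097300, 820950799203365501958296344, 820044031051678235239011092,
    780149552791371767309751064, 934589900034116939225043740, 934589770906908423258182421,
    937007622546137681607725845, 1090843414645355170387874580, 820044178625630824915424028,
    780149571238115841019302681, 781056191815850518062174997, 937007604099393607898174228,
    1090843488432331465226081048, 973275526261785072817738524, 973275452474808777979532056,
    937007696333113976445932313, 819741891830494946493076249, 820044104838654530077217560,
    780149626578348062147957532, 1090843433092099244097426197], [(30, [(1, 39), (1, 31)]), (0, [(1,
    3), (1, 4), (0, 4)]), (3, [(0, 7), (0, 4), (2, 8)]), (4, [(2, 7), (0, 7), (1, 7)]), (1, [(2, 5),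
    (2, 6), (0, 5)]), (2, [(0, 9), (2, 5), (2, 9)]), (5, [(1, 6), (2, 6), (0, 5)]), (10, [(2, 18),
    (2, 17)]), (11, [(0, 11), (0, 17), (1, 14)]), (14, [(1, 18), (0, 17), (2, 17)]), (12, [(2, 12),
    (1, 15)]), (13, [(1, 16), (1, 19)]), (15, [(0, 19), (1, 19)]), (20, [(0, 28), (1, 28)]), (21,
    [(0, 28), (1, 24)]), (24, [(0, 25), (0, 24)]), (22, [(1, 29), (1, 22)]), (23, [(0, 27)]), (26,
    [])]⟩
  | snubDodecahedron =>
    ⟨50,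
    15992808953233151062598788185157838347375409444871771189693171343176726770935841415598327345120432527328080384540900867695760,
    14665572550835577714638351651838955571668593156583709289052692880418099429508133167619220468533626743446523814680120642188317,
    3334620006175289247381323085984854365591362504774961140684892117016762611005096442714197120334041828734730924633631427552052,
    3, [1213648186097498819985664, 4869940435459321626888, 2422647792688422832963844,
    1832315088841569762116610, 14314673401198612054792, 1209036500079071432081414,
    1227925966010550012937222, 9592306918328966840840, 604536696783609425592324,
    1818111095904813407371520, 2432055632166014704288514, 2417888532717405768646658,
    4269203767954896368928778, 5473517901551098155796240, 3669537011606746264963342,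
    3050980789327117580142098, 4859536471801749439776012, 3650721332651562522314002,
    4259759034989157078500874, 4878425937733228020631820, 4868981204767488730203916,
    3060425522292856870570002, 5478203374545820381906958, 4255147348970729690596624,
    4274036814902208271452432, 3660018491664712136328970, 5468758641580081091479054,
    3055666262321839806252816, 3664740858147581781542922, 4864369518749061342299666,
    3669463224630451426756874, 5464036275097211446265102, 9733166256075812976987412,
    11560832765410807932096538, 13388499274745802887205664, 6149222136971079031526950,
    7906053149063029308426796, 6106831519089694481911084, 7933944626102478150471700,
    9761611135437473105580826, 11589277644772468060689952, 13346108656864418337589798,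
    13360165075848585015921952, 6120887938073861160243238, 7948554447408856115352364,
    9775667554421639783912980, 11532498566513590060812826, 11589166964308025803380250,
    13345997976399976080280096, 6106720838625252224601382, 7934387347960247179710508,
    9761500454973030848271124, 6135165717986912353194796, 7962278824999696021755412,
    9719109837091646298655258, 11546776346426641253764384, 13374442855761636208873510,
    9719331198020530813274662, 11546997707355525768383788, 13374110814368309436944404,
    6134833676593585581265690, 7962500185928580536374816, 9775999595814966555842086,
    11532830607906916832741932, 13359943714919700501302548, 6120666577144976645623834,
    7948333086479971600732960, 6120998618538303417552940, 7948111725551087086113556,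
    9775778234886082041222682, 11532609246978032318122528, 13360275756313027273231654,
    7905831788134144793807392, 9733498297469139748916518, 11561164806804134704025644,
    13388277913816918372586260, 6149000776042194516907546, 11546554985497756739144980,
    13374221494832751694254106, 6134944357058027838575392, 7962610866393022793684518,
    9719441878484973070584364, 13388388594281360629895962, 6149111456506636774217248,
    7905942468598587051117094, 9733608977933582006226220, 11560722084946365674786836,
    13345887295935533822970394, 6106610158160809967291680, 7934276667495804922400806,
    9761943176830799877509932, 11589056283843583546070548], [(0, [(1, 17), (2, 46), (1, 6)]), (2,
    [(1, 6), (2, 4)]), (4, [(0, 8), (1, 6)]), (11, [(1, 13), (1, 17)]), (13, [(1, 19), (1, 17)]),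
    (15, [(1, 19), (0, 19)]), (1, [(1, 7), (1, 5)]), (3, [(1, 7), (0, 9)]), (5, [(0, 9), (1, 5)]),
    (10, [(1, 10), (0, 16)]), (12, [(1, 14), (1, 18)]), (14, [(1, 16), (0, 18)]), (20, [(1, 44), (0,
    48), (0, 26)]), (26, [(2, 26), (2, 44), (1, 44)]), (32, [(1, 38), (0, 32), (1, 44)]), (21, [(0,
    33), (2, 27), (1, 27)]), (27, [(2, 27), (1, 33), (1, 45)]), (33, [(0, 39), (2, 39), (1, 45)]),
    (22, [(2, 40), (1, 46)]), (28, [(1, 34), (0, 34)]), (34, [(0, 40), (1, 46)]), (23, [(0, 35), (0,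
    47)]), (29, [(0, 35), (1, 41)]), (35, [(0, 41), (1, 47)]), (24, [(1, 30), (1, 42)]), (30, [(1,
    42), (1, 36)]), (36, [(1, 36), (1, 42)]), (25, [(0, 49), (1, 25)]), (31, [(0, 43)]), (37, [])]⟩
  | truncatedDodecahedron =>
    ⟨21, 492553410375877630311606496709323703114601662788485513699850294,
    492550247498139803050607114512417707117526085835349064150512915,
    440732821519274406599224158863397395107988936647977830003071074, 4,
    [155684617024005028590962560, 154778070233246646386296712, 157195829638755536188082051,
    118208064189904113849452424, 309520556697175107047524231, 272043727161913086662739840,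
    117301351378449068258822023, 270834875129274752326174596, 157195774298523315059427200,
    942259687285083896596360, 311636103094524413265168259, 156893690417572247442147208,
    544968360140322099253397898, 390830336586200953179556235, 429213768252453576897661325,
    507189465170853084960885132, 467294950017058469612521870, 468503857389929025077741965,
    506282807699630260498909582, 428609286895902188600723852, 544666147132162515669256587,
    468503802049696803949087114, 429213712912221355769006474, 390830391926433174308211086,
    429515944367125013062699402, 544968415480554320382052749, 506584983814301696663947659,
    545572823050129413840783754, 467597181471962126906214798, 468503820496440877658638731,
    506282770806142113079806348, 390528142024785443304966541], [(15, [(1, 19), (1, 16)]), (17, [(1,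
    17), (0, 19)]), (0, [(0, 7), (1, 7)]), (3, [(1, 3), (0, 8)]), (4, [(0, 7), (1, 4), (1, 8)]), (1,
    [(1, 2), (2, 5)]), (2, [(0, 6), (1, 6)]), (5, [(0, 6), (0, 9)]), (10, [(0, 14), (1, 10)]), (11,
    [(1, 14)]), (12, [])]⟩
  | greatRhombicuboctahedron =>
    ⟨36,
    36774753831191473028320606319157438986178030270641426327975165864034599064283976362132269415133,
    35747960877868505688420736632609972242198937888013657201856435127546959541250242464037770300836,
    6421948422653717373454718154546230534043708646416355098922735164755994531509030316070376626375,
    3, [1520602007484025758892544, 3031796175490459646460418, 628148529197957651662084,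
    1515953427977450951885060, 11879703183468951241348, 3022388336012867775135748,
    6698898216879476250610316, 6399138625681696036834066, 4585639215795310017366796,
    4885620167921974745762450, 4871342388008923552810892, 4571582796811143339034642,
    6684841797895309572278162, 6384860845768644843882508, 9754490692225021218656664,
    7336712839972057707319708, 7639018081852009839219104, 9445175687597059457142808,
    9426360008641875714493468, 9428794978859605375306912, 8536120139644652753457048,
    7327341893982613255098272, 10635359615232799727471648, 10637647011497939711872156,
    7629499561909975710584732, 9745064406003355637780377], [(0, [(0, 0), (0, 1), (0, 31), (0, 17)]),
    (26, [(0, 26), (3, 27), (2, 27), (0, 27)]), (4, [(3, 5), (1, 5), (2, 10)]), (5, [(2, 5), (1,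
    10), (1, 5)]), (29, [(0, 33), (1, 29), (2, 33)]), (1, [(1, 3), (1, 6)]), (24, [(1, 25), (0, 24),
    (0, 25)]), (6, [(1, 11), (2, 7), (2, 6)]), (28, [(1, 32), (2, 32), (0, 28)]), (12, [(2, 16), (1,
    16), (1, 15)]), (13, [(1, 13), (0, 13)]), (14, [(1, 14)]), (15, [])]⟩

-- The representations have degree at most 96, while the polyhedra have between 72 and 720 flags.
-- Nothing is assumed about the certificates: the evaluation tests the boundary cycles, the
-- equivariance and separation of the labels, the orders of the products and the order of the group.
set_option maxRecDepth 100000 in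
set_option maxHeartbeats 0 in
theorem check_certificate (X : Sporadic) : X.certificate.check X.faces X.symbol X.schlafli.1
    X.schlafli.2 X.groupOrder X.stabilizerOrder = true := by
  cases X <;> decide +kernel

end Sporadic

end ArchPoly
theorem mainTheorem1 (X : Sporadic) :
    IsPolytope 3 X.Poly ∧ HasVertexSymbol X.Poly X.symbol ∧
    ∃ (W : Type) (_ : Group W) (S : StringCGroup W 3) (act : Flag X.Poly → W → Flag X.Poly)
      (hact : IsFlagAction S.gen act),
      -- `P(W)` is a finite regular polytope with automorphism group `W`
      Finite W ∧ Finite S.Face ∧ IsRegularPolytope 3 S.Face ∧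
      Function.Bijective S.toAut ∧
      -- Schläfli type and orders
      orderOf (S.gen 0 * S.gen 1) = X.schlafli.1 ∧ orderOf (S.gen 1 * S.gen 2) = X.schlafli.2 ∧
      Nat.card W = X.groupOrder ∧
      -- for every base flag, with stabilizer `N`, the polyhedron is `P(W)/N`
      (∀ Φ : Flag X.Poly, Nat.card (hact.stabilizer Φ) = X.stabilizerOrder ∧
        (hact.stabilizer Φ).normalCore = ⊥ ∧
        Nonempty (X.Poly ≃o S.QuotientFace (hact.stabilizer Φ))) ∧
      -- minimality: if the group of a regular polytope `R` acts by the flag action, then `W` is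
      -- the quotient of that group by the core of a flag stabilizer, and `R` covers `P(W)`
      (∀ (R : Type u) [PartialOrder R], IsRegularPolytope 3 R →
        ∀ (Ψ : Flag R) (ρ : Fin 3 → (R ≃o R)), (∀ i : Fin 3, Adjacent i Ψ (Flag.map (ρ i) Ψ)) →
        ∀ (act' : Flag X.Poly → (R ≃o R) → Flag X.Poly) (hact' : IsFlagAction ρ act'),
          (∃ π : (R ≃o R) →* W, Function.Surjective π ∧ (∀ i, π (ρ i) = S.gen i) ∧
            ∀ Φ : Flag X.Poly, π.ker = (hact'.stabilizer Φ).normalCore) ∧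
          ∃ γ : R → S.Face, IsCovering γ) := by
  obtain ⟨hL, g, ⟨t, ht⟩, hp, hq, hN, hn⟩ := Certificate.sound X.check_certificate
  exact exists_minimal_cover hL ht hp hq hN hn
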